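/- Let $N=2n+1$ with $n\ge 0$, let $V=\mathbb{C}^N$ carry a non-degenerate quadratic form $Q$ with Gram matrix $J$ (an invertible symmetric matrix), and put $G=SL(V)$, $K=SO(V,Q)=\{g\in G : g^tJg=J\}$. Let $\theta(g)=J^{-1}(g^t)^{-1}J$ be the corresponding involution of $G$, let $\mathfrak g_1=\{X\in\mathfrak{sl}(V): d\theta(X)=-X\}$, and let $\mathcal N_1$ be the set of nilpotent elements of $\mathfrak g_1$, on which $K$ acts by conjugation. For a partition $\lambda=(\lambda_1\ge\dots\ge\lambda_s>0)$ of $N$ let $\mathcal O_\lambda\subset\mathcal N_1$ be the set of $x\in\mathcal N_1$ whose Jordan blocks have sizes $\lambda_1,\dots,\lambda_s$. Say that $\lambda$ has gaps if $\lambda_i-\lambda_{i+1}\ge 2$ for some $i\in\{1,\dots,s\}$, where $\lambda_{s+1}=0$. Let $P\subsetneq G$ be a $\theta$-stable proper parabolic subgroup (the stabilizer of a flag of subspaces of $V$) and $L$ a $\theta$-stable Levi subgroup of $P$ (the stabilizer of the summands of a splitting of that flag). Write $\mathfrak l=\operatorname{Lie}L$, $\mathfrak l_1=\mathfrak l\cap\mathfrak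 g_1$, let $\mathfrak n_P$ be the nilpotent radical of $\operatorname{Lie}P$, and put $(\mathfrak n_P)_1=\mathfrak n_P\cap\mathfrak g_1$. If $\mathcal O$ is an $L^\theta$-orbit of nilpotent elements in $\mathfrak l_1$, then a $K$-orbit $\tilde{\mathcal O}\subset\mathcal N_1$ is said to be induced from $\mathcal O$ if $\tilde{\mathcal O}\cap(\mathcal O+(\mathfrak n_P)_1)$ is dense in $\mathcal O+(\mathfrak n_P)_1$. A $K$-orbit in $\mathcal N_1$ is called induced if it is induced from such an $\mathcal O$ for some such $P$ and $L$. Then, for every partition $\lambda$ of $2n+1$, the set $\mathcal O_\lambda$ is a single $K$-orbit in $\mathcal N_1$, and $\mathcal O_\lambda$ is induced if and only if $\lambda$ has gaps. -/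

import Mathlib

open scoped Pointwise MatrixGroups

namespace SymPair

/-! The symmetric pair `(SL(V), SO(V, Q))` for `V = ℂ^N`.  The quadratic form `Q` is given by its
Gram matrix `J`, an invertible matrix (which the theorem takes to be symmetric):
`⟨v, w⟩ = vᵀ J w`. -/

/-- The involution `θ(g) = J⁻¹ (gᵀ)⁻¹ J` of `SL(N, ℂ)`; for `J = 1` it is `g ↦ (gᵀ)⁻¹`. -/
noncomputable def theta {N : ℕ} (J : GL (Fin N) ℂ) :
    Matrix.SpecialLinearGroup (Fin N) ℂ →* Matrix.SpecialLinearGroup (Fin N) ℂ where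
  toFun g := ⟨((J⁻¹ : GL (Fin N) ℂ) : Matrix (Fin N) (Fin N) ℂ) *
      ((g⁻¹ : Matrix.SpecialLinearGroup (Fin N) ℂ) : Matrix (Fin N) (Fin N) ℂ).transpose *
      (J : Matrix (Fin N) (Fin N) ℂ), by
    rw [Matrix.det_mul, Matrix.det_mul, Matrix.det_transpose, Matrix.SpecialLinearGroup.det_coe,
      mul_one, ← Matrix.det_mul, Units.inv_mul, Matrix.det_one]⟩
  map_one' := by
    apply Subtype.ext
    simp
  map_mul' g h := by
    apply Subtype.ext
    have e : (J : Matrix (Fin N) (Fin N) ℂ) * ((J⁻¹ : GL (Fin N) ℂ) : Matrix (Fin N) (Fin N) ℂ) = 1 :=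
      Units.mul_inv J
    have e' : ((g * h)⁻¹ : Matrix.SpecialLinearGroup (Fin N) ℂ) = h⁻¹ * g⁻¹ := mul_inv_rev g h
    change ((J⁻¹ : GL (Fin N) ℂ) : Matrix (Fin N) (Fin N) ℂ) *
        (((g * h)⁻¹ : Matrix.SpecialLinearGroup (Fin N) ℂ) : Matrix (Fin N) (Fin N) ℂ).transpose *
        (J : Matrix (Fin N) (Fin N) ℂ) =
      (((J⁻¹ : GL (Fin N) ℂ) : Matrix (Fin N) (Fin N) ℂ) *
        ((g⁻¹ : Matrix.SpecialLinearGroup (Fin N) ℂ) : Matrix (Fin N) (Fin N) ℂ).transpose *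
        (J : Matrix (Fin N) (Fin N) ℂ)) *
      (((J⁻¹ : GL (Fin N) ℂ) : Matrix (Fin N) (Fin N) ℂ) *
        ((h⁻¹ : Matrix.SpecialLinearGroup (Fin N) ℂ) : Matrix (Fin N) (Fin N) ℂ).transpose *
        (J : Matrix (Fin N) (Fin N) ℂ))
    rw [e', Matrix.SpecialLinearGroup.coe_mul, Matrix.transpose_mul]
    simp only [mul_assoc]
    rw [← mul_assoc (J : Matrix (Fin N) (Fin N) ℂ), e, one_mul]

/-- The differential `dθ(X) = - J⁻¹ Xᵀ J` of `θ`. -/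
noncomputable def dtheta {N : ℕ} (J : GL (Fin N) ℂ) (X : Matrix (Fin N) (Fin N) ℂ) :
    Matrix (Fin N) (Fin N) ℂ :=
  -(((J⁻¹ : GL (Fin N) ℂ) : Matrix (Fin N) (Fin N) ℂ) * X.transpose *
    (J : Matrix (Fin N) (Fin N) ℂ))

/-- `K = SO(V, Q)`: the elements `g` of `SL(N, ℂ)` with `gᵀ J g = J`. -/
def SO {N : ℕ} (J : GL (Fin N) ℂ) : Subgroup (Matrix.SpecialLinearGroup (Fin N) ℂ) where
  carrier := {g | (g : Matrix (Fin N) (Fin N) ℂ).transpose * (J : Matrix (Fin N) (Fin N) ℂ) *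
    (g : Matrix (Fin N) (Fin N) ℂ) = (J : Matrix (Fin N) (Fin N) ℂ)}
  one_mem' := by simp
  mul_mem' := by
    intro a b ha hb
    simp only [Set.mem_ofPred_eq, Matrix.SpecialLinearGroup.coe_mul, Matrix.transpose_mul] at *
    calc _ = (b : Matrix (Fin N) (Fin N) ℂ).transpose *
          ((a : Matrix (Fin N) (Fin N) ℂ).transpose * (J : Matrix (Fin N) (Fin N) ℂ) *
            (a : Matrix (Fin N) (Fin N) ℂ)) * (b : Matrix (Fin N) (Fin N) ℂ) := by
            simp only [mul_assoc]
      _ = _ := by rw [ha, hb]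
  inv_mem' := by
    intro a ha
    simp only [Set.mem_ofPred_eq] at *
    have h1 : (a : Matrix (Fin N) (Fin N) ℂ) *
        ((a⁻¹ : Matrix.SpecialLinearGroup (Fin N) ℂ) : Matrix (Fin N) (Fin N) ℂ) = 1 := by
      rw [← Matrix.SpecialLinearGroup.coe_mul, mul_inv_cancel, Matrix.SpecialLinearGroup.coe_one]
    have h2 : ((a⁻¹ : Matrix.SpecialLinearGroup (Fin N) ℂ) :
        Matrix (Fin N) (Fin N) ℂ).transpose * (a : Matrix (Fin N) (Fin N) ℂ).transpose = 1 := by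
      rw [← Matrix.transpose_mul, h1, Matrix.transpose_one]
    conv_lhs => rw [← ha]
    calc _ = (((a⁻¹ : Matrix.SpecialLinearGroup (Fin N) ℂ) :
        Matrix (Fin N) (Fin N) ℂ).transpose * (a : Matrix (Fin N) (Fin N) ℂ).transpose) *
          (J : Matrix (Fin N) (Fin N) ℂ) * ((a : Matrix (Fin N) (Fin N) ℂ) *
        ((a⁻¹ : Matrix.SpecialLinearGroup (Fin N) ℂ) : Matrix (Fin N) (Fin N) ℂ)) := by
            simp only [mul_assoc]
      _ = _ := by rw [h1, h2, one_mul, mul_one]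

/-- `𝔤₁`, the `(-1)`-eigenspace of `dθ` on `𝔰𝔩(N, ℂ)`; for `J = 1` these are the traceless symmetric
matrices. -/
def g1 {N : ℕ} (J : GL (Fin N) ℂ) : Set (Matrix (Fin N) (Fin N) ℂ) :=
  {X | X.trace = 0 ∧ dtheta J X = -X}

/-- `𝒩₁`, the nilpotent elements of `𝔤₁`. -/
def nilcone1 {N : ℕ} (J : GL (Fin N) ℂ) : Set (Matrix (Fin N) (Fin N) ℂ) :=
  {X | X ∈ g1 J ∧ IsNilpotent X}

/-- The orbit of a matrix `X` under conjugation by the elements of a subgroup `H` of `SL(N, ℂ)`. -/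
def conjOrbit {N : ℕ} (H : Subgroup (Matrix.SpecialLinearGroup (Fin N) ℂ))
    (X : Matrix (Fin N) (Fin N) ℂ) : Set (Matrix (Fin N) (Fin N) ℂ) :=
  {Y | ∃ g ∈ H, Y = (g : Matrix (Fin N) (Fin N) ℂ) * X *
    ((g⁻¹ : Matrix.SpecialLinearGroup (Fin N) ℂ) : Matrix (Fin N) (Fin N) ℂ)}

/-- `O` is a `K`-orbit in `𝒩₁`, where `K = SO(V, Q)`. -/
def IsNilpotentOrbit {N : ℕ} (J : GL (Fin N) ℂ) (O : Set (Matrix (Fin N) (Fin N) ℂ)) : Prop :=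
  ∃ X ∈ nilcone1 J, O = conjOrbit (SO J) X

/-! ### Partitions -/

/-- The parts of a partition in decreasing order, numbered from `0` and continued by `0`. -/
def part {N : ℕ} (lam : Nat.Partition N) (i : ℕ) : ℕ :=
  (lam.parts.sort (· ≥ ·)).getD i 0

/-- A partition has gaps if two consecutive parts differ by at least `2`, where the last nonzero
part is followed by `0`. -/
def HasGaps {N : ℕ} (lam : Nat.Partition N) : Prop :=
  ∃ i < Multiset.card lam.parts, part lam (i + 1) + 2 ≤ part lam i

/-- `X` is nilpotent with Jordan blocks of sizes `λ₁, …, λ_s`: there is a basis of `ℂ^N` consisting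
of chains `b_{i,0} ↦ b_{i,1} ↦ ⋯ ↦ b_{i,λ_i - 1} ↦ 0`, one for each part `λ_i`. -/
def HasJordanType {N : ℕ} (X : Matrix (Fin N) (Fin N) ℂ) (lam : Nat.Partition N) : Prop :=
  ∃ b : Module.Basis (Σ i : Fin (Multiset.card lam.parts), Fin (part lam i)) ℂ (Fin N → ℂ),
    ∀ (i : Fin (Multiset.card lam.parts)) (a : Fin (part lam i)),
      X.mulVec (b ⟨i, a⟩) =
        if h : (a : ℕ) + 1 < part lam i then b ⟨i, ⟨(a : ℕ) + 1, h⟩⟩ else 0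

/-- `𝒪_λ`: the elements of `𝒩₁` with Jordan blocks of sizes given by `λ`. -/
def orbit {N : ℕ} (J : GL (Fin N) ℂ) (lam : Nat.Partition N) :
    Set (Matrix (Fin N) (Fin N) ℂ) :=
  {X | X ∈ nilcone1 J ∧ HasJordanType X lam}

/-! ### Parabolic subgroups, Levi subgroups, and their Lie algebras -/

/-- The subgroup of `SL(N, ℂ)` of all elements that map each member of a family of subspaces onto
itself. -/
def stabilizer {N : ℕ} {ι : Type} (S : ι → Submodule ℂ (Fin N → ℂ)) :
    Subgroup (Matrix.SpecialLinearGroup (Fin N) ℂ) where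
  carrier := {g | ∀ i, (S i).map (g : Matrix (Fin N) (Fin N) ℂ).mulVecLin = S i}
  one_mem' := by
    intro i
    simp
  mul_mem' := by
    intro a b ha hb i
    rw [Matrix.SpecialLinearGroup.coe_mul, Matrix.mulVecLin_mul, Submodule.map_comp, hb i, ha i]
  inv_mem' := by
    intro a ha i
    conv_lhs => rw [← ha i]
    rw [← Submodule.map_comp, ← Matrix.mulVecLin_mul, ← Matrix.SpecialLinearGroup.coe_mul,
      inv_mul_cancel, Matrix.SpecialLinearGroup.coe_one, Matrix.mulVecLin_one, Submodule.map_id]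

/-- A (partial) flag `0 = V⁰ ⊊ V¹ ⊊ ⋯ ⊊ Vˡ = ℂ^N`. -/
structure PartialFlag (N : ℕ) where
  /-- the number `l` of steps -/
  length : ℕ
  /-- the subspaces -/
  space : Fin (length + 1) → Submodule ℂ (Fin N → ℂ)
  strictMono : StrictMono space
  space_zero : space 0 = ⊥
  space_last : space (Fin.last length) = ⊤

/-- The parabolic subgroup of `SL(N, ℂ)` given by a flag: its stabilizer. -/
def PartialFlag.parabolic {N : ℕ} (F : PartialFlag N) :
    Subgroup (Matrix.SpecialLinearGroup (Fin N) ℂ) :=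
  stabilizer F.space

/-- The nilpotent radical `𝔫_P` of the Lie algebra of `P`: the matrices that map each space of the
flag into the preceding one. -/
def PartialFlag.nilradical {N : ℕ} (F : PartialFlag N) : Set (Matrix (Fin N) (Fin N) ℂ) :=
  {X | ∀ i : Fin F.length, ∀ v ∈ F.space i.succ, X.mulVec v ∈ F.space i.castSucc}

/-- A splitting of a flag: for each step a complement of `V^i` in `V^{i+1}`. -/
structure PartialFlag.Splitting {N : ℕ} (F : PartialFlag N) where
  /-- the complements -/
  compl : Fin F.length → Submodule ℂ (Fin N → ℂ)
  disjoint : ∀ i : Fin F.length, Disjoint (F.space i.castSucc) (compl i)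
  sup_eq : ∀ i : Fin F.length, F.space i.castSucc ⊔ compl i = F.space i.succ

/-- The Levi subgroups of the parabolic subgroup of a flag: the block diagonal subgroups for the
splittings of the flag. -/
def PartialFlag.Splitting.levi {N : ℕ} {F : PartialFlag N} (W : F.Splitting) :
    Subgroup (Matrix.SpecialLinearGroup (Fin N) ℂ) :=
  stabilizer W.compl

/-- The Lie algebra `𝔩` of the Levi subgroup `L` of a splitting: the traceless block diagonal
matrices. -/
def PartialFlag.Splitting.leviAlgebra {N : ℕ} {F : PartialFlag N} (W : F.Splitting) :
    Set (Matrix (Fin N) (Fin N) ℂ) :=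
  {X | X.trace = 0 ∧ ∀ i : Fin F.length, ∀ v ∈ W.compl i, X.mulVec v ∈ W.compl i}

/-- A subgroup is `θ`-stable if `θ` maps it onto itself. -/
def ThetaStable {N : ℕ} (J : GL (Fin N) ℂ)
    (H : Subgroup (Matrix.SpecialLinearGroup (Fin N) ℂ)) : Prop :=
  H.map (theta J) = H

/-- `H^θ`, the elements of `H` fixed by `θ`. -/
noncomputable def fixedSubgroup {N : ℕ} (J : GL (Fin N) ℂ)
    (H : Subgroup (Matrix.SpecialLinearGroup (Fin N) ℂ)) :
    Subgroup (Matrix.SpecialLinearGroup (Fin N) ℂ) :=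
  H ⊓ (theta J).eqLocus (MonoidHom.id (Matrix.SpecialLinearGroup (Fin N) ℂ))

/-- `A` is a nilpotent `L^θ`-orbit in `𝔩₁ = 𝔩 ∩ 𝔤₁`. -/
def IsLeviNilpotentOrbit {N : ℕ} (J : GL (Fin N) ℂ) {F : PartialFlag N} (W : F.Splitting)
    (A : Set (Matrix (Fin N) (Fin N) ℂ)) : Prop :=
  ∃ X ∈ W.leviAlgebra ∩ nilcone1 J, A = conjOrbit (fixedSubgroup J W.levi) X

/-- `O` is the orbit induced from `A`: it is a `K`-orbit in `𝒩₁`, and `O ∩ (A + (𝔫_P)₁)` is dense in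
`A + (𝔫_P)₁` (in the classical topology). -/
def IsInducedFrom {N : ℕ} (J : GL (Fin N) ℂ) (F : PartialFlag N)
    (A O : Set (Matrix (Fin N) (Fin N) ℂ)) : Prop :=
  IsNilpotentOrbit J O ∧
    A + (F.nilradical ∩ g1 J) ⊆ closure (O ∩ (A + (F.nilradical ∩ g1 J)))

/-- `O` is an induced nilpotent orbit: it is induced from a nilpotent `L^θ`-orbit in `𝔩₁` for some
`θ`-stable Levi subgroup `L` of some `θ`-stable proper parabolic subgroup `P` of `SL(N, ℂ)`. -/
def IsInduced {N : ℕ} (J : GL (Fin N) ℂ) (O : Set (Matrix (Fin N) (Fin N) ℂ)) : Prop :=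
  ∃ (F : PartialFlag N) (W : F.Splitting) (A : Set (Matrix (Fin N) (Fin N) ℂ)),
    F.parabolic ≠ ⊤ ∧ ThetaStable J F.parabolic ∧ ThetaStable J W.levi ∧
      IsLeviNilpotentOrbit J W A ∧ IsInducedFrom J F A O

end SymPair

/-! Elements of $\mathfrak g_1$ are the traceless endomorphisms that are self-adjoint for the form.
A nilpotent self-adjoint $x$ has a normal form: $V$ is an orthogonal sum of Jordan chains, and on
each chain the Gram matrix is antidiagonal (`exists_isNormalBasis`). Hence two elements of the same
Jordan type are conjugate by an isometry $T$, of determinant $\pm1$. As $N$ is odd, $T$ or $-T$ lies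
in $K$, and $\mathcal O_\lambda$ is one orbit.

Jordan types are compared through partial sums. If $f$ is nilpotent of type $p$, then
$p_0+\dots+p_{j-1}$ is the largest dimension of an invariant $U$ with $\dim(U\cap\ker f)\le j$. Here
$\dim(U\cap\ker f)=\dim U/fU$ is the number of generators of $U$. This gives three tools: linearly
independent chains bound the type from below (`IsChainBasis.sum_le_of_linearIndependent`), their
independence is an open condition, and the type of a block triangular map is bounded above by the
sum of the types of its diagonal blocks (`finrank_le_of_block`).

Induced implies gaps: let $E$ be the first nonzero space of the flag. Since $\theta(P)=P$, $E^\perp$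
is also a space of the flag and is nonzero, so $E$ is isotropic. Take $x\in\mathcal
O_\lambda\cap(\mathcal O+(\mathfrak n_P)_1)$, with types $\nu$ on $E$ and $\mu$ on $E^\perp/E$. The
quotient $V/E^\perp$ is dual to $E$ and has type $\nu$ again, so $\lambda\le\mu+2\nu$ in partial
sums. Conversely some $z\in(\mathfrak n_P)_1$ links the chains of the three blocks end to end
(`exists_generic`). Thus $x+z$ has independent chains of lengths $\mu+2\nu$, and it lies in the
closure of $\mathcal O_\lambda$, so openness gives $\mu+2\nu\le\lambda$. Therefore
$\lambda=\mu+2\nu$, which has a gap where $\nu$ ends.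

Gaps imply induced: let the gap come after the $m$ largest parts. In a normal basis of some
$X\in\mathcal O_\lambda$, let $E$ be spanned by the last vectors of the $m$ longest chains; their
first vectors are dual to them. The block diagonal part $X'$ of $X$ vanishes on $E$ and on its dual,
and in the middle it has the chains shortened by $2$, which are still in decreasing order because of
the gap. On the line from any $X'+Z$ to $X$, the given chains stay independent for a dense set of
parameters. There the lower bound and the block bound force the type $\lambda$. -/

namespace SymPair

open Module

/-! ### Jordan chains and the partial sums of their lengths. -/

section Chains

variable {𝕜 V : Type*} [Field 𝕜] [AddCommGroup V] [Module 𝕜 V]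

/-- The span of the vectors `f ^ a (v i)`. -/
def chainSpan (f : End 𝕜 V) (v : ℕ → V) : Submodule 𝕜 V :=
  Submodule.span 𝕜 (Set.range fun q : ℕ × ℕ => (f ^ q.2) (v q.1))

/-- The family of the vectors `f ^ a (v i)` with `i < s` and `a < p i`. -/
def chainFamily (f : End 𝕜 V) (s : ℕ) (p : ℕ → ℕ) (v : ℕ → V) (q : Σ i : Fin s, Fin (p i)) : V :=
  (f ^ (q.2 : ℕ)) (v q.1)

/-- `M` has a basis that consists of Jordan chains of `f` of lengths `p 0 ≥ p 1 ≥ ⋯`, generated by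
`v 0, v 1, …`. -/
structure IsChainBasis (f : End 𝕜 V) (s : ℕ) (p : ℕ → ℕ) (v : ℕ → V) (M : Submodule 𝕜 V) :
    Prop where
  anti : Antitone p
  supp : ∀ i, s ≤ i → p i = 0
  pow_apply : ∀ i, (f ^ p i) (v i) = 0
  span_eq : chainSpan f v = M
  card_eq : ∑ i ∈ Finset.range s, p i = finrank 𝕜 M

theorem pow_mem_chainSpan (f : End 𝕜 V) (v : ℕ → V) (i a : ℕ) : (f ^ a) (v i) ∈ chainSpan f v :=
  Submodule.subset_span ⟨(i, a), rfl⟩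

theorem chainSpan_le {f : End 𝕜 V} {v : ℕ → V} {M : Submodule 𝕜 V}
    (h : ∀ i a, (f ^ a) (v i) ∈ M) : chainSpan f v ≤ M := by
  rw [chainSpan, Submodule.span_le]
  rintro _ ⟨q, rfl⟩
  exact h _ _

theorem map_mem_chainSpan (f : End 𝕜 V) (v : ℕ → V) {x : V} (hx : x ∈ chainSpan f v) :
    f x ∈ chainSpan f v := by
  have : chainSpan f v ≤ (chainSpan f v).comap f := chainSpan_le fun i a => by
    rw [Submodule.mem_comap, ← Module.End.mul_apply, ← pow_succ']
    exact pow_mem_chainSpan f v i (a + 1)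
  exact this hx

theorem map_chainSpan (f : End 𝕜 V) (v : ℕ → V) :
    (chainSpan f v).map f = chainSpan f (fun i => f (v i)) := by
  rw [chainSpan, chainSpan, Submodule.map_span, ← Set.range_comp]
  congr 2
  ext q
  simp only [Function.comp, ← Module.End.mul_apply, ← pow_succ, ← pow_succ']

theorem pow_apply_eq_zero_of_le {f : End 𝕜 V} {x : V} {k l : ℕ} (h : (f ^ k) x = 0) (hkl : k ≤ l) :
    (f ^ l) x = 0 := by
  obtain ⟨d, rfl⟩ := Nat.exists_eq_add_of_le' hkl
  rw [pow_add, Module.End.mul_apply, h, map_zero]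

theorem chainSpan_eq_span_chainFamily {f : End 𝕜 V} {s : ℕ} {p : ℕ → ℕ} {v : ℕ → V}
    (hs : ∀ i, s ≤ i → p i = 0) (hv : ∀ i, (f ^ p i) (v i) = 0) :
    chainSpan f v = Submodule.span 𝕜 (Set.range (chainFamily f s p v)) := by
  apply le_antisymm
  · refine chainSpan_le fun i a => ?_
    by_cases ha : a < p i
    · have hi : i < s := by
        by_contra hi
        rw [hs i (by omega)] at ha
        omega
      exact Submodule.subset_span ⟨⟨⟨i, hi⟩, ⟨a, ha⟩⟩, rfl⟩
    · rw [pow_apply_eq_zero_of_le (hv i) (by omega)]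
      exact Submodule.zero_mem _
  · rw [Submodule.span_le]
    rintro _ ⟨q, rfl⟩
    exact pow_mem_chainSpan f v _ _

theorem card_sigma_fin (s : ℕ) (p : ℕ → ℕ) :
    Fintype.card (Σ i : Fin s, Fin (p i)) = ∑ i ∈ Finset.range s, p i := by
  rw [Fintype.card_sigma, Finset.sum_range]
  simp

theorem finrank_chainSpan_le {f : End 𝕜 V} {s : ℕ} {p : ℕ → ℕ} {v : ℕ → V}
    (hs : ∀ i, s ≤ i → p i = 0) (hv : ∀ i, (f ^ p i) (v i) = 0) :
    finrank 𝕜 (chainSpan f v) ≤ ∑ i ∈ Finset.range s, p i := by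
  rw [chainSpan_eq_span_chainFamily hs hv, ← card_sigma_fin]
  exact finrank_range_le_card _

theorem IsChainBasis.linearIndependent {f : End 𝕜 V} {s : ℕ} {p : ℕ → ℕ} {v : ℕ → V}
    {M : Submodule 𝕜 V} (h : IsChainBasis f s p v M) :
    LinearIndependent 𝕜 (chainFamily f s p v) := by
  rw [linearIndependent_iff_card_eq_finrank_span, card_sigma_fin, h.card_eq, ← h.span_eq,
    chainSpan_eq_span_chainFamily h.supp h.pow_apply]
  rfl

theorem IsChainBasis.pow_mem {f : End 𝕜 V} {s : ℕ} {p : ℕ → ℕ} {v : ℕ → V}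
    {M : Submodule 𝕜 V} (h : IsChainBasis f s p v M) (i a : ℕ) : (f ^ a) (v i) ∈ M := by
  rw [← h.span_eq]
  exact pow_mem_chainSpan f v i a

theorem IsChainBasis.pow_eq_zero {f : End 𝕜 V} {s : ℕ} {p : ℕ → ℕ} {v : ℕ → V}
    {M : Submodule 𝕜 V} (h : IsChainBasis f s p v M) {x : V} (hx : x ∈ M) : (f ^ p 0) x = 0 := by
  have : M ≤ LinearMap.ker (f ^ p 0) := by
    rw [← h.span_eq]
    refine chainSpan_le fun i a => ?_
    rw [LinearMap.mem_ker, ← Module.End.mul_apply, ← pow_add]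
    exact pow_apply_eq_zero_of_le (h.pow_apply i) ((h.anti (Nat.zero_le i)).trans (by omega))
  exact this hx

theorem IsChainBasis.apply_eq_zero {f : End 𝕜 V} {s : ℕ} {p : ℕ → ℕ} {v : ℕ → V}
    {M : Submodule 𝕜 V} (h : IsChainBasis f s p v M) {i : ℕ} (hi : p i = 0) : v i = 0 := by
  simpa [hi] using h.pow_apply i

theorem IsChainBasis.le_of_pow_eq_zero {f : End 𝕜 V} {s : ℕ} {p : ℕ → ℕ} {v : ℕ → V}
    {M : Submodule 𝕜 V} (h : IsChainBasis f s p v M) {k : ℕ} (hk : ∀ x ∈ M, (f ^ k) x = 0) (i : ℕ) :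
    p i ≤ k := by
  by_contra hlt
  have hi : i < s := by
    by_contra hi
    have := h.supp i (by omega)
    omega
  apply h.linearIndependent.ne_zero ⟨⟨i, hi⟩, ⟨k, by simpa using hlt⟩⟩
  exact hk _ (by simpa using h.pow_mem i 0)

theorem IsChainBasis.congr {f g : End 𝕜 V} {s : ℕ} {p : ℕ → ℕ} {v : ℕ → V}
    {M : Submodule 𝕜 V} (h : IsChainBasis f s p v M) (hfg : ∀ x ∈ M, g x = f x) :
    IsChainBasis g s p v M := by
  have key : ∀ i a, (g ^ a) (v i) = (f ^ a) (v i) := by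
    intro i a
    induction a with
    | zero => simp
    | succ a ih =>
      rw [pow_succ', pow_succ', Module.End.mul_apply, Module.End.mul_apply, ih,
        hfg _ (h.pow_mem i a)]
  refine ⟨h.anti, h.supp, fun i => by rw [key, h.pow_apply], ?_, h.card_eq⟩
  rw [← h.span_eq, chainSpan, chainSpan]
  simp only [key]

/-- Every $f^{a+1}v_i$ lies in the image already, so $m$ starting vectors generate the span modulo
its image. This makes $m$ a bound for $\dim(U\cap\ker f)$. -/
theorem chainSpan_le_map_sup {f : End 𝕜 V} {v : ℕ → V} {m : ℕ} (h : ∀ i, m ≤ i → v i = 0) :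
    chainSpan f v ≤ (chainSpan f v).map f ⊔ Submodule.span 𝕜 (Set.range fun i : Fin m => v i) := by
  refine chainSpan_le fun i a => ?_
  rcases Nat.lt_or_ge i m with hi | hi
  · cases a with
    | zero => exact Submodule.mem_sup_right (Submodule.subset_span ⟨⟨i, hi⟩, by simp⟩)
    | succ a =>
      refine Submodule.mem_sup_left ⟨_, pow_mem_chainSpan f v i a, ?_⟩
      rw [pow_succ', Module.End.mul_apply]
  · rw [h i hi, map_zero]
    exact Submodule.zero_mem _

variable [FiniteDimensional 𝕜 V]

theorem finrank_map_add_finrank_inf_ker {V' : Type*} [AddCommGroup V'] [Module 𝕜 V']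
    (f : V →ₗ[𝕜] V') (U : Submodule 𝕜 V) :
    finrank 𝕜 (U.map f) + finrank 𝕜 (U ⊓ LinearMap.ker f : Submodule 𝕜 V) = finrank 𝕜 U := by
  have h := (f.domRestrict U).finrank_range_add_finrank_ker
  have e : LinearMap.ker (f.domRestrict U) = (LinearMap.ker f).comap U.subtype := rfl
  rw [LinearMap.range_domRestrict, e, ← Submodule.finrank_map_subtype_eq,
    Submodule.map_comap_subtype] at h
  exact h

/-- If a subspace `U` is generated by `f(U)` and `k` vectors, then `U ⊓ ker f` has dimension at most
`k`. -/
theorem finrank_inf_ker_le {f : End 𝕜 V} {U : Submodule 𝕜 V} {ι : Type*} [Fintype ι] (w : ι → V)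
    (h : U ≤ U.map f ⊔ Submodule.span 𝕜 (Set.range w)) :
    finrank 𝕜 (U ⊓ LinearMap.ker f : Submodule 𝕜 V) ≤ Fintype.card ι := by
  have h1 := finrank_map_add_finrank_inf_ker f U
  have h2 := Submodule.finrank_mono h
  have h3 := Submodule.finrank_add_le_finrank_add_finrank (U.map f)
    (Submodule.span 𝕜 (Set.range w))
  have h4 : finrank 𝕜 (Submodule.span 𝕜 (Set.range w)) ≤ Fintype.card ι := finrank_range_le_card w
  omega

theorem finrank_chainSpan_inf_ker_le {f : End 𝕜 V} {v : ℕ → V} {m : ℕ}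
    (h : ∀ i, m ≤ i → v i = 0) :
    finrank 𝕜 (chainSpan f v ⊓ LinearMap.ker f : Submodule 𝕜 V) ≤ m := by
  simpa using finrank_inf_ker_le _ (chainSpan_le_map_sup h)

theorem sum_range_eq_sum_sub_one_add (p : ℕ → ℕ) (k : ℕ) :
    ∑ i ∈ Finset.range k, p i =
      ∑ i ∈ Finset.range k, (p i - 1) + ((Finset.range k).filter fun i => 0 < p i).card := by
  rw [Finset.card_filter, ← Finset.sum_add_distrib]
  refine Finset.sum_congr rfl fun i _ => ?_
  split_ifs <;> omega

theorem exists_pos_iff_lt {p : ℕ → ℕ} (hp : Antitone p) {s : ℕ} (hs : ∀ i, s ≤ i → p i = 0) :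
    ∃ m, m ≤ s ∧ ∀ i, 0 < p i ↔ i < m := by
  classical
  have hex : ∃ m, p m = 0 := ⟨s, hs s le_rfl⟩
  refine ⟨Nat.find hex, Nat.find_min' hex (hs s le_rfl), fun i => ⟨fun hi => ?_, fun hi => ?_⟩⟩
  · by_contra hlt
    have := hp (Nat.le_of_not_lt hlt)
    rw [Nat.find_spec hex] at this
    omega
  · exact Nat.pos_of_ne_zero (Nat.find_min hex hi)

theorem card_filter_pos {p : ℕ → ℕ} {m : ℕ} (hm : ∀ i, 0 < p i ↔ i < m) (k : ℕ) :
    ((Finset.range k).filter fun i => 0 < p i).card = min k m := by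
  have : (Finset.range k).filter (fun i => 0 < p i) = Finset.range (min k m) := by
    ext i
    simp [hm]
  rw [this, Finset.card_range]

theorem IsChainBasis.finrank_inf_ker_le {f : End 𝕜 V} {s : ℕ} {p : ℕ → ℕ} {v : ℕ → V}
    {M : Submodule 𝕜 V} (h : IsChainBasis f s p v M) {m : ℕ} (hm : ∀ i, 0 < p i ↔ i < m) :
    finrank 𝕜 (M ⊓ LinearMap.ker f : Submodule 𝕜 V) ≤ m := by
  rw [← h.span_eq]
  refine finrank_chainSpan_inf_ker_le fun i hi => h.apply_eq_zero ?_
  have := hm i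
  omega

/-- The dimension is squeezed: the kernel has dimension at most the number $m$ of nonempty chains,
which bounds $\dim f(M)$ below, and the shortened chains span $f(M)$, which bounds it above. -/
theorem IsChainBasis.map {f : End 𝕜 V} {s : ℕ} {p : ℕ → ℕ} {v : ℕ → V}
    {M : Submodule 𝕜 V} (h : IsChainBasis f s p v M) :
    IsChainBasis f s (fun i => p i - 1) (fun i => f (v i)) (M.map f) := by
  have hpow : ∀ i, (f ^ (p i - 1)) (f (v i)) = 0 := by
    intro i
    rw [← Module.End.mul_apply, ← pow_succ]
    exact pow_apply_eq_zero_of_le (h.pow_apply i) (by omega)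
  have hspan : chainSpan f (fun i => f (v i)) = M.map f := by
    rw [← map_chainSpan, h.span_eq]
  have hsupp : ∀ i, s ≤ i → p i - 1 = 0 := fun i hi => by rw [h.supp i hi]
  refine ⟨fun i j hij => Nat.sub_le_sub_right (h.anti hij) 1, hsupp, hpow, hspan, ?_⟩
  obtain ⟨m, hms, hm⟩ := exists_pos_iff_lt h.anti h.supp
  have h1 := finrank_map_add_finrank_inf_ker f M
  have h2 := h.finrank_inf_ker_le hm
  have h3 := sum_range_eq_sum_sub_one_add p s
  rw [card_filter_pos hm, h.card_eq] at h3
  have h4 := finrank_chainSpan_le hsupp hpow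
  rw [hspan] at h4
  have : min s m = m := by omega
  omega

/-- An invariant subspace that is generated by `j` vectors is at most as large as the sum of the
`j` longest chains. -/
theorem IsChainBasis.finrank_le {f : End 𝕜 V} {s : ℕ} {p : ℕ → ℕ} {v : ℕ → V}
    {M : Submodule 𝕜 V} (h : IsChainBasis f s p v M) {U : Submodule 𝕜 V} (hUM : U ≤ M)
    (hU : ∀ x ∈ U, f x ∈ U) {j : ℕ}
    (hj : finrank 𝕜 (U ⊓ LinearMap.ker f : Submodule 𝕜 V) ≤ j) :
    finrank 𝕜 U ≤ ∑ i ∈ Finset.range j, p i := by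
  -- Induction on the longest chain, replacing $M$ and $U$ by their images. This lowers $\dim U$ by
  -- $\dim(U\cap\ker f)\le\min(j,m)$, while the sum of the first $j$ lengths drops by exactly
  -- $\min(j,m)$, where $m$ counts the nonempty chains.
  induction hn : p 0 generalizing p v M U with
  | zero =>
    have hM : finrank 𝕜 M = 0 := by
      rw [← h.card_eq]
      exact Finset.sum_eq_zero fun i _ => Nat.le_zero.1 (hn ▸ h.anti (Nat.zero_le i))
    have := Submodule.finrank_mono hUM
    omega
  | succ n ih =>
    have hle : U.map f ≤ U := by
      rintro _ ⟨x, hx, rfl⟩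
      exact hU x hx
    have h1 := ih h.map (Submodule.map_mono hUM) (U := U.map f)
      (by
        rintro _ ⟨x, hx, rfl⟩
        exact ⟨_, hU x hx, rfl⟩)
      ((Submodule.finrank_mono (inf_le_inf_right _ hle)).trans hj) (by simp only [hn]; rfl)
    obtain ⟨m, hms, hm⟩ := exists_pos_iff_lt h.anti h.supp
    have h2 := (Submodule.finrank_mono (inf_le_inf_right (LinearMap.ker f) hUM)).trans
      (h.finrank_inf_ker_le hm)
    have h3 := finrank_map_add_finrank_inf_ker f U
    have h4 := sum_range_eq_sum_sub_one_add p j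
    rw [card_filter_pos hm] at h4
    have := le_min hj h2
    omega

/-- Both sides count generators: $\dim(U\cap\ker f)=\dim U-\dim fU$, and an equivariant image of $U$
needs no more generators than $U$ does. -/
theorem finrank_map_inf_ker_le {f g π : End 𝕜 V} {U : Submodule 𝕜 V} (hU : ∀ x ∈ U, f x ∈ U)
    (h : ∀ x ∈ U, π (f x) = g (π x)) :
    finrank 𝕜 (U.map π ⊓ LinearMap.ker g : Submodule 𝕜 V) ≤
      finrank 𝕜 (U ⊓ LinearMap.ker f : Submodule 𝕜 V) := by
  have e : (U.map f).map π = (U.map π).map g := by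
    ext y
    constructor
    · rintro ⟨_, ⟨x, hx, rfl⟩, rfl⟩
      exact ⟨_, ⟨x, hx, rfl⟩, (h x hx).symm⟩
    · rintro ⟨_, ⟨x, hx, rfl⟩, rfl⟩
      exact ⟨_, ⟨x, hx, rfl⟩, h x hx⟩
  have hle : U.map f ≤ U := by
    rintro _ ⟨x, hx, rfl⟩
    exact hU x hx
  have h1 := finrank_map_add_finrank_inf_ker f U
  have h2 := finrank_map_add_finrank_inf_ker g (U.map π)
  have h3 := finrank_map_add_finrank_inf_ker π U
  have h4 := finrank_map_add_finrank_inf_ker π (U.map f)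
  rw [e] at h4
  have h5 := Submodule.finrank_mono (inf_le_inf_right (LinearMap.ker π) hle)
  omega

/-- The bound of `IsChainBasis.finrank_le` for a block triangular endomorphism `f` whose part on the
diagonal is `g`. -/
theorem finrank_le_of_block {f g π₂ π₃ : End 𝕜 V} {M₁ M₂ M₃ : Submodule 𝕜 V}
    (h₃ : ∀ x, π₃ x ∈ M₃) (h₂ : ∀ x, π₃ x = 0 → π₂ x ∈ M₂) (h₁ : ∀ x, π₃ x = 0 → π₂ x = 0 → x ∈ M₁)
    (c₃ : ∀ x, π₃ (f x) = g (π₃ x)) (c₂ : ∀ x, π₃ x = 0 → π₂ (f x) = g (π₂ x))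
    (c₁ : ∀ x ∈ M₁, f x = g x) {s₁ s₂ s₃ : ℕ} {p₁ p₂ p₃ : ℕ → ℕ} {v₁ v₂ v₃ : ℕ → V}
    (b₁ : IsChainBasis g s₁ p₁ v₁ M₁) (b₂ : IsChainBasis g s₂ p₂ v₂ M₂)
    (b₃ : IsChainBasis g s₃ p₃ v₃ M₃) {U : Submodule 𝕜 V} (hU : ∀ x ∈ U, f x ∈ U) {j : ℕ}
    (hj : finrank 𝕜 (U ⊓ LinearMap.ker f : Submodule 𝕜 V) ≤ j) :
    finrank 𝕜 U ≤ ∑ i ∈ Finset.range j, (p₁ i + p₂ i + p₃ i) := by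
  -- Filter $U\supseteq U'\supseteq U''$. The pieces $\pi_3U$, $\pi_2U'$ and $U''$ are $g$-invariant
  -- subspaces of $M_3$, $M_2$ and $M_1$, each with at most $j$ generators, and their dimensions add
  -- up to $\dim U$.
  set U' := U ⊓ LinearMap.ker π₃ with hU'
  set U'' := U' ⊓ LinearMap.ker π₂ with hU''
  have i' : ∀ x ∈ U', f x ∈ U' := by
    rintro x ⟨hx, hx3⟩
    refine ⟨hU x hx, ?_⟩
    change π₃ (f x) = 0
    rw [c₃, show π₃ x = 0 from hx3, map_zero]
  have i'' : ∀ x ∈ U'', f x ∈ U'' := by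
    rintro x ⟨hx, hx2⟩
    refine ⟨i' x hx, ?_⟩
    change π₂ (f x) = 0
    rw [c₂ x hx.2, show π₂ x = 0 from hx2, map_zero]
  have m₁ : U'' ≤ M₁ := fun x hx => h₁ x hx.1.2 hx.2
  have n₃ := b₃.finrank_le (U := U.map π₃) (by rintro _ ⟨x, hx, rfl⟩; exact h₃ x)
    (by rintro _ ⟨x, hx, rfl⟩; exact ⟨_, hU x hx, c₃ x⟩)
    ((finrank_map_inf_ker_le hU fun x _ => c₃ x).trans hj)
  have j' : finrank 𝕜 (U' ⊓ LinearMap.ker f : Submodule 𝕜 V) ≤ j :=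
    (Submodule.finrank_mono (inf_le_inf_right _ inf_le_left)).trans hj
  have n₂ := b₂.finrank_le (U := U'.map π₂) (by rintro _ ⟨x, hx, rfl⟩; exact h₂ x hx.2)
    (by rintro _ ⟨x, hx, rfl⟩; exact ⟨_, i' x hx, c₂ x hx.2⟩)
    ((finrank_map_inf_ker_le i' fun x hx => c₂ x hx.2).trans j')
  have j'' : finrank 𝕜 (U'' ⊓ LinearMap.ker g : Submodule 𝕜 V) ≤ j := by
    refine (Submodule.finrank_mono ?_).trans j'
    rintro x ⟨hx, hxg⟩
    exact ⟨hx.1, (c₁ x (m₁ hx)).trans hxg⟩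
  have n₁ := b₁.finrank_le (U := U'') m₁ (fun x hx => by rw [← c₁ x (m₁ hx)]; exact i'' x hx) j''
  have e₃ := finrank_map_add_finrank_inf_ker π₃ U
  have e₂ := finrank_map_add_finrank_inf_ker π₂ U'
  rw [← hU'] at e₃
  rw [← hU''] at e₂
  rw [Finset.sum_add_distrib, Finset.sum_add_distrib]
  omega

/-- If the vectors `f ^ a (v i)`, `a < p i`, are linearly independent, then there is an invariant
subspace generated by `j` vectors of dimension at least `p 0 + ⋯ + p (j - 1)`. -/
theorem exists_le_finrank_of_linearIndependent {f : End 𝕜 V} {s : ℕ} {p : ℕ → ℕ} {v : ℕ → V}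
    (hs : ∀ i, s ≤ i → p i = 0) (h : LinearIndependent 𝕜 (chainFamily f s p v)) (j : ℕ) :
    ∃ U : Submodule 𝕜 V, (∀ x ∈ U, f x ∈ U) ∧
      finrank 𝕜 (U ⊓ LinearMap.ker f : Submodule 𝕜 V) ≤ j ∧
      ∑ i ∈ Finset.range j, p i ≤ finrank 𝕜 U := by
  set w : ℕ → V := fun i => if i < j then v i else 0 with hw
  refine ⟨chainSpan f w, fun x hx => map_mem_chainSpan f w hx,
    finrank_chainSpan_inf_ker_le fun i hi => if_neg (by omega), ?_⟩
  have e : ∑ i ∈ Finset.range j, p i = ∑ i ∈ Finset.range (min j s), p i := by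
    refine (Finset.sum_subset (by simp) fun i hi hi' => hs i ?_).symm
    simp at hi hi'
    omega
  have inj : Function.Injective (fun q : Σ i : Fin (min j s), Fin (p i) =>
      (⟨⟨q.1, q.1.2.trans_le (min_le_right _ _)⟩, q.2⟩ : Σ i : Fin s, Fin (p i))) := by
    rintro ⟨⟨i, hi⟩, a⟩ ⟨⟨i', hi'⟩, a'⟩ h
    simp only [Sigma.mk.injEq, Fin.mk.injEq] at h
    obtain ⟨rfl, h⟩ := h
    simpa using h
  have h' := h.comp _ inj
  rw [e, ← card_sigma_fin, linearIndependent_iff_card_eq_finrank_span.1 h']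
  refine Submodule.finrank_mono ?_
  rw [Submodule.span_le]
  rintro _ ⟨⟨⟨i, hi⟩, a⟩, rfl⟩
  have : w i = v i := if_pos (by omega)
  simp only [Function.comp, chainFamily]
  rw [← this]
  exact pow_mem_chainSpan f w i a

theorem eq_of_sum_range_eq {p q : ℕ → ℕ}
    (h : ∀ j, ∑ i ∈ Finset.range j, p i = ∑ i ∈ Finset.range j, q i) : p = q := by
  ext j
  have h1 := h (j + 1)
  rw [Finset.sum_range_succ, Finset.sum_range_succ, h j] at h1
  omega

/-- The chains of `v'` need not end after `p'` steps; independence of their initial segments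
suffices. This is why the bound survives a small perturbation of $f$. -/
theorem IsChainBasis.sum_le_of_linearIndependent {f : End 𝕜 V} {s s' : ℕ} {p p' : ℕ → ℕ}
    {v v' : ℕ → V} (h : IsChainBasis f s p v ⊤) (hs : ∀ i, s' ≤ i → p' i = 0)
    (h' : LinearIndependent 𝕜 (chainFamily f s' p' v')) (j : ℕ) :
    ∑ i ∈ Finset.range j, p' i ≤ ∑ i ∈ Finset.range j, p i := by
  obtain ⟨U, hU, hj, hle⟩ := exists_le_finrank_of_linearIndependent hs h' j
  exact hle.trans (h.finrank_le le_top hU hj)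

/-- The Jordan type of an endomorphism is unique. -/
theorem IsChainBasis.unique {f : End 𝕜 V} {s s' : ℕ} {p p' : ℕ → ℕ} {v v' : ℕ → V}
    (h : IsChainBasis f s p v ⊤) (h' : IsChainBasis f s' p' v' ⊤) : p = p' :=
  eq_of_sum_range_eq fun j => le_antisymm (h'.sum_le_of_linearIndependent h.supp
    h.linearIndependent j) (h.sum_le_of_linearIndependent h'.supp h'.linearIndependent j)

end Chains

/-- The sequence `a, p 0, p 1, …`. -/
def consSeq {α : Type*} (a : α) (p : ℕ → α) : ℕ → α
  | 0 => a
  | i + 1 => p i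

/-! ### Jordan normal form by splitting off a longest chain. -/

section Existence

variable {𝕜 V : Type*} [Field 𝕜] [AddCommGroup V] [Module 𝕜 V]

/-- The vectors of `M` such that the functional `φ` vanishes on `x, f x, …, f ^ K x`. -/
def chainCompl (f : End 𝕜 V) (φ : V →ₗ[𝕜] 𝕜) (K : ℕ) (M : Submodule 𝕜 V) : Submodule 𝕜 V :=
  M ⊓ LinearMap.ker (LinearMap.pi fun a : Fin (K + 1) => φ ∘ₗ (f ^ (a : ℕ)))

theorem mem_chainCompl {f : End 𝕜 V} {φ : V →ₗ[𝕜] 𝕜} {K : ℕ} {M : Submodule 𝕜 V}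
    (hK : ∀ x ∈ M, (f ^ (K + 1)) x = 0) {x : V} :
    x ∈ chainCompl f φ K M ↔ x ∈ M ∧ ∀ a, φ ((f ^ a) x) = 0 := by
  constructor
  · rintro ⟨hx, h⟩
    refine ⟨hx, fun a => ?_⟩
    by_cases ha : a < K + 1
    · exact congrFun h ⟨a, ha⟩
    · rw [pow_apply_eq_zero_of_le (hK x hx) (by omega), map_zero]
  · rintro ⟨hx, h⟩
    exact ⟨hx, funext fun a => h a⟩

theorem pow_mem_of_map_mem {f : End 𝕜 V} {M : Submodule 𝕜 V} (hM : ∀ x ∈ M, f x ∈ M) (a : ℕ) {x : V}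
    (hx : x ∈ M) : (f ^ a) x ∈ M := by
  induction a with
  | zero => simpa
  | succ a ih =>
    rw [pow_succ', Module.End.mul_apply]
    exact hM _ ih

theorem map_mem_chainCompl {f : End 𝕜 V} {φ : V →ₗ[𝕜] 𝕜} {K : ℕ} {M : Submodule 𝕜 V}
    (hK : ∀ x ∈ M, (f ^ (K + 1)) x = 0) (hM : ∀ x ∈ M, f x ∈ M) {x : V}
    (hx : x ∈ chainCompl f φ K M) : f x ∈ chainCompl f φ K M := by
  rw [mem_chainCompl hK] at *
  refine ⟨hM x hx.1, fun a => ?_⟩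
  rw [← Module.End.mul_apply, ← pow_succ]
  exact hx.2 _

/-- The functionals $\varphi\circ f^{K-a}$ are dual to the chain vectors $f^a v$, so the sum is the
component of $x$ along the chain. -/
theorem sub_sum_mem_chainCompl {f : End 𝕜 V} {φ : V →ₗ[𝕜] 𝕜} {K : ℕ} {M : Submodule 𝕜 V}
    (hK : ∀ x ∈ M, (f ^ (K + 1)) x = 0) (hM : ∀ x ∈ M, f x ∈ M) {v : V} (hv : v ∈ M)
    (hφ : ∀ c, φ ((f ^ c) v) = if c = K then 1 else 0) {x : V} (hx : x ∈ M) :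
    x - ∑ a ∈ Finset.range (K + 1), φ ((f ^ (K - a)) x) • (f ^ a) v ∈ chainCompl f φ K M := by
  rw [mem_chainCompl hK]
  refine ⟨sub_mem hx (sum_mem fun a _ => M.smul_mem _ (pow_mem_of_map_mem hM a hv)), fun b => ?_⟩
  by_cases hb : b ≤ K
  · rw [map_sub, map_sub, map_sum, map_sum, Finset.sum_eq_single (K - b)]
    · rw [map_smul, map_smul, ← Module.End.mul_apply, ← pow_add, hφ, if_pos (by omega),
        show K - (K - b) = b by omega]
      simp
    · intro a _ ha
      rw [map_smul, map_smul, ← Module.End.mul_apply, ← pow_add, hφ, if_neg (by omega), smul_zero]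
    · intro h
      exact absurd (Finset.mem_range.2 (by omega)) h
  · rw [pow_apply_eq_zero_of_le (hK _ _) (by omega), map_zero]
    exact sub_mem hx (sum_mem fun a _ => M.smul_mem _ (pow_mem_of_map_mem hM a hv))

/-- The $K+1$ defining functionals are independent on $M$: on the vectors $f^{K-b}v$ they form the
identity matrix. -/
theorem finrank_chainCompl [FiniteDimensional 𝕜 V] {f : End 𝕜 V} {φ : V →ₗ[𝕜] 𝕜} {K : ℕ}
    {M : Submodule 𝕜 V} (hM : ∀ x ∈ M, f x ∈ M) {v : V} (hv : v ∈ M)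
    (hφ : ∀ c, φ ((f ^ c) v) = if c = K then 1 else 0) :
    finrank 𝕜 M = K + 1 + finrank 𝕜 (chainCompl f φ K M) := by
  rw [← finrank_map_add_finrank_inf_ker
    (LinearMap.pi fun a : Fin (K + 1) => φ ∘ₗ (f ^ (a : ℕ))) M]
  congr 1
  have : M.map (LinearMap.pi fun a : Fin (K + 1) => φ ∘ₗ (f ^ (a : ℕ))) = ⊤ := by
    rw [eq_top_iff, ← (Pi.basisFun 𝕜 (Fin (K + 1))).span_eq, Submodule.span_le]
    rintro _ ⟨b, rfl⟩
    refine ⟨(f ^ (K - b)) v, pow_mem_of_map_mem hM _ hv, ?_⟩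
    ext a
    have ha := a.2
    have hb := b.2
    rw [LinearMap.pi_apply, LinearMap.comp_apply, ← Module.End.mul_apply, ← pow_add, hφ,
      Pi.basisFun_apply, Pi.single_apply]
    congr 1
    rw [Fin.ext_iff, eq_iff_iff]
    omega
  rw [this, finrank_top, finrank_fin_fun]

theorem IsChainBasis.cons [FiniteDimensional 𝕜 V] {f : End 𝕜 V} {φ : V →ₗ[𝕜] 𝕜} {K : ℕ}
    {M : Submodule 𝕜 V} (hK : ∀ x ∈ M, (f ^ (K + 1)) x = 0) (hM : ∀ x ∈ M, f x ∈ M) {v : V}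
    (hv : v ∈ M) (hφ : ∀ c, φ ((f ^ c) v) = if c = K then 1 else 0) {s : ℕ} {p : ℕ → ℕ} {w : ℕ → V}
    (h : IsChainBasis f s p w (chainCompl f φ K M)) :
    IsChainBasis f (s + 1) (consSeq (K + 1) p) (consSeq v w) M where
  anti := by
    refine antitone_nat_of_succ_le fun i => ?_
    cases i with
    | zero => exact h.le_of_pow_eq_zero (fun x hx => hK x hx.1) 0
    | succ i => exact h.anti (Nat.le_succ i)
  supp i hi := by
    cases i with
    | zero => omega
    | succ i => exact h.supp i (by omega)
  pow_apply i := by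
    cases i with
    | zero => exact hK v hv
    | succ i => exact h.pow_apply i
  span_eq := by
    apply le_antisymm
    · refine chainSpan_le fun i a => ?_
      cases i with
      | zero => exact pow_mem_of_map_mem hM a hv
      | succ i => exact (h.pow_mem i a).1
    · intro x hx
      have h1 := sub_sum_mem_chainCompl hK hM hv hφ hx
      rw [← h.span_eq] at h1
      have h2 : chainSpan f w ≤ chainSpan f (consSeq v w) :=
        chainSpan_le fun i a => pow_mem_chainSpan f (consSeq v w) (i + 1) a
      have h3 : ∑ a ∈ Finset.range (K + 1), φ ((f ^ (K - a)) x) • (f ^ a) v ∈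
          chainSpan f (consSeq v w) :=
        sum_mem fun a _ => Submodule.smul_mem _ _ (pow_mem_chainSpan f (consSeq v w) 0 a)
      simpa using add_mem (h2 h1) h3
  card_eq := by
    rw [Finset.sum_range_succ', finrank_chainCompl hM hv hφ, ← h.card_eq, add_comm]
    rfl

theorem isChainBasis_bot [FiniteDimensional 𝕜 V] (f : End 𝕜 V) :
    IsChainBasis f 0 (fun _ => 0) (fun _ => 0) ⊥ where
  anti := antitone_const
  supp _ _ := rfl
  pow_apply i := by simp
  span_eq := by
    rw [eq_bot_iff]
    exact chainSpan_le fun i a => by simp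
  card_eq := by simp

theorem exists_pow_ne_zero {f : End 𝕜 V} {M : Submodule 𝕜 V} (hM : M ≠ ⊥)
    (hf : ∃ k, ∀ x ∈ M, (f ^ k) x = 0) :
    ∃ K, (∀ x ∈ M, (f ^ (K + 1)) x = 0) ∧ ∃ x ∈ M, (f ^ K) x ≠ 0 := by
  classical
  obtain ⟨x, hx, hx0⟩ := Submodule.exists_mem_ne_zero_of_ne_bot hM
  have h0 : Nat.find hf ≠ 0 := by
    intro h
    have := Nat.find_spec hf x hx
    rw [h] at this
    exact hx0 (by simpa using this)
  obtain ⟨K, hK⟩ := Nat.exists_eq_succ_of_ne_zero h0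
  refine ⟨K, fun y hy => ?_, ?_⟩
  · have := Nat.find_spec hf y hy
    rwa [hK] at this
  have := Nat.find_min hf (m := K) (by omega)
  push Not at this
  exact this

/-- A functional with value $1$ on $f^Kv$ is corrected from the top down: subtracting a multiple of
$\varphi\circ f^{r+1}$ clears the value at $f^{K-r-1}v$ and leaves those at higher powers alone. -/
theorem exists_dual_pow {f : End 𝕜 V} {K : ℕ} {v : V} (h0 : (f ^ (K + 1)) v = 0)
    (h1 : (f ^ K) v ≠ 0) :
    ∃ φ : V →ₗ[𝕜] 𝕜, ∀ c, φ ((f ^ c) v) = if c = K then 1 else 0 := by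
  have key : ∀ r ≤ K, ∃ φ : V →ₗ[𝕜] 𝕜, ∀ c, K - r ≤ c →
      φ ((f ^ c) v) = if c = K then 1 else 0 := by
    intro r hr
    induction r with
    | zero =>
      obtain ⟨φ, hφ⟩ := Module.Projective.exists_dual_eq_one 𝕜 h1
      refine ⟨φ, fun c hc => ?_⟩
      split_ifs with h
      · rw [h, hφ]
      · rw [pow_apply_eq_zero_of_le (l := c) h0 (by omega), map_zero]
    | succ r ih =>
      obtain ⟨φ, hφ⟩ := ih (by omega)
      refine ⟨φ - φ ((f ^ (K - (r + 1))) v) • φ ∘ₗ (f ^ (r + 1)), fun c hc => ?_⟩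
      rw [LinearMap.sub_apply, LinearMap.smul_apply, LinearMap.comp_apply, ← Module.End.mul_apply,
        ← pow_add]
      rcases Nat.lt_or_ge (K - (r + 1)) c with hlt | hle
      · rw [pow_apply_eq_zero_of_le (l := r + 1 + c) h0 (by omega), hφ c (by omega)]
        simp
      · have : c = K - (r + 1) := by omega
        subst this
        rw [show r + 1 + (K - (r + 1)) = K by omega, hφ K (by omega), if_pos rfl,
          if_neg (by omega)]
        simp
  obtain ⟨φ, hφ⟩ := key K le_rfl
  exact ⟨φ, fun c => hφ c (by omega)⟩

/-- The Jordan normal form of a nilpotent endomorphism. -/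
theorem exists_isChainBasis [FiniteDimensional 𝕜 V] {f : End 𝕜 V} {M : Submodule 𝕜 V}
    (hM : ∀ x ∈ M, f x ∈ M) (hf : ∃ k, ∀ x ∈ M, (f ^ k) x = 0) :
    ∃ s p v, IsChainBasis f s p v M := by
  induction hn : finrank 𝕜 M using Nat.strong_induction_on generalizing M with
  | _ n ih =>
    by_cases h0 : M = ⊥
    · subst h0
      exact ⟨_, _, _, isChainBasis_bot f⟩
    obtain ⟨K, hK, v, hv, hKv⟩ := exists_pow_ne_zero h0 hf
    obtain ⟨φ, hφ⟩ := exists_dual_pow (hK v hv) hKv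
    have hfin := finrank_chainCompl hM hv hφ
    obtain ⟨s, p, w, h⟩ := ih _ (by omega : finrank 𝕜 (chainCompl f φ K M) < n)
      (fun x hx => map_mem_chainCompl hK hM hx)
      ⟨K + 1, fun x hx => hK x hx.1⟩ rfl
    exact ⟨_, _, _, h.cons hK hM hv hφ⟩

/-- A chain basis that is adapted to a symmetric bilinear form: the `a`-th vector of a chain of
length `l` is dual to the `(l - 1 - a)`-th vector of the same chain. -/
structure IsNormalBasis (B : LinearMap.BilinForm 𝕜 V) (f : End 𝕜 V) (s : ℕ) (p : ℕ → ℕ)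
    (v : ℕ → V) (M : Submodule 𝕜 V) : Prop extends IsChainBasis f s p v M where
  gram : ∀ i j c, B (v i) ((f ^ c) (v j)) = if i = j ∧ c + 1 = p i then 1 else 0

theorem pow_selfAdjoint {B : LinearMap.BilinForm 𝕜 V} {f : End 𝕜 V}
    (hf : ∀ x y, B (f x) y = B x (f y)) (a : ℕ) (x y : V) : B ((f ^ a) x) y = B x ((f ^ a) y) := by
  induction a generalizing x y with
  | zero => simp
  | succ a ih =>
    rw [pow_succ', Module.End.mul_apply, hf, ih, ← Module.End.mul_apply, ← pow_succ, pow_succ']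

/-- Pairing a relation with $f^{p_i-1-a}v'_i$ isolates the coefficient of $f^av_i$. Two families are
allowed so that chains in an isotropic subspace can be tested against a dual one. -/
theorem linearIndependent_of_gram {B : LinearMap.BilinForm 𝕜 V} {f : End 𝕜 V}
    (hf : ∀ x y, B (f x) y = B x (f y)) {s : ℕ} {p : ℕ → ℕ} {v v' : ℕ → V}
    (h : ∀ i j c, B (v' i) ((f ^ c) (v j)) = if i = j ∧ c + 1 = p i then 1 else 0) :
    LinearIndependent 𝕜 (chainFamily f s p v) := by
  rw [Fintype.linearIndependent_iff]
  rintro g hg ⟨i, a⟩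
  have h1 : B ((f ^ (p i - 1 - a)) (v' i)) (∑ q, g q • chainFamily f s p v q) = 0 := by
    rw [hg, map_zero]
  rw [map_sum, Finset.sum_eq_single ⟨i, a⟩] at h1
  · have ha : (a : ℕ) < p i := a.2
    rw [map_smul, chainFamily, pow_selfAdjoint hf, ← Module.End.mul_apply, ← pow_add, h,
      if_pos ⟨rfl, by simp only; omega⟩] at h1
    simpa using h1
  · rintro ⟨j, b⟩ _ hne
    rw [map_smul, chainFamily, pow_selfAdjoint hf, ← Module.End.mul_apply, ← pow_add, h, if_neg,
      smul_zero]
    rintro ⟨hij, hab⟩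
    have hij' : j = i := (Fin.ext hij).symm
    subst hij'
    apply hne
    have ha := a.2
    have hb := b.2
    congr 1
    ext
    simp only at hab
    omega
  · simp

theorem IsNormalBasis.cons [FiniteDimensional 𝕜 V] {B : LinearMap.BilinForm 𝕜 V} {f : End 𝕜 V}
    (hB : ∀ x y, B x y = B y x) (hf : ∀ x y, B (f x) y = B x (f y)) {K : ℕ}
    {M : Submodule 𝕜 V} (hK : ∀ x ∈ M, (f ^ (K + 1)) x = 0) (hM : ∀ x ∈ M, f x ∈ M) {v : V}
    (hv : v ∈ M) (hφ : ∀ c, B v ((f ^ c) v) = if c = K then 1 else 0) {s : ℕ} {p : ℕ → ℕ}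
    {w : ℕ → V} (h : IsNormalBasis B f s p w (chainCompl f (B v) K M)) :
    IsNormalBasis B f (s + 1) (consSeq (K + 1) p) (consSeq v w) M where
  toIsChainBasis := h.toIsChainBasis.cons hK hM hv hφ
  gram i j c := by
    have key : ∀ j c, B v ((f ^ c) (w j)) = 0 := fun j c => by
      have := ((mem_chainCompl hK).1 (h.pow_mem j c)).2 0
      simpa using this
    cases i with
    | zero =>
      cases j with
      | zero => simpa [consSeq] using hφ c
      | succ j => simpa [consSeq] using key j c
    | succ i =>
      cases j with
      | zero =>
        have := key i c
        rw [← pow_selfAdjoint hf, hB] at this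
        simpa [consSeq] using this
      | succ j => simpa [consSeq] using h.gram i j c

end Existence

/-! ### Normal form of nilpotent self-adjoint endomorphisms. -/

section NormalForm

variable {V : Type*} [AddCommGroup V] [Module ℂ V]

theorem exists_form_pow {B : LinearMap.BilinForm ℂ V} {f : End ℂ V} (hB : ∀ x y, B x y = B y x)
    (hf : ∀ x y, B (f x) y = B x (f y)) {K : ℕ} {M : Submodule ℂ V}
    (hK : ∀ x ∈ M, (f ^ (K + 1)) x = 0) (hM : ∀ x ∈ M, f x ∈ M)
    (hnd : ∀ x ∈ M, (∀ y ∈ M, B x y = 0) → x = 0) (h1 : ∃ x ∈ M, (f ^ K) x ≠ 0) :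
    ∃ v ∈ M, ∀ c, B v ((f ^ c) v) = if c = K then 1 else 0 := by
  -- Polarization: $(x,y)\mapsto B(x,f^Ky)$ is a nonzero symmetric form on $M$, so its quadratic
  -- form does not vanish.
  have h2 : ∃ u ∈ M, B u ((f ^ K) u) ≠ 0 := by
    by_contra! hall
    obtain ⟨x, hx, hx0⟩ := h1
    refine hx0 (hnd _ (pow_mem_of_map_mem hM K hx) fun y hy => ?_)
    have h := hall (x + y) (add_mem hx hy)
    have e : B y ((f ^ K) x) = B x ((f ^ K) y) := by rw [hB, pow_selfAdjoint hf]
    simp only [map_add, LinearMap.add_apply, hall x hx, hall y hy, e] at h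
    rw [pow_selfAdjoint hf]
    linear_combination h / 2
  have key : ∀ r ≤ K, ∃ v ∈ M, ∀ c, K - r ≤ c → B v ((f ^ c) v) = if c = K then 1 else 0 := by
    intro r hr
    induction r with
    | zero =>
      obtain ⟨u, hu, hu0⟩ := h2
      obtain ⟨z, hz⟩ := IsAlgClosed.exists_pow_nat_eq (B u ((f ^ K) u)) (n := 2) (by norm_num)
      have hz0 : z ≠ 0 := by
        rintro rfl
        exact hu0 (by rw [← hz]; simp)
      refine ⟨z⁻¹ • u, M.smul_mem _ hu, fun c hc => ?_⟩
      split_ifs with h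
      · rw [h]
        simp only [map_smul, LinearMap.smul_apply, smul_eq_mul, ← hz]
        field_simp
      · rw [pow_apply_eq_zero_of_le (hK _ (M.smul_mem _ hu)) (by omega), map_zero]
    | succ r ih =>
      obtain ⟨v, hv, hφ⟩ := ih (by omega)
      -- At $c=K-r-1$ the new value is the old one plus $2\alpha B(v,f^Kv)=2\alpha$; the $\alpha^2$
      -- term contains a power of $f$ beyond $K$ and vanishes.
      set α : ℂ := -(B v ((f ^ (K - (r + 1))) v)) / 2 with hα
      refine ⟨v + α • (f ^ (r + 1)) v,
        add_mem hv (M.smul_mem _ (pow_mem_of_map_mem hM _ hv)), fun c hc => ?_⟩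
      have e : B (v + α • (f ^ (r + 1)) v) ((f ^ c) (v + α • (f ^ (r + 1)) v)) =
          B v ((f ^ c) v) + 2 * α * B v ((f ^ (c + (r + 1))) v) +
            α ^ 2 * B v ((f ^ (r + 1 + c + (r + 1))) v) := by
        simp only [map_add, map_smul, LinearMap.add_apply, LinearMap.smul_apply, smul_eq_mul,
          pow_selfAdjoint hf, ← Module.End.mul_apply, ← pow_add, ← add_assoc]
        rw [show r + 1 + c = c + r + 1 by omega]
        ring
      rw [e, pow_apply_eq_zero_of_le (hK v hv) (show K + 1 ≤ r + 1 + c + (r + 1) by omega),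
        map_zero]
      rcases Nat.lt_or_ge (K - (r + 1)) c with hlt | hle
      · rw [pow_apply_eq_zero_of_le (l := c + (r + 1)) (hK v hv) (by omega), hφ c (by omega)]
        simp
      · have : c = K - (r + 1) := by omega
        subst this
        rw [show K - (r + 1) + (r + 1) = K by omega, hφ K (by omega), if_pos rfl,
          if_neg (by omega), hα]
        ring
  obtain ⟨v, hv, hφ⟩ := key K le_rfl
  exact ⟨v, hv, fun c => hφ c (by omega)⟩

/-- The normal form of a nilpotent self-adjoint endomorphism. -/
theorem exists_isNormalBasis [FiniteDimensional ℂ V] {B : LinearMap.BilinForm ℂ V} {f : End ℂ V}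
    (hB : ∀ x y, B x y = B y x) (hf : ∀ x y, B (f x) y = B x (f y)) {M : Submodule ℂ V}
    (hM : ∀ x ∈ M, f x ∈ M) (hnil : ∃ k, ∀ x ∈ M, (f ^ k) x = 0)
    (hnd : ∀ x ∈ M, (∀ y ∈ M, B x y = 0) → x = 0) :
    ∃ s p v, IsNormalBasis B f s p v M := by
  induction hn : finrank ℂ M using Nat.strong_induction_on generalizing M with
  | _ n ih =>
    by_cases h0 : M = ⊥
    · subst h0
      exact ⟨_, _, _, isChainBasis_bot f, fun i j c => by simp⟩
    obtain ⟨K, hK, hKv⟩ := exists_pow_ne_zero h0 hnil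
    obtain ⟨v, hv, hφ⟩ := exists_form_pow hB hf hK hM hnd hKv
    have hfin := finrank_chainCompl hM hv hφ
    obtain ⟨s, p, w, h⟩ := ih _ (by omega : finrank ℂ (chainCompl f (B v) K M) < n)
      (fun x hx => map_mem_chainCompl hK hM hx) ⟨K + 1, fun x hx => hK x hx.1⟩ (by
        intro x hx hx'
        -- The form stays nondegenerate on the complement, because the complement is orthogonal to
        -- the chain and together they span $M$.
        have hx2 := (mem_chainCompl hK).1 hx
        refine hnd x hx2.1 fun y hy => ?_
        have h1 := hx' _ (sub_sum_mem_chainCompl hK hM hv hφ hy)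
        rw [map_sub, map_sum, Finset.sum_eq_zero, sub_zero] at h1
        · exact h1
        · intro a _
          rw [map_smul, hB x, pow_selfAdjoint hf, hx2.2, smul_zero]) rfl
    exact ⟨_, _, _, h.cons hB hf hK hM hv hφ⟩

end NormalForm

/-! ### Witt pairs, their projections, and block triangular endomorphisms. -/

section Witt

variable {𝕜 V ι : Type*} [Field 𝕜] [AddCommGroup V] [Module 𝕜 V] [Fintype ι] [DecidableEq ι]

/-- Two families that span isotropic subspaces and are dual to each other. -/
structure IsWittPair (B : LinearMap.BilinForm 𝕜 V) (e f : ι → V) : Prop where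
  symm : ∀ x y, B x y = B y x
  left : ∀ i j, B (e i) (e j) = 0
  right : ∀ i j, B (f i) (f j) = 0
  dual : ∀ i j, B (e i) (f j) = if i = j then 1 else 0

/-- The map `x ↦ ∑ i, B (a i) x • b i`. -/
def pairMap (B : LinearMap.BilinForm 𝕜 V) (a b : ι → V) : End 𝕜 V :=
  ∑ i, (B (a i)).smulRight (b i)

omit [DecidableEq ι] in
theorem pairMap_apply (B : LinearMap.BilinForm 𝕜 V) (a b : ι → V) (x : V) :
    pairMap B a b x = ∑ i, B (a i) x • b i := by
  simp [pairMap]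

/-- The projection to the orthogonal complement of both families of a Witt pair. -/
def midMap (B : LinearMap.BilinForm 𝕜 V) (e f : ι → V) : End 𝕜 V :=
  1 - pairMap B f e - pairMap B e f

/-- The block diagonal part of `x` for the splitting given by a Witt pair. -/
def blockDiag (B : LinearMap.BilinForm 𝕜 V) (e f : ι → V) (x : End 𝕜 V) : End 𝕜 V :=
  pairMap B f e * x * pairMap B f e + midMap B e f * x * midMap B e f +
    pairMap B e f * x * pairMap B e f

variable {B : LinearMap.BilinForm 𝕜 V} {e f : ι → V}

namespace IsWittPair

omit [Fintype ι] in
theorem swap (h : IsWittPair B e f) : IsWittPair B f e where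
  symm := h.symm
  left := h.right
  right := h.left
  dual i j := by rw [h.symm, h.dual]; simp only [eq_comm]

/-- `pairMap B f e` is the projection onto the span of `e` and `pairMap B e f` the one onto the span
of `f`. They are exchanged by taking adjoints, and `midMap B e f` is self-adjoint. -/
theorem adjoint (h : IsWittPair B e f) (x y : V) :
    B (pairMap B f e x) y = B x (pairMap B e f y) := by
  simp only [pairMap_apply, map_sum, LinearMap.sum_apply, map_smul, LinearMap.smul_apply,
    smul_eq_mul]
  exact Finset.sum_congr rfl fun i _ => by rw [h.symm x (f i)]; ring

theorem adjoint_mid (h : IsWittPair B e f) (x y : V) :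
    B (midMap B e f x) y = B x (midMap B e f y) := by
  simp only [midMap, LinearMap.sub_apply, Module.End.one_apply, map_sub, h.adjoint, h.swap.adjoint]
  ring

theorem pairMap_e (h : IsWittPair B e f) (i : ι) : pairMap B f e (e i) = e i := by
  simp [pairMap_apply, h.swap.dual]

theorem pairMap_f (h : IsWittPair B e f) (i : ι) : pairMap B f e (f i) = 0 := by
  simp [pairMap_apply, h.right]

theorem pairMap_pairMap (h : IsWittPair B e f) (x : V) :
    pairMap B f e (pairMap B f e x) = pairMap B f e x := by
  simp only [pairMap_apply B f e x, map_sum, map_smul, h.pairMap_e]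

theorem pairMap_pairMap_swap (h : IsWittPair B e f) (x : V) :
    pairMap B f e (pairMap B e f x) = 0 := by
  simp only [pairMap_apply B e f x, map_sum, map_smul, h.pairMap_f, smul_zero,
    Finset.sum_const_zero]

theorem pairMap_mid (h : IsWittPair B e f) (x : V) : pairMap B f e (midMap B e f x) = 0 := by
  simp [midMap, h.pairMap_pairMap, h.pairMap_pairMap_swap]

omit [DecidableEq ι] in
theorem midMap_swap : midMap B f e = midMap B e f := by
  simp only [midMap]
  abel

theorem pairMap_swap_mid (h : IsWittPair B e f) (x : V) :
    pairMap B e f (midMap B e f x) = 0 := by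
  rw [← midMap_swap]
  exact h.swap.pairMap_mid x

theorem mid_pairMap (h : IsWittPair B e f) (x : V) : midMap B e f (pairMap B f e x) = 0 := by
  simp [midMap, h.pairMap_pairMap, h.swap.pairMap_pairMap_swap]

theorem mid_pairMap_swap (h : IsWittPair B e f) (x : V) :
    midMap B e f (pairMap B e f x) = 0 := by
  rw [← midMap_swap]
  exact h.swap.mid_pairMap x

theorem mid_mid (h : IsWittPair B e f) (x : V) :
    midMap B e f (midMap B e f x) = midMap B e f x := by
  have e1 : ∀ y, midMap B e f y = y - pairMap B f e y - pairMap B e f y := fun _ => rfl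
  rw [e1 (midMap B e f x), h.pairMap_mid, h.pairMap_swap_mid, sub_zero, sub_zero]

omit [DecidableEq ι] in
theorem decomp (x : V) : x = pairMap B f e x + midMap B e f x + pairMap B e f x := by
  simp only [midMap, LinearMap.sub_apply, Module.End.one_apply]
  abel

theorem mem_range_pairMap (h : IsWittPair B e f) {x : V} :
    x ∈ LinearMap.range (pairMap B f e) ↔ pairMap B f e x = x :=
  ⟨by rintro ⟨y, rfl⟩; exact h.pairMap_pairMap y, fun hx => ⟨x, hx⟩⟩

theorem mem_range_mid (h : IsWittPair B e f) {x : V} :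
    x ∈ LinearMap.range (midMap B e f) ↔ midMap B e f x = x :=
  ⟨by rintro ⟨y, rfl⟩; exact h.mid_mid y, fun hx => ⟨x, hx⟩⟩

theorem range_pairMap (h : IsWittPair B e f) :
    LinearMap.range (pairMap B f e) = Submodule.span 𝕜 (Set.range e) := by
  apply le_antisymm
  · rintro _ ⟨x, rfl⟩
    rw [pairMap_apply]
    exact sum_mem fun i _ => Submodule.smul_mem _ _ (Submodule.subset_span ⟨i, rfl⟩)
  · rw [Submodule.span_le]
    rintro _ ⟨i, rfl⟩
    exact ⟨e i, h.pairMap_e i⟩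

theorem pairMap_eq_zero_iff (h : IsWittPair B e f) {x : V} :
    pairMap B e f x = 0 ↔ ∀ i, B (e i) x = 0 := by
  constructor
  · intro hx i
    rw [← h.pairMap_e i, h.adjoint, hx, map_zero]
  · intro hx
    rw [pairMap_apply]
    exact Finset.sum_eq_zero fun i _ => by rw [hx, zero_smul]

theorem blockDiag_selfAdjoint (h : IsWittPair B e f) {x : End 𝕜 V}
    (hx : ∀ u w, B (x u) w = B u (x w)) (u w : V) :
    B (blockDiag B e f x u) w = B u (blockDiag B e f x w) := by
  simp only [blockDiag, LinearMap.add_apply, Module.End.mul_apply, map_add, h.adjoint,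
    h.swap.adjoint, h.adjoint_mid, hx]
  ring

theorem blockDiag_pairMap (h : IsWittPair B e f) (x : End 𝕜 V) (u : V) :
    blockDiag B e f x (pairMap B f e u) = pairMap B f e (x (pairMap B f e u)) := by
  simp [blockDiag, h.pairMap_pairMap, h.mid_pairMap, h.swap.pairMap_pairMap_swap]

omit [DecidableEq ι] in
theorem blockDiag_swap (x : End 𝕜 V) : blockDiag B f e x = blockDiag B e f x := by
  simp only [blockDiag, midMap_swap]
  abel

theorem blockDiag_pairMap_swap (h : IsWittPair B e f) (x : End 𝕜 V) (u : V) :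
    blockDiag B e f x (pairMap B e f u) = pairMap B e f (x (pairMap B e f u)) := by
  rw [← blockDiag_swap]
  exact h.swap.blockDiag_pairMap x u

theorem blockDiag_mid (h : IsWittPair B e f) (x : End 𝕜 V) (u : V) :
    blockDiag B e f x (midMap B e f u) = midMap B e f (x (midMap B e f u)) := by
  simp [blockDiag, h.pairMap_mid, h.mid_mid, h.pairMap_swap_mid]

theorem pairMap_blockDiag (h : IsWittPair B e f) (x : End 𝕜 V) (u : V) :
    pairMap B f e (blockDiag B e f x u) = blockDiag B e f x (pairMap B f e u) := by
  rw [h.blockDiag_pairMap]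
  simp [blockDiag, h.pairMap_pairMap, h.pairMap_mid, h.pairMap_pairMap_swap]

theorem pairMap_swap_blockDiag (h : IsWittPair B e f) (x : End 𝕜 V) (u : V) :
    pairMap B e f (blockDiag B e f x u) = blockDiag B e f x (pairMap B e f u) := by
  rw [← blockDiag_swap]
  exact h.swap.pairMap_blockDiag x u

theorem mid_blockDiag (h : IsWittPair B e f) (x : End 𝕜 V) (u : V) :
    midMap B e f (blockDiag B e f x u) = blockDiag B e f x (midMap B e f u) := by
  rw [h.blockDiag_mid]
  simp [blockDiag, h.mid_mid, h.mid_pairMap, h.mid_pairMap_swap]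

end IsWittPair

/-- The endomorphisms that are strictly block upper triangular for the flag
`0 ⊆ span e ⊆ (span e)ᗮ ⊆ V` of a Witt pair. -/
structure IsStrictBlock (B : LinearMap.BilinForm 𝕜 V) (e f : ι → V) (z : End 𝕜 V) : Prop where
  kills : ∀ i, z (e i) = 0
  maps : ∀ u, (∀ i, B (e i) u = 0) → z u ∈ Submodule.span 𝕜 (Set.range e)
  range : ∀ u i, B (e i) (z u) = 0

namespace IsStrictBlock

omit [Fintype ι] [DecidableEq ι] in
theorem add {z z' : End 𝕜 V} (h : IsStrictBlock B e f z) (h' : IsStrictBlock B e f z') :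
    IsStrictBlock B e f (z + z') where
  kills i := by simp [h.kills, h'.kills]
  maps u hu := add_mem (h.maps u hu) (h'.maps u hu)
  range u i := by simp [h.range, h'.range]

omit [Fintype ι] [DecidableEq ι] in
theorem neg {z : End 𝕜 V} (h : IsStrictBlock B e f z) : IsStrictBlock B e f (-z) where
  kills i := by simp [h.kills]
  maps u hu := neg_mem (h.maps u hu)
  range u i := by simp [h.range]

omit [Fintype ι] [DecidableEq ι] in
theorem smul {z : End 𝕜 V} (h : IsStrictBlock B e f z) (c : 𝕜) : IsStrictBlock B e f (c • z) where
  kills i := by simp [h.kills]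
  maps u hu := Submodule.smul_mem _ c (h.maps u hu)
  range u i := by simp [h.range]

variable {x y : End 𝕜 V} (h : IsWittPair B e f)

include h

/-- A strictly block triangular difference acts as zero on the graded pieces of $V\supseteq
E^\perp\supseteq E\supseteq 0$, where $E$ is the span of `e`. So `y` and the block diagonal map
agree there; this lemma and the next two treat the pieces in turn. -/
theorem pairMap_swap_apply (hz : IsStrictBlock B e f (y - blockDiag B e f x)) (u : V) :
    pairMap B e f (y u) = blockDiag B e f x (pairMap B e f u) := by
  have h1 : pairMap B e f ((y - blockDiag B e f x) u) = 0 :=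
    h.pairMap_eq_zero_iff.2 (hz.range u)
  rw [LinearMap.sub_apply, map_sub, sub_eq_zero] at h1
  rw [h1, h.pairMap_swap_blockDiag]

theorem mid_apply (hz : IsStrictBlock B e f (y - blockDiag B e f x)) {u : V}
    (hu : pairMap B e f u = 0) : midMap B e f (y u) = blockDiag B e f x (midMap B e f u) := by
  have h1 := hz.maps u (h.pairMap_eq_zero_iff.1 hu)
  rw [← h.range_pairMap, h.mem_range_pairMap] at h1
  have h2 := h.mid_pairMap ((y - blockDiag B e f x) u)
  rw [h1, LinearMap.sub_apply, map_sub, sub_eq_zero] at h2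
  rw [h2, h.mid_blockDiag]

theorem apply_of_mem (hz : IsStrictBlock B e f (y - blockDiag B e f x)) {u : V}
    (hu : u ∈ LinearMap.range (pairMap B f e)) : y u = blockDiag B e f x u := by
  rw [← sub_eq_zero, ← LinearMap.sub_apply]
  have : LinearMap.range (pairMap B f e) ≤ LinearMap.ker (y - blockDiag B e f x) := by
    rw [h.range_pairMap, Submodule.span_le]
    rintro _ ⟨i, rfl⟩
    exact hz.kills i
  exact this hu

theorem pow_pairMap_swap (hz : IsStrictBlock B e f (y - blockDiag B e f x)) (k : ℕ) (u : V) :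
    pairMap B e f ((y ^ k) u) = (blockDiag B e f x ^ k) (pairMap B e f u) := by
  induction k with
  | zero => simp
  | succ k ih =>
    rw [pow_succ', pow_succ', Module.End.mul_apply, Module.End.mul_apply,
      hz.pairMap_swap_apply h, ih]

theorem pow_mid (hz : IsStrictBlock B e f (y - blockDiag B e f x)) (k : ℕ) {u : V}
    (hu : pairMap B e f u = 0) :
    midMap B e f ((y ^ k) u) = (blockDiag B e f x ^ k) (midMap B e f u) := by
  induction k with
  | zero => simp
  | succ k ih =>
    rw [pow_succ', pow_succ', Module.End.mul_apply, Module.End.mul_apply,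
      hz.mid_apply h, ih]
    rw [hz.pow_pairMap_swap h, hu, map_zero]

theorem pow_pairMap (hz : IsStrictBlock B e f (y - blockDiag B e f x)) (k : ℕ) (u : V) :
    (y ^ k) (pairMap B f e u) = (blockDiag B e f x ^ k) (pairMap B f e u) ∧
      (y ^ k) (pairMap B f e u) ∈ LinearMap.range (pairMap B f e) := by
  induction k with
  | zero => simp
  | succ k ih =>
    have h1 := hz.apply_of_mem h ih.2
    rw [pow_succ', pow_succ', Module.End.mul_apply, Module.End.mul_apply, ← ih.1]
    refine ⟨h1, ?_⟩
    rw [h1, h.mem_range_pairMap, h.pairMap_blockDiag, h.mem_range_pairMap.1 ih.2]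

theorem blockDiag_pow_eq_zero (hz : IsStrictBlock B e f (y - blockDiag B e f x)) {k : ℕ}
    (hy : y ^ k = 0) : blockDiag B e f x ^ k = 0 := by
  ext u
  rw [IsWittPair.decomp (B := B) (e := e) (f := f) u, map_add, map_add,
    ← hz.pow_pairMap_swap h, ← (hz.pow_pairMap h k u).1, ← h.mid_mid, ← hz.pow_mid h k, hy]
  · simp
  · exact h.pairMap_swap_mid u

/-- Since `y` agrees with the block diagonal map on the graded pieces, each of the three factors
$y^k$ moves one step down the filtration $V\supseteq E^\perp\supseteq E\supseteq 0$. -/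
theorem pow_eq_zero (hz : IsStrictBlock B e f (y - blockDiag B e f x)) {k : ℕ}
    (hD : blockDiag B e f x ^ k = 0) : y ^ (k + k + k) = 0 := by
  ext u
  have h1 : pairMap B e f ((y ^ k) u) = 0 := by rw [hz.pow_pairMap_swap h, hD]; rfl
  have h2 : pairMap B e f ((y ^ k) ((y ^ k) u)) = 0 := by rw [hz.pow_pairMap_swap h, hD]; rfl
  have h3 : midMap B e f ((y ^ k) ((y ^ k) u)) = 0 := by rw [hz.pow_mid h k h1, hD]; rfl
  rw [pow_add, pow_add, mul_assoc, Module.End.mul_apply, Module.End.mul_apply]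
  rw [IsWittPair.decomp (B := B) (e := e) (f := f) ((y ^ k) ((y ^ k) u)), h2, h3, add_zero,
    add_zero, (hz.pow_pairMap h k _).1, hD]
  rfl

theorem finrank_le [FiniteDimensional 𝕜 V] (hz : IsStrictBlock B e f (y - blockDiag B e f x))
    {s₁ s₂ s₃ : ℕ} {p₁ p₂ p₃ : ℕ → ℕ} {v₁ v₂ v₃ : ℕ → V}
    (b₁ : IsChainBasis (blockDiag B e f x) s₁ p₁ v₁ (LinearMap.range (pairMap B f e)))
    (b₂ : IsChainBasis (blockDiag B e f x) s₂ p₂ v₂ (LinearMap.range (midMap B e f)))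
    (b₃ : IsChainBasis (blockDiag B e f x) s₃ p₃ v₃ (LinearMap.range (pairMap B e f)))
    {U : Submodule 𝕜 V} (hU : ∀ u ∈ U, y u ∈ U) {j : ℕ}
    (hj : finrank 𝕜 (U ⊓ LinearMap.ker y : Submodule 𝕜 V) ≤ j) :
    finrank 𝕜 U ≤ ∑ i ∈ Finset.range j, (p₁ i + p₂ i + p₃ i) := by
  refine finrank_le_of_block (π₃ := pairMap B e f) (π₂ := midMap B e f)
    (LinearMap.mem_range_self _) (fun u _ => LinearMap.mem_range_self _ u) ?_
    (hz.pairMap_swap_apply h) (fun u hu => hz.mid_apply h hu) (fun u hu => hz.apply_of_mem h hu)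
    b₁ b₂ b₃ hU hj
  intro u h3 h2
  rw [h.mem_range_pairMap]
  conv_rhs => rw [IsWittPair.decomp (B := B) (e := e) (f := f) u, h3, h2, add_zero, add_zero]

/-- A self-adjoint endomorphism that stabilizes `span e` is block upper triangular. -/
theorem sub_blockDiag (hx : ∀ u w, B (x u) w = B u (x w))
    (hE : ∀ i, x (e i) ∈ Submodule.span 𝕜 (Set.range e)) :
    IsStrictBlock B e f (x - blockDiag B e f x) := by
  have hE' : ∀ u, pairMap B f e (x (pairMap B f e u)) = x (pairMap B f e u) := by
    intro u
    rw [← h.mem_range_pairMap, h.range_pairMap, pairMap_apply, map_sum]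
    exact sum_mem fun i _ => by
      rw [map_smul]
      exact Submodule.smul_mem _ _ (hE i)
  -- By self-adjointness, stability of the span of `e` passes to its orthogonal complement.
  have h3 : ∀ u, pairMap B e f u = 0 → pairMap B e f (x u) = 0 := by
    intro u hu
    rw [h.pairMap_eq_zero_iff]
    intro i
    rw [← hx, ← h.pairMap_e i, ← hE', h.adjoint, hu, map_zero]
  have hz3 : ∀ u, pairMap B e f ((x - blockDiag B e f x) u) = 0 := by
    intro u
    have e1 := h3 (u - pairMap B e f u) (by rw [map_sub, h.swap.pairMap_pairMap, sub_self])
    rw [map_sub, map_sub] at e1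
    rw [LinearMap.sub_apply, map_sub, h.pairMap_swap_blockDiag, h.blockDiag_pairMap_swap, e1]
  refine ⟨fun i => ?_, fun u hu => ?_, fun u => h.pairMap_eq_zero_iff.1 (hz3 u)⟩
  · rw [LinearMap.sub_apply]
    conv_lhs => rw [← h.pairMap_e i, h.blockDiag_pairMap, hE', sub_self]
  · rw [← h.pairMap_eq_zero_iff] at hu
    rw [← h.range_pairMap, h.mem_range_pairMap]
    conv_rhs => rw [IsWittPair.decomp (B := B) (e := e) (f := f) ((x - blockDiag B e f x) u)]
    rw [hz3, add_zero]
    have e2 : midMap B e f ((x - blockDiag B e f x) u) = 0 := by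
      have e3 : u - midMap B e f u = pairMap B f e u := by
        rw [sub_eq_iff_eq_add]
        conv_lhs => rw [IsWittPair.decomp (B := B) (e := e) (f := f) u, hu, add_zero]
      rw [LinearMap.sub_apply, map_sub, h.mid_blockDiag, h.blockDiag_mid, ← map_sub, ← map_sub, e3,
        ← hE', h.mid_pairMap]
    rw [e2, add_zero]

end IsStrictBlock

theorem surjective_of_nondegenerate [FiniteDimensional 𝕜 V] {B : LinearMap.BilinForm 𝕜 V}
    (hnd : ∀ x, (∀ y, B x y = 0) → x = 0) :
    Function.Surjective (B : V →ₗ[𝕜] Module.Dual 𝕜 V) := by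
  have hinj : Function.Injective (B : V →ₗ[𝕜] Module.Dual 𝕜 V) := by
    rw [injective_iff_map_eq_zero]
    intro x hx
    exact hnd x fun y => by rw [hx]; rfl
  exact (LinearMap.injective_iff_surjective_of_finrank_eq_finrank
    Subspace.dual_finrank_eq.symm).1 hinj

theorem exists_dual_family [FiniteDimensional 𝕜 V] (hB : ∀ x y, B x y = B y x)
    (hnd : ∀ x, (∀ y, B x y = 0) → x = 0) (he : LinearIndependent 𝕜 e) :
    ∃ g : ι → V, ∀ i j, B (e i) (g j) = if i = j then 1 else 0 := by
  have hsurj := surjective_of_nondegenerate hnd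
  obtain ⟨L, hL⟩ := LinearMap.exists_leftInverse_of_injective
    (Fintype.linearCombination 𝕜 e) (LinearMap.ker_eq_bot.2 he.fintypeLinearCombination_injective)
  choose g hg using fun j => hsurj (LinearMap.proj j ∘ₗ L)
  refine ⟨g, fun i j => ?_⟩
  rw [hB, hg, LinearMap.comp_apply]
  have : L (e i) = Pi.single i 1 := by
    have := LinearMap.congr_fun hL (Pi.single i 1)
    simpa using this
  rw [this, LinearMap.proj_apply, Pi.single_apply]
  simp only [eq_comm]

/-- Subtracting from a dual family half of its Gram matrix applied to `e` makes it isotropic; the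
duality is unaffected because `e` is isotropic. -/
theorem exists_isWittPair [FiniteDimensional 𝕜 V] [NeZero (2 : 𝕜)] (hB : ∀ x y, B x y = B y x)
    (hnd : ∀ x, (∀ y, B x y = 0) → x = 0) (he : LinearIndependent 𝕜 e)
    (hee : ∀ i j, B (e i) (e j) = 0) : ∃ f : ι → V, IsWittPair B e f := by
  obtain ⟨g, hg⟩ := exists_dual_family hB hnd he
  have hg' : ∀ i j, B (g j) (e i) = if i = j then 1 else 0 := fun i j => by rw [hB, hg]
  refine ⟨fun j => g j - (2 : 𝕜)⁻¹ • ∑ i, B (g i) (g j) • e i, hB, hee, fun i j => ?_,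
    fun i j => ?_⟩
  · simp only [map_sub, map_smul, map_sum, LinearMap.sub_apply, LinearMap.smul_apply,
      LinearMap.sum_apply, hee, hg, hg', smul_eq_mul, mul_zero, Finset.sum_const_zero, mul_ite,
      mul_one, Finset.sum_ite_eq', Finset.mem_univ, if_true, sub_zero]
    rw [hB (g j) (g i)]
    have h2 : (2 : 𝕜) ≠ 0 := NeZero.ne 2
    field_simp
    ring
  · simp [hee, hg]

end Witt

/-! ### Linking chains of the three diagonal blocks. -/

section Link

variable {V : Type*} [AddCommGroup V] [Module ℂ V]

/-- The map that links the end of the `j`-th dual chain to the start of the chain of `w j` and the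
end of the latter to `e j`, or, if the chain of `w j` is empty, the end of the dual chain to
`e j`. -/
noncomputable def linkMap (B : LinearMap.BilinForm ℂ V) (s : ℕ) (μ : ℕ → ℕ) (e w : ℕ → V) :
    End ℂ V :=
  ∑ i ∈ Finset.range s, ((B (e i)).smulRight (w i) + (B (w i)).smulRight (e i) +
    if μ i = 0 then (B (e i)).smulRight (e i) else 0)

theorem linkMap_apply (B : LinearMap.BilinForm ℂ V) (s : ℕ) (μ : ℕ → ℕ) (e w : ℕ → V) (x : V) :
    linkMap B s μ e w x = ∑ i ∈ Finset.range s, (B (e i) x • w i + B (w i) x • e i +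
      if μ i = 0 then B (e i) x • e i else 0) := by
  rw [linkMap, LinearMap.sum_apply]
  refine Finset.sum_congr rfl fun i _ => ?_
  split_ifs <;> simp

theorem linkMap_selfAdjoint {B : LinearMap.BilinForm ℂ V} (hB : ∀ x y, B x y = B y x) (s : ℕ)
    (μ : ℕ → ℕ) (e w : ℕ → V) (x y : V) :
    B (linkMap B s μ e w x) y = B x (linkMap B s μ e w y) := by
  simp only [linkMap_apply, map_sum, LinearMap.sum_apply]
  refine Finset.sum_congr rfl fun i _ => ?_
  split_ifs <;> simp only [map_add, map_smul, LinearMap.add_apply, LinearMap.smul_apply,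
    smul_eq_mul, map_zero, LinearMap.zero_apply, hB x (e i), hB x (w i)] <;> ring

/-- The chain that the endomorphism `D + linkMap` generates. -/
def linkChain (D : End ℂ V) (ν μ : ℕ → ℕ) (e w t : ℕ → V) (j c : ℕ) : V :=
  if c < ν j then (D ^ c) (t j)
  else if c < ν j + μ j then (D ^ (c - ν j)) (w j)
  else (D ^ (c - ν j - μ j)) (e j)

/-- Chains `e`, `w`, `t` of `D` in a Witt decomposition, where the chains `t` are dual to the
chains `e`, and the chains `w` are in normal form. -/
structure IsLinkData (B : LinearMap.BilinForm ℂ V) (D : End ℂ V) (s : ℕ) (ν μ : ℕ → ℕ)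
    (e w t : ℕ → V) : Prop where
  e_e : ∀ i j a, B (e i) ((D ^ a) (e j)) = 0
  e_w : ∀ i j a, B (e i) ((D ^ a) (w j)) = 0
  w_e : ∀ i j a, B (w i) ((D ^ a) (e j)) = 0
  w_t : ∀ i j a, B (w i) ((D ^ a) (t j)) = 0
  t_w : ∀ i j a, B (t i) ((D ^ a) (w j)) = 0
  t_t : ∀ i j a, B (t i) ((D ^ a) (t j)) = 0
  w_w : ∀ i j a, B (w i) ((D ^ a) (w j)) = if i = j ∧ a + 1 = μ i then 1 else 0
  e_t : ∀ i j a, B (e i) ((D ^ a) (t j)) = if i = j ∧ a + 1 = ν i then 1 else 0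
  t_e : ∀ i j a, B (t i) ((D ^ a) (e j)) = if i = j ∧ a + 1 = ν i then 1 else 0
  pow_t : ∀ i, (D ^ ν i) (t i) = 0
  pow_w : ∀ i, (D ^ μ i) (w i) = 0
  pow_e : ∀ i, (D ^ ν i) (e i) = 0
  supp : ∀ i, s ≤ i → ν i = 0

namespace IsLinkData

variable {B : LinearMap.BilinForm ℂ V} {D : End ℂ V} {s : ℕ} {ν μ : ℕ → ℕ} {e w t : ℕ → V}
  (h : IsLinkData B D s ν μ e w t)

include h

theorem e_eq_zero {i : ℕ} (hi : ν i = 0) : e i = 0 := by simpa [hi] using h.pow_e i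

theorem w_eq_zero {i : ℕ} (hi : μ i = 0) : w i = 0 := by simpa [hi] using h.pow_w i

theorem link_e (j a : ℕ) : linkMap B s μ e w ((D ^ a) (e j)) = 0 := by
  rw [linkMap_apply]
  exact Finset.sum_eq_zero fun i _ => by simp [h.e_e, h.w_e]

theorem link_w (j a : ℕ) :
    linkMap B s μ e w ((D ^ a) (w j)) = if a + 1 = μ j then e j else 0 := by
  rw [linkMap_apply]
  simp only [h.e_w, h.w_w, zero_smul, ite_self, add_zero, zero_add]
  by_cases hj : j < s
  · rw [Finset.sum_eq_single j]
    · split_ifs <;> simp_all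
    · intro i _ hij
      rw [if_neg (by tauto), zero_smul]
    · simp [hj]
  · rw [h.e_eq_zero (h.supp j (by omega)), ite_self]
    refine Finset.sum_eq_zero fun i hi => ?_
    have := Finset.mem_range.1 hi
    rw [if_neg (by omega), zero_smul]

theorem link_t (j a : ℕ) :
    linkMap B s μ e w ((D ^ a) (t j)) =
      if a + 1 = ν j then w j + (if μ j = 0 then e j else 0) else 0 := by
  rw [linkMap_apply]
  simp only [h.e_t, h.w_t, zero_smul, add_zero]
  by_cases hj : j < s
  · rw [Finset.sum_eq_single j]
    · split_ifs <;> simp_all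
    · intro i _ hij
      rw [if_neg (by tauto), zero_smul, zero_smul, ite_self, zero_add]
    · simp [hj]
  · rw [if_neg (by rw [h.supp j (by omega)]; omega)]
    refine Finset.sum_eq_zero fun i hi => ?_
    have := Finset.mem_range.1 hi
    rw [if_neg (by omega), zero_smul, zero_smul, ite_self, zero_add]

/-- Within a segment only $D$ acts. At the end of a segment $D$ gives zero and the link supplies the
start of the next one; the extra term for `μ j = 0` jumps over an empty middle segment. -/
theorem apply_linkChain (j c : ℕ) :
    (D + linkMap B s μ e w) (linkChain D ν μ e w t j c) = linkChain D ν μ e w t j (c + 1) := by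
  rw [LinearMap.add_apply]
  have hD : ∀ (a : ℕ) (x : V), D ((D ^ a) x) = (D ^ (a + 1)) x := fun a x => by
    rw [pow_succ', Module.End.mul_apply]
  unfold linkChain
  by_cases h1 : c < ν j
  · rw [if_pos h1, h.link_t, hD]
    by_cases h2 : c + 1 < ν j
    · rw [if_pos h2, if_neg (by omega), add_zero]
    · have h3 : c + 1 = ν j := by omega
      rw [if_pos h3, if_neg h2, h3, h.pow_t, zero_add]
      by_cases h4 : μ j = 0
      · rw [if_pos h4, if_neg (by omega), h.w_eq_zero h4]
        simp [h4]
      · rw [if_neg h4, if_pos (by omega)]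
        simp
  · rw [if_neg h1, if_neg (by omega : ¬ c + 1 < ν j)]
    by_cases h2 : c < ν j + μ j
    · rw [if_pos h2, h.link_w, hD]
      by_cases h3 : c + 1 < ν j + μ j
      · rw [if_pos h3, if_neg (by omega), add_zero, show c + 1 - ν j = c - ν j + 1 by omega]
      · rw [if_neg h3, if_pos (by omega), show c - ν j + 1 = μ j by omega, h.pow_w,
          show c + 1 - ν j - μ j = 0 by omega]
        simp
    · rw [if_neg h2, if_neg (by omega), h.link_e, add_zero, hD,
        show c + 1 - ν j - μ j = c - ν j - μ j + 1 by omega]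

theorem pow_apply_linkChain (j c : ℕ) :
    ((D + linkMap B s μ e w) ^ c) (linkChain D ν μ e w t j 0) = linkChain D ν μ e w t j c := by
  induction c with
  | zero => simp
  | succ c ih => rw [pow_succ', Module.End.mul_apply, ih, h.apply_linkChain]

/-- The pairing of `t` with `e` puts the $1$ at the far end of the linked chain. Feeding this into
`linearIndependent_of_gram` gives independent chains of lengths $\nu_i+\mu_i+\nu_i$. -/
theorem gram (i j c : ℕ) :
    B (linkChain D ν μ e w t i 0)
      (((D + linkMap B s μ e w) ^ c) (linkChain D ν μ e w t j 0)) =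
        if i = j ∧ c + 1 = ν i + μ i + ν i then 1 else 0 := by
  rw [h.pow_apply_linkChain]
  unfold linkChain
  by_cases hi : 0 < ν i
  · rw [if_pos hi, pow_zero, Module.End.one_apply]
    by_cases hij : i = j
    · subst hij
      by_cases h1 : c < ν i
      · rw [if_pos h1, h.t_t, if_neg fun hh => by omega]
      · rw [if_neg h1]
        by_cases h2 : c < ν i + μ i
        · rw [if_pos h2, h.t_w, if_neg fun hh => by omega]
        · rw [if_neg h2, h.t_e]
          congr 1
          rw [eq_iff_iff]
          omega
    · rw [if_neg (c := i = j ∧ _) fun hh => hij hh.1]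
      split_ifs
      · rw [h.t_t]
      · rw [h.t_w]
      · rw [h.t_e, if_neg fun hh => hij hh.1]
  · have hi0 : ν i = 0 := by omega
    rw [if_neg hi]
    by_cases hm : 0 < μ i
    · rw [if_pos (by omega), hi0, Nat.sub_zero, pow_zero, Module.End.one_apply]
      by_cases hij : i = j
      · subst hij
        rw [if_neg (by omega)]
        by_cases h2 : c < ν i + μ i
        · rw [if_pos h2, h.w_w, hi0, Nat.sub_zero]
          simp
        · rw [if_neg h2, h.w_e, if_neg (by omega)]
      · rw [if_neg (c := i = j ∧ _) fun hh => hij hh.1]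
        split_ifs
        · rw [h.w_t]
        · rw [h.w_w, if_neg fun hh => hij hh.1]
        · rw [h.w_e]
    · rw [if_neg (c := 0 < ν i + μ i) (by omega), h.e_eq_zero hi0,
        if_neg (c := i = j ∧ _) fun hh => by omega]
      simp

end IsLinkData

end Link

/-! ### A generic element for an invariant isotropic subspace. -/

section Induction

variable {V : Type*} [AddCommGroup V] [Module ℂ V] [FiniteDimensional ℂ V]

/-- Let `x` be nilpotent and self-adjoint, let it stabilize the isotropic subspace `E`, and let `ν`
and `μ` be its Jordan types on `E` and on `Eᗮ / E`.  Then some element of `x + 𝔫`, for the parabolic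
subalgebra given by `E`, has Jordan type `p = μ + 2 ν`, and the type of `x` is at most `p`. -/
theorem exists_generic {B : LinearMap.BilinForm ℂ V} (hB : ∀ x y, B x y = B y x)
    (hnd : ∀ x, (∀ y, B x y = 0) → x = 0) {x : End ℂ V} (hx : ∀ u w, B (x u) w = B u (x w))
    (hnil : IsNilpotent x) {E : Submodule ℂ V} (hE : ∀ u ∈ E, x u ∈ E) (hE0 : E ≠ ⊥)
    (hiso : ∀ u ∈ E, ∀ w ∈ E, B u w = 0) :
    ∃ (z : End ℂ V) (s : ℕ) (p : ℕ → ℕ) (v : ℕ → V),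
      (∀ u w, B (z u) w = B u (z w)) ∧ (∀ u ∈ E, z u = 0) ∧
      (∀ u, (∀ w ∈ E, B w u = 0) → z u ∈ E) ∧ (∀ u, ∀ w ∈ E, B w (z u) = 0) ∧
      (∃ k, (x + z) ^ k = 0) ∧
      (∀ i, s ≤ i → p i = 0) ∧ (∃ i, p (i + 1) + 2 ≤ p i) ∧
      LinearIndependent ℂ (chainFamily (x + z) s p v) ∧
      ∀ (U : Submodule ℂ V) (j : ℕ), (∀ u ∈ U, x u ∈ U) →
        finrank ℂ (U ⊓ LinearMap.ker x : Submodule ℂ V) ≤ j →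
        finrank ℂ U ≤ ∑ i ∈ Finset.range j, p i := by
  classical
  obtain ⟨k, hk⟩ := hnil
  obtain ⟨s, ν, ve, bE⟩ := exists_isChainBasis hE ⟨k, fun u _ => by rw [hk]; rfl⟩
  set ι := Σ i : Fin s, Fin (ν i)
  set e : ι → V := chainFamily x s ν ve with he
  have heE : Submodule.span ℂ (Set.range e) = E := by
    rw [he, ← chainSpan_eq_span_chainFamily bE.supp bE.pow_apply, bE.span_eq]
  have heE' : ∀ i, e i ∈ E := fun i => heE ▸ Submodule.subset_span ⟨i, rfl⟩
  obtain ⟨f, h⟩ := exists_isWittPair hB hnd bE.linearIndependent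
    fun i j => hiso _ (heE' i) _ (heE' j)
  have hr1 : LinearMap.range (pairMap B f e) = E := by rw [h.range_pairMap, heE]
  have hxD : IsStrictBlock B e f (x - blockDiag B e f x) :=
    IsStrictBlock.sub_blockDiag h hx fun i => heE ▸ hE _ (heE' i)
  set D := blockDiag B e f x with hDdef
  have hDk : D ^ k = 0 := hxD.blockDiag_pow_eq_zero h hk
  have hD : ∀ u w, B (D u) w = B u (D w) := h.blockDiag_selfAdjoint hx
  have bE' : IsChainBasis D s ν ve E :=
    bE.congr fun u hu => (hxD.apply_of_mem h (by rwa [hr1])).symm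
  have hpow : ∀ a i, (D ^ a) (ve i) = (x ^ a) (ve i) := fun a i => by
    have h1 := h.mem_range_pairMap.1 (hr1.symm ▸ bE.pow_mem i 0)
    have h2 := (hxD.pow_pairMap h a ((x ^ 0) (ve i))).1
    rw [h1] at h2
    exact h2.symm
  -- the middle part
  obtain ⟨sW, μ, w, bW⟩ := exists_isNormalBasis hB hD
    (M := LinearMap.range (midMap B e f))
    (by
      rintro _ ⟨u, rfl⟩
      exact ⟨D u, h.mid_blockDiag x u⟩)
    ⟨k, fun u _ => by rw [hDk]; rfl⟩
    (by
      intro u hu hu'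
      refine hnd u fun y => ?_
      rw [← h.mem_range_mid.1 hu, h.adjoint_mid]
      exact hu' _ ⟨y, rfl⟩)
  -- the dual chains
  set t : ℕ → V := fun j => if hj : j < s ∧ 0 < ν j then
    f ⟨⟨j, hj.1⟩, ⟨ν j - 1, Nat.sub_lt hj.2 one_pos⟩⟩ else 0 with ht
  have t_mem : ∀ j, pairMap B e f (t j) = t j := by
    intro j
    simp only [ht]
    split_ifs
    · exact h.swap.pairMap_e _
    · exact map_zero _
  have t_ve : ∀ i j c, B (t i) ((D ^ c) (ve j)) = if i = j ∧ c + 1 = ν i then 1 else 0 := by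
    intro i j c
    rw [hpow]
    by_cases hc : c < ν j
    · have hj : j < s := by
        by_contra hj
        rw [bE.supp j (by omega)] at hc
        omega
      have e1 : (x ^ c) (ve j) = e ⟨⟨j, hj⟩, ⟨c, hc⟩⟩ := rfl
      rw [e1]
      simp only [ht]
      split_ifs with h1 h2 h2
      · obtain ⟨rfl, h2⟩ := h2
        have : c = ν i - 1 := by omega
        subst this
        rw [h.swap.dual, if_pos rfl]
      · rw [h.swap.dual, if_neg]
        intro h3
        simp only [Sigma.mk.injEq, Fin.mk.injEq] at h3
        obtain ⟨rfl, h3⟩ := h3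
        simp only [heq_eq_eq, Fin.mk.injEq] at h3
        exact h2 ⟨rfl, by omega⟩
      · obtain ⟨rfl, h2⟩ := h2
        exact absurd ⟨hj, by omega⟩ h1
      · simp
    · rw [pow_apply_eq_zero_of_le (bE.pow_apply j) (by omega), map_zero, if_neg]
      rintro ⟨rfl, h2⟩
      omega
  have ve_t : ∀ i j c, B (ve i) ((D ^ c) (t j)) = if i = j ∧ c + 1 = ν i then 1 else 0 := by
    intro i j c
    rw [hB, pow_selfAdjoint hD, t_ve]
    congr 1
    rw [eq_iff_iff]
    constructor <;> (rintro ⟨rfl, h2⟩; exact ⟨rfl, h2⟩)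
  have t_pow_mem : ∀ j a, (D ^ a) (t j) ∈ LinearMap.range (pairMap B e f) := by
    intro j a
    induction a with
    | zero => exact ⟨t j, t_mem j⟩
    | succ a ih =>
      obtain ⟨u, hu⟩ := ih
      rw [pow_succ', Module.End.mul_apply, ← hu]
      exact ⟨D u, h.pairMap_swap_blockDiag x u⟩
  have pow_t : ∀ i, (D ^ ν i) (t i) = 0 := by
    intro i
    rw [← h.swap.mem_range_pairMap.1 (t_pow_mem i (ν i)), h.pairMap_eq_zero_iff]
    rintro ⟨j, a⟩
    change B ((x ^ (a : ℕ)) (ve j)) _ = 0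
    rw [← hpow, pow_selfAdjoint hD, ← Module.End.mul_apply, ← pow_add, ve_t, if_neg]
    rintro ⟨rfl, h2⟩
    omega
  -- The dual chains are independent by their pairing with the chains of $E$, and their number of
  -- vectors is at least the dimension of the span of `f`, so they fill it.
  have bT : IsChainBasis D s ν t (LinearMap.range (pairMap B e f)) := by
    have hle : chainSpan D t ≤ LinearMap.range (pairMap B e f) := chainSpan_le t_pow_mem
    have h1 : ∑ i ∈ Finset.range s, ν i = finrank ℂ (chainSpan D t) := by
      rw [chainSpan_eq_span_chainFamily bE.supp pow_t, ← card_sigma_fin]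
      exact linearIndependent_iff_card_eq_finrank_span.1 (linearIndependent_of_gram hD ve_t)
    have h2 : finrank ℂ (LinearMap.range (pairMap B e f)) ≤ ∑ i ∈ Finset.range s, ν i := by
      rw [h.swap.range_pairMap, ← card_sigma_fin]
      exact finrank_range_le_card f
    have h3 := Submodule.eq_of_le_of_finrank_le hle (by omega)
    exact ⟨bE.anti, bE.supp, pow_t, h3, by rw [h1, h3]⟩
  have w_mem : ∀ j a, midMap B e f ((D ^ a) (w j)) = (D ^ a) (w j) := fun j a =>
    h.mem_range_mid.1 (bW.pow_mem j a)
  have t_mem' : ∀ j a, pairMap B e f ((D ^ a) (t j)) = (D ^ a) (t j) := fun j a =>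
    h.swap.mem_range_pairMap.1 (t_pow_mem j a)
  have e_mem : ∀ j a, pairMap B f e ((D ^ a) (ve j)) = (D ^ a) (ve j) := fun j a =>
    h.mem_range_pairMap.1 (hr1.symm ▸ bE'.pow_mem j a)
  have w_mem0 : ∀ j, midMap B e f (w j) = w j := fun j => w_mem j 0
  have e_mem0 : ∀ j, pairMap B f e (ve j) = ve j := fun j => e_mem j 0
  have link : IsLinkData B D s ν μ ve w t :=
    { e_e := fun i j a => by
        rw [← e_mem0 i, h.adjoint, ← e_mem j a, h.swap.pairMap_pairMap_swap, map_zero]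
      e_w := fun i j a => by
        rw [← e_mem0 i, h.adjoint, ← w_mem j a, h.pairMap_swap_mid, map_zero]
      w_e := fun i j a => by
        rw [← w_mem0 i, h.adjoint_mid, ← e_mem j a, h.mid_pairMap, map_zero]
      w_t := fun i j a => by
        rw [← w_mem0 i, h.adjoint_mid, ← t_mem' j a, h.mid_pairMap_swap, map_zero]
      t_w := fun i j a => by
        rw [← t_mem i, h.swap.adjoint, ← w_mem j a, h.pairMap_mid, map_zero]
      t_t := fun i j a => by
        rw [← t_mem i, h.swap.adjoint, ← t_mem' j a, h.pairMap_pairMap_swap, map_zero]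
      w_w := bW.gram
      e_t := ve_t
      t_e := t_ve
      pow_t := pow_t
      pow_w := bW.pow_apply
      pow_e := bE'.pow_apply
      supp := bE.supp }
  set z₀ := linkMap B s μ ve w with hz₀
  have hz₀B : ∀ u w', B (z₀ u) w' = B u (z₀ w') := linkMap_selfAdjoint hB s μ ve w
  have ve_mem : ∀ i, ve i ∈ E := fun i => bE.pow_mem i 0
  have z₀kills : ∀ i, z₀ (e i) = 0 := by
    rintro ⟨j, a⟩
    change z₀ ((x ^ (a : ℕ)) (ve j)) = 0
    rw [← hpow]
    exact link.link_e j a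
  have z₀strict : IsStrictBlock B e f z₀ := by
    refine ⟨z₀kills, fun u hu => ?_, fun u i => ?_⟩
    · rw [heE, hz₀, linkMap_apply]
      refine sum_mem fun i _ => ?_
      have : B (ve i) u = 0 := by
        rw [← e_mem0 i, h.adjoint, h.pairMap_eq_zero_iff.2 hu, map_zero]
      rw [this, zero_smul, zero_smul, zero_add, ite_self, add_zero]
      exact E.smul_mem _ (ve_mem i)
    · rw [← hz₀B, z₀kills, map_zero, LinearMap.zero_apply]
  -- The element $z=z_0-(x-D)$ first removes the part of $x$ off the diagonal blocks, then adds the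
  -- links.
  have hy : x + (z₀ - (x - D)) = D + z₀ := by abel
  have hzs : IsStrictBlock B e f (z₀ - (x - D)) := by
    rw [sub_eq_add_neg]
    exact z₀strict.add hxD.neg
  have hyB : ∀ u w', B ((D + z₀) u) w' = B u ((D + z₀) w') := fun u w' => by
    simp only [LinearMap.add_apply, map_add, hD, hz₀B]
  -- With $m$ the number of nonempty chains in $E$, $\nu_{m-1}\ge1$ and $\nu_m=0$; since $\mu$
  -- decreases, $\mu+2\nu$ drops by at least $2$ after index $m-1$.
  obtain ⟨m, hms, hm⟩ := exists_pos_iff_lt bE.anti bE.supp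
  have hm0 : 0 < m := by
    by_contra hm0
    apply hE0
    have h1 : finrank ℂ E = 0 := by
      rw [← bE.card_eq]
      exact Finset.sum_eq_zero fun i _ => by
        have := hm i
        omega
    exact Submodule.finrank_eq_zero.1 h1
  refine ⟨z₀ - (x - D), max s sW, fun i => ν i + μ i + ν i,
    fun j => linkChain D ν μ ve w t j 0, fun u w' => ?_, fun u hu => ?_, fun u hu => ?_,
    fun u y hy' => ?_, ⟨k + k + k, ?_⟩, fun i hi => ?_, ⟨m - 1, ?_⟩, ?_, fun U j hU hj => ?_⟩
  · simp only [LinearMap.sub_apply, map_sub, hD, hz₀B, hx]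
  · rw [← heE] at hu
    have : Submodule.span ℂ (Set.range e) ≤ LinearMap.ker (z₀ - (x - D)) := by
      rw [Submodule.span_le]
      rintro _ ⟨i, rfl⟩
      exact hzs.kills i
    exact this hu
  · rw [← heE]
    exact hzs.maps u fun i => hu _ (heE' i)
  · rw [← heE, ← h.range_pairMap] at hy'
    rw [← h.mem_range_pairMap.1 hy', h.adjoint, h.pairMap_eq_zero_iff.2 (hzs.range u), map_zero]
  · rw [hy]
    refine IsStrictBlock.pow_eq_zero (x := x) h ?_ hDk
    rw [← hDdef, add_sub_cancel_left]
    exact z₀strict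
  · have h1 := bE.supp i (by omega)
    have h2 := bW.supp i (by omega)
    simp only [h1, h2]
  · have h1 := hm (m - 1)
    have h2 := hm (m - 1 + 1)
    have h3 := bW.anti (Nat.le_succ (m - 1))
    have h4 : μ (m - 1 + 1) ≤ μ (m - 1) := h3
    simp only
    omega
  · rw [hy]
    exact linearIndependent_of_gram hyB link.gram
  · exact hxD.finrank_le h (by rw [hr1]; exact bE') bW.toIsChainBasis bT hU hj

end Induction

open Matrix

/-! ### Partitions as eventually zero decreasing sequences. -/

section Partition

theorem sum_range_getD (l : List ℕ) : ∑ i ∈ Finset.range l.length, l.getD i 0 = l.sum := by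
  induction l with
  | nil => simp
  | cons a l ih =>
    rw [List.length_cons, Finset.sum_range_succ', List.sum_cons, ← ih, add_comm]
    simp

variable {N : ℕ} (lam : Nat.Partition N)

theorem part_eq_zero {i : ℕ} (hi : Multiset.card lam.parts ≤ i) : part lam i = 0 := by
  rw [part, List.getD_eq_default]
  rwa [Multiset.length_sort]

theorem part_pos {i : ℕ} (hi : i < Multiset.card lam.parts) : 0 < part lam i := by
  rw [part, List.getD_eq_getElem _ _ (by rwa [Multiset.length_sort])]
  apply lam.parts_pos
  rw [← Multiset.mem_sort (r := (· ≥ ·))]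
  exact List.getElem_mem _

theorem part_antitone : Antitone (part lam) := by
  refine antitone_nat_of_succ_le fun i => ?_
  by_cases hi : i + 1 < Multiset.card lam.parts
  · rw [part, part, List.getD_eq_getElem _ _ (by rwa [Multiset.length_sort]),
      List.getD_eq_getElem _ _ (by rw [Multiset.length_sort]; omega)]
    exact List.pairwise_iff_getElem.1 (Multiset.pairwise_sort lam.parts (· ≥ ·)) _ _ _ _
      (Nat.lt_succ_self i)
  · rw [part_eq_zero lam (by omega)]
    exact Nat.zero_le _

theorem sum_part : ∑ i ∈ Finset.range (Multiset.card lam.parts), part lam i = N := by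
  have h := sum_range_getD (lam.parts.sort (· ≥ ·))
  rw [Multiset.length_sort] at h
  refine h.trans ?_
  conv_rhs => rw [← lam.parts_sum, ← Multiset.sort_eq lam.parts (· ≥ ·)]
  rw [Multiset.sum_coe]

theorem hasGaps_iff : HasGaps lam ↔ ∃ i, part lam (i + 1) + 2 ≤ part lam i := by
  refine ⟨fun ⟨i, _, h⟩ => ⟨i, h⟩, fun ⟨i, h⟩ => ⟨i, ?_, h⟩⟩
  by_contra hi
  rw [part_eq_zero lam (i := i) (by omega)] at h
  omega

end Partition

/-! ### From matrices to endomorphisms with a bilinear form. -/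

section Translation

variable {N : ℕ} {X : Matrix (Fin N) (Fin N) ℂ} {lam : Nat.Partition N}

theorem hasJordanType_of_isChainBasis {s : ℕ} {v : ℕ → Fin N → ℂ}
    (h : IsChainBasis (toLin' X) s (part lam) v ⊤) : HasJordanType X lam := by
  have hli : LinearIndependent ℂ (chainFamily (toLin' X) (Multiset.card lam.parts) (part lam) v) := by
    rw [linearIndependent_iff_card_eq_finrank_span, card_sigma_fin, sum_part, Set.finrank,
      ← chainSpan_eq_span_chainFamily (fun i hi => part_eq_zero lam hi) h.pow_apply, h.span_eq,
      finrank_top, finrank_fin_fun]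
  have hsp : ⊤ ≤ Submodule.span ℂ
      (Set.range (chainFamily (toLin' X) (Multiset.card lam.parts) (part lam) v)) := by
    rw [← chainSpan_eq_span_chainFamily (fun i hi => part_eq_zero lam hi) h.pow_apply, h.span_eq]
  refine ⟨Basis.mk hli hsp, fun i a => ?_⟩
  have e1 : X *ᵥ (((toLin' X) ^ (a : ℕ)) (v i)) = ((toLin' X) ^ ((a : ℕ) + 1)) (v i) := by
    rw [pow_succ', Module.End.mul_apply, toLin'_apply]
  rw [Basis.mk_apply]
  split_ifs with ha
  · rw [Basis.mk_apply]
    exact e1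
  · refine e1.trans (pow_apply_eq_zero_of_le (h.pow_apply i) (by omega))

theorem HasJordanType.exists_isChainBasis (h : HasJordanType X lam) :
    ∃ v, IsChainBasis (toLin' X) (Multiset.card lam.parts) (part lam) v ⊤ := by
  obtain ⟨b, hb⟩ := h
  set v : ℕ → Fin N → ℂ := fun i =>
    if hi : i < Multiset.card lam.parts then b ⟨⟨i, hi⟩, ⟨0, part_pos lam hi⟩⟩ else 0 with hv
  have key : ∀ (i : Fin (Multiset.card lam.parts)) (a : ℕ) (ha : a < part lam i),
      ((toLin' X) ^ a) (v i) = b ⟨i, ⟨a, ha⟩⟩ := by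
    intro i a ha
    induction a with
    | zero => simp [hv]
    | succ a ih =>
      rw [pow_succ', Module.End.mul_apply, ih (by omega), toLin'_apply, hb, dif_pos ha]
  have hpow : ∀ i, ((toLin' X) ^ part lam i) (v i) = 0 := by
    intro i
    by_cases hi : i < Multiset.card lam.parts
    · obtain ⟨l, hl⟩ := Nat.exists_eq_succ_of_ne_zero (part_pos lam hi).ne'
      have h1 := key ⟨i, hi⟩ l (by simp only; omega)
      rw [hl, pow_succ', Module.End.mul_apply]
      simp only at h1
      rw [h1, toLin'_apply, hb, dif_neg]
      simp only
      omega
    · simp [hv, hi]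
  refine ⟨v, part_antitone lam, fun i hi => part_eq_zero lam hi, hpow, ?_, ?_⟩
  · rw [chainSpan_eq_span_chainFamily (fun i hi => part_eq_zero lam hi) hpow, ← b.span_eq]
    congr 2
    ext ⟨i, a⟩ : 1
    exact key i a a.2
  · rw [sum_part, finrank_top, finrank_fin_fun]

/-- The bilinear form with Gram matrix `J`. -/
noncomputable def form (J : GL (Fin N) ℂ) : LinearMap.BilinForm ℂ (Fin N → ℂ) :=
  toBilin' (J : Matrix (Fin N) (Fin N) ℂ)

variable {J : GL (Fin N) ℂ}

theorem form_apply (u w : Fin N → ℂ) :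
    form J u w = u ⬝ᵥ (J : Matrix (Fin N) (Fin N) ℂ) *ᵥ w := by
  rw [form, toBilin'_apply']

theorem form_symm (hJ : (J : Matrix (Fin N) (Fin N) ℂ).IsSymm) (u w : Fin N → ℂ) :
    form J u w = form J w u := by
  rw [form_apply, form_apply, dotProduct_mulVec, ← mulVec_transpose, hJ.eq, dotProduct_comm]

theorem form_mulVec_left (A : Matrix (Fin N) (Fin N) ℂ) (u w : Fin N → ℂ) :
    form J (A *ᵥ u) w = u ⬝ᵥ (Aᵀ * (J : Matrix (Fin N) (Fin N) ℂ)) *ᵥ w := by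
  rw [form_apply, ← vecMul_transpose, ← dotProduct_mulVec, mulVec_mulVec]

theorem form_mulVec_right (A : Matrix (Fin N) (Fin N) ℂ) (u w : Fin N → ℂ) :
    form J u (A *ᵥ w) = u ⬝ᵥ ((J : Matrix (Fin N) (Fin N) ℂ) * A) *ᵥ w := by
  rw [form_apply, mulVec_mulVec]

theorem eq_of_dotProduct_mulVec {A A' : Matrix (Fin N) (Fin N) ℂ}
    (h : ∀ u w : Fin N → ℂ, u ⬝ᵥ A *ᵥ w = u ⬝ᵥ A' *ᵥ w) : A = A' := by
  refine Matrix.ext_of_mulVec_single fun i => ?_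
  refine dotProduct_eq _ _ fun u => ?_
  rw [dotProduct_comm, h, dotProduct_comm]

theorem form_nondegenerate (hJ : (J : Matrix (Fin N) (Fin N) ℂ).IsSymm) (u : Fin N → ℂ)
    (h : ∀ w, form J u w = 0) : u = 0 := by
  have h1 : (J : Matrix (Fin N) (Fin N) ℂ) *ᵥ u = 0 := by
    refine dotProduct_eq _ _ fun w => ?_
    rw [dotProduct_comm, ← form_apply, form_symm hJ, h, zero_dotProduct]
  have h2 := congrArg (((J⁻¹ : GL (Fin N) ℂ) : Matrix (Fin N) (Fin N) ℂ) *ᵥ ·) h1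
  simpa [mulVec_mulVec] using h2

theorem form_surjective (hJ : (J : Matrix (Fin N) (Fin N) ℂ).IsSymm) :
    Function.Surjective (form J : (Fin N → ℂ) →ₗ[ℂ] Module.Dual ℂ (Fin N → ℂ)) :=
  surjective_of_nondegenerate (form_nondegenerate hJ)

theorem selfAdjoint_iff :
    dtheta J X = -X ↔ ∀ u w, form J (X *ᵥ u) w = form J u (X *ᵥ w) := by
  have h1 : dtheta J X = -X ↔
      Xᵀ * (J : Matrix (Fin N) (Fin N) ℂ) = (J : Matrix (Fin N) (Fin N) ℂ) * X := by
    rw [dtheta, neg_inj, mul_assoc]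
    constructor
    · intro h
      conv_rhs => rw [← h, ← mul_assoc (J : Matrix (Fin N) (Fin N) ℂ), Units.mul_inv, one_mul]
    · intro h
      rw [h, ← mul_assoc, Units.inv_mul, one_mul]
  rw [h1]
  constructor
  · intro h u w
    rw [form_mulVec_left, form_mulVec_right, h]
  · intro h
    refine eq_of_dotProduct_mulVec fun u w => ?_
    rw [← form_mulVec_left, ← form_mulVec_right, h]

theorem mem_g1_iff :
    X ∈ g1 J ↔ X.trace = 0 ∧ ∀ u w, form J (X *ᵥ u) w = form J u (X *ᵥ w) := by
  rw [← selfAdjoint_iff]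
  rfl

/-- Nilpotent matrices have trace zero, so the trace condition is automatic. -/
theorem mem_nilcone1_iff :
    X ∈ nilcone1 J ↔ (∀ u w, form J (X *ᵥ u) w = form J u (X *ᵥ w)) ∧ IsNilpotent X := by
  constructor
  · rintro ⟨h1, h2⟩
    exact ⟨(mem_g1_iff.1 h1).2, h2⟩
  · rintro ⟨h1, h2⟩
    exact ⟨mem_g1_iff.2 ⟨(Matrix.isNilpotent_trace_of_isNilpotent h2).eq_zero, h1⟩, h2⟩

theorem mem_SO_iff {g : Matrix.SpecialLinearGroup (Fin N) ℂ} :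
    g ∈ SO J ↔ ∀ u w, form J ((g : Matrix (Fin N) (Fin N) ℂ) *ᵥ u)
      ((g : Matrix (Fin N) (Fin N) ℂ) *ᵥ w) = form J u w := by
  have e : ∀ u w, form J ((g : Matrix (Fin N) (Fin N) ℂ) *ᵥ u)
      ((g : Matrix (Fin N) (Fin N) ℂ) *ᵥ w) = u ⬝ᵥ ((g : Matrix (Fin N) (Fin N) ℂ)ᵀ *
        (J : Matrix (Fin N) (Fin N) ℂ) * (g : Matrix (Fin N) (Fin N) ℂ)) *ᵥ w := by
    intro u w
    rw [form_mulVec_left, mulVec_mulVec]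
  constructor
  · intro h u w
    rw [e, form_apply]
    congr 2
  · intro h
    exact eq_of_dotProduct_mulVec fun u w => by rw [← e, h, form_apply]

theorem mul_inv_cancel_coe (g : Matrix.SpecialLinearGroup (Fin N) ℂ) :
    (g : Matrix (Fin N) (Fin N) ℂ) *
      ((g⁻¹ : Matrix.SpecialLinearGroup (Fin N) ℂ) : Matrix (Fin N) (Fin N) ℂ) = 1 := by
  rw [← Matrix.SpecialLinearGroup.coe_mul, mul_inv_cancel, Matrix.SpecialLinearGroup.coe_one]

theorem inv_mul_cancel_coe (g : Matrix.SpecialLinearGroup (Fin N) ℂ) :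
    ((g⁻¹ : Matrix.SpecialLinearGroup (Fin N) ℂ) : Matrix (Fin N) (Fin N) ℂ) *
      (g : Matrix (Fin N) (Fin N) ℂ) = 1 := by
  rw [← Matrix.SpecialLinearGroup.coe_mul, inv_mul_cancel, Matrix.SpecialLinearGroup.coe_one]

/-- `θ(g)` is the inverse adjoint of `g`. -/
theorem form_theta (g : Matrix.SpecialLinearGroup (Fin N) ℂ)
    (hJ : (J : Matrix (Fin N) (Fin N) ℂ).IsSymm) (u w : Fin N → ℂ) :
    form J ((theta J g : Matrix (Fin N) (Fin N) ℂ) *ᵥ u) ((g : Matrix (Fin N) (Fin N) ℂ) *ᵥ w) =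
      form J u w := by
  have hinv : ((J⁻¹ : GL (Fin N) ℂ) : Matrix (Fin N) (Fin N) ℂ)ᵀ *
      (J : Matrix (Fin N) (Fin N) ℂ) = 1 := by
    conv_lhs => rw [← hJ.eq, ← transpose_mul, Units.mul_inv, transpose_one]
  rw [form_mulVec_left, mulVec_mulVec, form_apply]
  congr 2
  change (((J⁻¹ : GL (Fin N) ℂ) : Matrix (Fin N) (Fin N) ℂ) *
    ((g⁻¹ : Matrix.SpecialLinearGroup (Fin N) ℂ) : Matrix (Fin N) (Fin N) ℂ)ᵀ *
    (J : Matrix (Fin N) (Fin N) ℂ))ᵀ * _ * _ = _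
  rw [transpose_mul, transpose_mul, transpose_transpose, hJ.eq, mul_assoc, mul_assoc, mul_assoc,
    ← mul_assoc _ (J : Matrix (Fin N) (Fin N) ℂ), hinv, one_mul, inv_mul_cancel_coe, mul_one]

theorem theta_eq_iff (hJ : (J : Matrix (Fin N) (Fin N) ℂ).IsSymm)
    {g : Matrix.SpecialLinearGroup (Fin N) ℂ} : theta J g = g ↔ g ∈ SO J := by
  rw [mem_SO_iff]
  constructor
  · intro h u w
    have := form_theta g hJ u w
    rwa [h] at this
  · intro h
    apply Subtype.ext
    refine eq_of_dotProduct_mulVec fun u w => ?_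
    congr 1
    rw [← sub_eq_zero]
    refine form_nondegenerate hJ _ fun y => ?_
    obtain ⟨y', rfl⟩ : ∃ y', y = (g : Matrix (Fin N) (Fin N) ℂ) *ᵥ y' :=
      ⟨((g⁻¹ : Matrix.SpecialLinearGroup (Fin N) ℂ) : Matrix (Fin N) (Fin N) ℂ) *ᵥ y, by
        rw [mulVec_mulVec, mul_inv_cancel_coe, one_mulVec]⟩
    rw [map_sub, LinearMap.sub_apply, form_theta g hJ, h, sub_self]

theorem mem_fixedSubgroup_iff (hJ : (J : Matrix (Fin N) (Fin N) ℂ).IsSymm)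
    {H : Subgroup (Matrix.SpecialLinearGroup (Fin N) ℂ)}
    {g : Matrix.SpecialLinearGroup (Fin N) ℂ} :
    g ∈ fixedSubgroup J H ↔ g ∈ H ∧ g ∈ SO J := by
  rw [← theta_eq_iff hJ]
  rfl

/-- Conjugation by `g`. -/
def conj (g : Matrix.SpecialLinearGroup (Fin N) ℂ) (X : Matrix (Fin N) (Fin N) ℂ) :
    Matrix (Fin N) (Fin N) ℂ :=
  (g : Matrix (Fin N) (Fin N) ℂ) * X *
    ((g⁻¹ : Matrix.SpecialLinearGroup (Fin N) ℂ) : Matrix (Fin N) (Fin N) ℂ)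

theorem conj_mulVec (g : Matrix.SpecialLinearGroup (Fin N) ℂ) (X : Matrix (Fin N) (Fin N) ℂ)
    (u : Fin N → ℂ) :
    conj g X *ᵥ ((g : Matrix (Fin N) (Fin N) ℂ) *ᵥ u) =
      (g : Matrix (Fin N) (Fin N) ℂ) *ᵥ (X *ᵥ u) := by
  rw [conj, mulVec_mulVec, mul_assoc, mul_assoc, inv_mul_cancel_coe, mul_one, mulVec_mulVec]

theorem conj_pow (g : Matrix.SpecialLinearGroup (Fin N) ℂ) (X : Matrix (Fin N) (Fin N) ℂ)
    (k : ℕ) : conj g X ^ k = conj g (X ^ k) := by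
  induction k with
  | zero => rw [pow_zero, pow_zero, conj, mul_one, mul_inv_cancel_coe]
  | succ k ih =>
    rw [pow_succ, ih, pow_succ]
    simp only [conj, mul_assoc]
    rw [← mul_assoc _ (g : Matrix (Fin N) (Fin N) ℂ), inv_mul_cancel_coe, one_mul]

theorem conj_mem_nilcone1 {g : Matrix.SpecialLinearGroup (Fin N) ℂ} (hg : g ∈ SO J)
    (hX : X ∈ nilcone1 J) : conj g X ∈ nilcone1 J := by
  rw [mem_nilcone1_iff] at *
  refine ⟨fun u w => ?_, ?_⟩
  · have e : ∀ y : Fin N → ℂ, ∃ y', y = (g : Matrix (Fin N) (Fin N) ℂ) *ᵥ y' := fun y =>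
      ⟨((g⁻¹ : Matrix.SpecialLinearGroup (Fin N) ℂ) : Matrix (Fin N) (Fin N) ℂ) *ᵥ y, by
        rw [mulVec_mulVec, mul_inv_cancel_coe, one_mulVec]⟩
    obtain ⟨u, rfl⟩ := e u
    obtain ⟨w, rfl⟩ := e w
    rw [conj_mulVec, conj_mulVec, mem_SO_iff.1 hg, mem_SO_iff.1 hg, hX.1]
  · obtain ⟨k, hk⟩ := hX.2
    exact ⟨k, by rw [conj_pow, hk]; simp [conj]⟩

theorem HasJordanType.conj (g : Matrix.SpecialLinearGroup (Fin N) ℂ) (h : HasJordanType X lam) :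
    HasJordanType (conj g X) lam := by
  obtain ⟨b, hb⟩ := h
  refine ⟨b.map (Matrix.SpecialLinearGroup.toLin' g), fun i a => ?_⟩
  simp only [Basis.map_apply, Matrix.SpecialLinearGroup.toLin'_apply, toLin'_apply, conj_mulVec, hb]
  split_ifs
  · rfl
  · rw [mulVec_zero]

theorem conj_mem_orbit {g : Matrix.SpecialLinearGroup (Fin N) ℂ} (hg : g ∈ SO J)
    (hX : X ∈ orbit J lam) : conj g X ∈ orbit J lam :=
  ⟨conj_mem_nilcone1 hg hX.1, hX.2.conj g⟩

theorem exists_isNormalBasis_of_mem_orbit (hJ : (J : Matrix (Fin N) (Fin N) ℂ).IsSymm)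
    (hX : X ∈ orbit J lam) :
    ∃ s v, IsNormalBasis (form J) (toLin' X) s (part lam) v ⊤ := by
  obtain ⟨hX1, hX2⟩ := hX
  rw [mem_nilcone1_iff] at hX1
  obtain ⟨v', hv'⟩ := hX2.exists_isChainBasis
  obtain ⟨k, hk⟩ := hX1.2
  obtain ⟨s, p, v, h⟩ := exists_isNormalBasis (B := form J) (f := toLin' X) (M := ⊤)
    (form_symm hJ) (fun u w => by simpa using hX1.1 u w) (fun _ _ => trivial)
    ⟨k, fun u _ => by rw [← toLin'_pow, hk]; simp⟩
    (fun u _ hu => form_nondegenerate hJ u fun w => hu w trivial)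
  have : p = part lam := h.toIsChainBasis.unique hv'
  subst this
  exact ⟨s, v, h⟩

end Translation

/-! ### Each $\mathcal O_\lambda$ is a single nonempty $K$-orbit. -/

section SingleOrbit

variable {V : Type*} [AddCommGroup V] [Module ℂ V]

theorem linearIndependent_of_dual {ι : Type*} [Fintype ι] [DecidableEq ι]
    {B : LinearMap.BilinForm ℂ V} {b b' : ι → V}
    (h : ∀ i j, B (b' i) (b j) = if i = j then 1 else 0) : LinearIndependent ℂ b := by
  rw [Fintype.linearIndependent_iff]
  intro g hg i
  have h1 : B (b' i) (∑ j, g j • b j) = 0 := by rw [hg, map_zero]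
  simpa [map_sum, h] using h1

variable [FiniteDimensional ℂ V]

/-- This is the normal form of the zero endomorphism, all of whose nonempty chains have length $1$.
-/
theorem exists_orthonormal {B : LinearMap.BilinForm ℂ V} (hB : ∀ x y, B x y = B y x)
    (hnd : ∀ x, (∀ y, B x y = 0) → x = 0) {ι : Type*} [Fintype ι] [DecidableEq ι]
    (hι : Fintype.card ι = finrank ℂ V) :
    ∃ o : ι → V, ∀ i j, B (o i) (o j) = if i = j then 1 else 0 := by
  obtain ⟨s, p, v, h⟩ := exists_isNormalBasis (B := B) (f := 0) (M := ⊤) hB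
    (fun x y => by simp) (fun x _ => trivial) ⟨1, fun x _ => by simp⟩
    (fun x _ hx => hnd x fun y => hx y trivial)
  obtain ⟨m, hms, hm⟩ := exists_pos_iff_lt h.anti h.supp
  have hp : ∀ i, p i = if i < m then 1 else 0 := by
    intro i
    have h1 := h.le_of_pow_eq_zero (k := 1) (fun x _ => by simp) i
    have h2 := hm i
    split_ifs with hi
    · have := h2.2 hi
      omega
    · omega
  have hcard : Fintype.card ι = m := by
    rw [hι, ← finrank_top ℂ V, ← h.card_eq, Finset.sum_congr rfl fun i _ => hp i,
      ← Finset.card_filter]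
    refine Eq.trans ?_ ((card_filter_pos hm s).trans (min_eq_right hms))
    simp only [hm]
  let ε : ι ≃ Fin m := Fintype.equivFinOfCardEq hcard
  refine ⟨fun i => v (ε i), fun i j => ?_⟩
  have h1 := h.gram (ε i) (ε j) 0
  rw [pow_zero, Module.End.one_apply, hp, if_pos (ε i).2] at h1
  rw [h1]
  congr 1
  simp [← Fin.ext_iff]

/-- A basis in normal form, for a given list of chain lengths. -/
theorem exists_gram_basis {B : LinearMap.BilinForm ℂ V} (hB : ∀ x y, B x y = B y x)
    (hnd : ∀ x, (∀ y, B x y = 0) → x = 0) {s : ℕ} {p : ℕ → ℕ}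
    (hp : ∑ i ∈ Finset.range s, p i = finrank ℂ V) :
    ∃ b : Basis (Σ i : Fin s, Fin (p i)) ℂ V, ∀ (i j : Fin s) (a : Fin (p i)) (c : Fin (p j)),
      B (b ⟨i, a⟩) (b ⟨j, c⟩) = if i = j ∧ (a : ℕ) + c + 1 = p i then 1 else 0 := by
  have hcard : Fintype.card (Σ i : Fin s, Fin (p i)) = finrank ℂ V := by rw [card_sigma_fin, hp]
  obtain ⟨o, ho⟩ := exists_orthonormal hB hnd hcard
  let r : (Σ i : Fin s, Fin (p i)) → (Σ i : Fin s, Fin (p i)) := fun q => ⟨q.1, Fin.rev q.2⟩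
  have hr : ∀ q, r (r q) = q := fun q => by simp [r]
  have hrinj : ∀ q q', r q = q' ↔ q = r q' := fun q q' =>
    ⟨fun h => by rw [← h, hr], fun h => by rw [h, hr]⟩
  -- With $\alpha=(1+i)/2$ and $\beta=(1-i)/2$ one has $\alpha^2+\beta^2=0$ and $2\alpha\beta=1$, so
  -- each pair exchanged by `r` becomes hyperbolic. A fixed point keeps norm $(\alpha+\beta)^2=1$.
  let b₀ : (Σ i : Fin s, Fin (p i)) → V := fun q =>
    ((1 + Complex.I) / 2) • o q + ((1 - Complex.I) / 2) • o (r q)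
  have hI := Complex.I_sq
  have hb₀ : ∀ q q', B (b₀ q) (b₀ q') = if q = r q' then 1 else 0 := by
    intro q q'
    simp only [b₀, map_add, map_smul, LinearMap.add_apply, LinearMap.smul_apply, smul_eq_mul, ho,
      hrinj q, hr]
    split_ifs <;> first
      | ring1
      | linear_combination (1 / 2) * hI
      | linear_combination (-1 / 2) * hI
  have hli : LinearIndependent ℂ b₀ := linearIndependent_of_dual (B := B) (b' := fun q => b₀ (r q))
    fun q q' => by simp only [hb₀, hrinj, hr]
  refine ⟨basisOfLinearIndependentOfCardEqFinrank' _ hli hcard, fun i j a c => ?_⟩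
  rw [coe_basisOfLinearIndependentOfCardEqFinrank', hb₀]
  congr 1
  rw [eq_iff_iff]
  simp only [r, Sigma.mk.injEq]
  constructor
  · rintro ⟨rfl, h⟩
    refine ⟨rfl, ?_⟩
    rw [heq_eq_eq] at h
    rw [h, Fin.val_rev]
    omega
  · rintro ⟨rfl, h⟩
    refine ⟨rfl, ?_⟩
    rw [heq_eq_eq, Fin.ext_iff, Fin.val_rev]
    omega

omit [FiniteDimensional ℂ V] in
/-- Two self-adjoint endomorphisms with normal bases of the same type are related by an isometry. -/
theorem IsNormalBasis.exists_isometry {B : LinearMap.BilinForm ℂ V} {f f' : End ℂ V}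
    (hf : ∀ x y, B (f x) y = B x (f y)) (hf' : ∀ x y, B (f' x) y = B x (f' y)) {s s' : ℕ}
    {p : ℕ → ℕ} {v v' : ℕ → V} (h : IsNormalBasis B f s p v ⊤) (h' : IsNormalBasis B f' s' p v' ⊤) :
    ∃ T : End ℂ V, (∀ x y, B (T x) (T y) = B x y) ∧ ∀ x, T (f x) = f' (T x) := by
  have hsp : ⊤ ≤ Submodule.span ℂ (Set.range (chainFamily f s p v)) := by
    rw [← chainSpan_eq_span_chainFamily h.supp h.pow_apply, h.span_eq]
  let b := Basis.mk h.linearIndependent hsp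
  let T : End ℂ V := b.constr ℂ (chainFamily f' s p v')
  have hT : ∀ i a, T ((f ^ a) (v i)) = (f' ^ a) (v' i) := by
    intro i a
    by_cases ha : a < p i
    · have hi : i < s := by
        by_contra hi
        rw [h.supp i (by omega)] at ha
        omega
      have e1 : (f ^ a) (v i) = b ⟨⟨i, hi⟩, ⟨a, ha⟩⟩ := by
        rw [Basis.mk_apply]
        rfl
      rw [e1, Basis.constr_basis]
      rfl
    · rw [pow_apply_eq_zero_of_le (h.pow_apply i) (by omega),
        pow_apply_eq_zero_of_le (h'.pow_apply i) (by omega), map_zero]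
  have hind : ∀ P : V → Prop, (∀ i a, P ((f ^ a) (v i))) → P 0 → (∀ x y, P x → P y → P (x + y)) →
      (∀ (c : ℂ) x, P x → P (c • x)) → ∀ x, P x := by
    intro P h1 h0 h2 h3 x
    have hx : x ∈ chainSpan f v := by
      rw [h.span_eq]
      trivial
    refine Submodule.span_induction ?_ h0 (fun x y _ _ => h2 x y) (fun c x _ => h3 c x) hx
    rintro _ ⟨q, rfl⟩
    exact h1 _ _
  refine ⟨T, fun x y => ?_, fun x => ?_⟩
  · refine hind (fun x => B (T x) (T y) = B x y) (fun i a => ?_) (by simp)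
      (fun x x' hx hx' => by simp [hx, hx']) (fun c x hx => by simp [hx]) x
    refine hind (fun y => B (T ((f ^ a) (v i))) (T y) = B ((f ^ a) (v i)) y) (fun j c => ?_)
      (by simp) (fun x x' hx hx' => by rw [map_add, map_add, map_add, hx, hx'])
      (fun c x hx => by rw [map_smul, map_smul, map_smul, hx]) y
    rw [hT, hT, pow_selfAdjoint hf', pow_selfAdjoint hf, ← Module.End.mul_apply,
      ← Module.End.mul_apply, ← pow_add, ← pow_add, h.gram, h'.gram]
  · refine hind (fun x => T (f x) = f' (T x)) (fun i a => ?_) (by simp)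
      (fun x x' hx hx' => by simp [hx, hx']) (fun c x hx => by simp [hx]) x
    rw [hT, ← Module.End.mul_apply f, ← pow_succ', hT, pow_succ', Module.End.mul_apply]

variable {n : ℕ} {J : GL (Fin (2 * n + 1)) ℂ}

/-- The shift along chains with antidiagonal Gram matrix is self-adjoint: moving either argument by
one step gives $1$ exactly when the chains agree and $a+c+2=\lambda_i$. -/
theorem orbit_nonempty (hJ : (J : Matrix (Fin (2 * n + 1)) (Fin (2 * n + 1)) ℂ).IsSymm)
    (lam : Nat.Partition (2 * n + 1)) : (orbit J lam).Nonempty := by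
  obtain ⟨b, hb⟩ := exists_gram_basis (form_symm hJ) (form_nondegenerate hJ)
    (s := Multiset.card lam.parts) (p := part lam) (by rw [sum_part, finrank_fin_fun])
  let f : End ℂ (Fin (2 * n + 1) → ℂ) := b.constr ℂ fun q =>
    if h : (q.2 : ℕ) + 1 < part lam q.1 then b ⟨q.1, ⟨(q.2 : ℕ) + 1, h⟩⟩ else 0
  have hf : ∀ q, f (b q) =
      if h : (q.2 : ℕ) + 1 < part lam q.1 then b ⟨q.1, ⟨(q.2 : ℕ) + 1, h⟩⟩ else 0 :=
    fun q => b.constr_basis ℂ _ q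
  have hjt : HasJordanType (LinearMap.toMatrix' f) lam := by
    refine ⟨b, fun i a => ?_⟩
    rw [← toLin'_apply, toLin'_toMatrix', hf]
  have hself : ∀ u w, form J (f u) w = form J u (f w) := by
    have : (form J).compLeft f = (form J).compRight f := by
      refine LinearMap.BilinForm.ext_basis b ?_
      rintro ⟨i, a⟩ ⟨j, c⟩
      rw [LinearMap.BilinForm.compLeft_apply, LinearMap.BilinForm.compRight_apply, hf, hf]
      have e1 : form J (if h : (a : ℕ) + 1 < part lam i then b ⟨i, ⟨(a : ℕ) + 1, h⟩⟩ else 0)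
          (b ⟨j, c⟩) = if i = j ∧ (a : ℕ) + c + 2 = part lam i then 1 else 0 := by
        split_ifs with h1 h2 h2
        · rw [hb, if_pos ⟨h2.1, by simp only; omega⟩]
        · rw [hb, if_neg]
          rintro ⟨h3, h4⟩
          exact h2 ⟨h3, by simp only at h4; omega⟩
        · omega
        · simp
      have e2 : form J (b ⟨i, a⟩)
          (if h : (c : ℕ) + 1 < part lam j then b ⟨j, ⟨(c : ℕ) + 1, h⟩⟩ else 0) =
            if i = j ∧ (a : ℕ) + c + 2 = part lam i then 1 else 0 := by
        split_ifs with h1 h2 h2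
        · rw [hb, if_pos ⟨h2.1, by simp only; omega⟩]
        · rw [hb, if_neg]
          rintro ⟨h3, h4⟩
          exact h2 ⟨h3, by simp only at h4; omega⟩
        · obtain ⟨rfl, h2⟩ := h2
          omega
        · simp
      exact e1.trans e2.symm
    intro u w
    exact LinearMap.congr_fun₂ this u w
  refine ⟨LinearMap.toMatrix' f, mem_nilcone1_iff.2 ⟨fun u w => ?_, ?_⟩, hjt⟩
  · rw [← toLin'_apply, ← toLin'_apply, toLin'_toMatrix', hself]
  · obtain ⟨v, hv⟩ := hjt.exists_isChainBasis
    rw [← Matrix.isNilpotent_toLin'_iff]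
    exact ⟨_, LinearMap.ext fun x => hv.pow_eq_zero trivial⟩

theorem exists_conj_of_mem_orbit
    (hJ : (J : Matrix (Fin (2 * n + 1)) (Fin (2 * n + 1)) ℂ).IsSymm)
    {lam : Nat.Partition (2 * n + 1)} {X Y : Matrix (Fin (2 * n + 1)) (Fin (2 * n + 1)) ℂ}
    (hX : X ∈ orbit J lam) (hY : Y ∈ orbit J lam) : ∃ g ∈ SO J, Y = conj g X := by
  obtain ⟨s, v, h⟩ := exists_isNormalBasis_of_mem_orbit hJ hX
  obtain ⟨s', v', h'⟩ := exists_isNormalBasis_of_mem_orbit hJ hY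
  obtain ⟨T, hT1, hT2⟩ := h.exists_isometry
    (fun u w => by simpa using (mem_nilcone1_iff.1 hX.1).1 u w)
    (fun u w => by simpa using (mem_nilcone1_iff.1 hY.1).1 u w) h'
  set A := LinearMap.toMatrix' T with hA
  have hAT : ∀ u, A *ᵥ u = T u := fun u => by rw [← toLin'_apply, hA, toLin'_toMatrix']
  have hAX : A * X = Y * A := Matrix.ext_of_mulVec_single fun i => by
    have := hT2 (Pi.single i 1)
    rw [toLin'_apply, toLin'_apply, ← hAT, ← hAT] at this
    rw [← mulVec_mulVec, this, mulVec_mulVec]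
  have hAJ : Aᵀ * (J : Matrix (Fin (2 * n + 1)) (Fin (2 * n + 1)) ℂ) * A =
      (J : Matrix (Fin (2 * n + 1)) (Fin (2 * n + 1)) ℂ) := eq_of_dotProduct_mulVec fun u w => by
    rw [← mulVec_mulVec, ← form_mulVec_left, hAT, hAT, hT1, form_apply]
  have hdet : A.det ^ 2 = 1 := by
    have h1 := congrArg Matrix.det hAJ
    rw [det_mul, det_mul, det_transpose] at h1
    have h2 : (J : Matrix (Fin (2 * n + 1)) (Fin (2 * n + 1)) ℂ).det ≠ 0 :=
      ((Matrix.isUnit_iff_isUnit_det _).1 J.isUnit).ne_zero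
    exact mul_right_cancel₀ h2 (by linear_combination h1)
  have main : ∀ A' : Matrix (Fin (2 * n + 1)) (Fin (2 * n + 1)) ℂ, A' * X = Y * A' →
      A'ᵀ * (J : Matrix (Fin (2 * n + 1)) (Fin (2 * n + 1)) ℂ) * A' =
        (J : Matrix (Fin (2 * n + 1)) (Fin (2 * n + 1)) ℂ) → A'.det = 1 → ∃ g ∈ SO J, Y = conj g X := by
    intro A' h1 h2 h3
    refine ⟨⟨A', h3⟩, h2, ?_⟩
    have := mul_inv_cancel_coe (⟨A', h3⟩ : Matrix.SpecialLinearGroup (Fin (2 * n + 1)) ℂ)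
    change Y = A' * X * _
    rw [h1, mul_assoc]
    change _ = Y * ((⟨A', h3⟩ : Matrix.SpecialLinearGroup (Fin (2 * n + 1)) ℂ) *
      ((⟨A', h3⟩ : Matrix.SpecialLinearGroup (Fin (2 * n + 1)) ℂ)⁻¹ :
        Matrix.SpecialLinearGroup (Fin (2 * n + 1)) ℂ).1)
    rw [this, mul_one]
  rcases mul_self_eq_one_iff.1 ((sq A.det).symm.trans hdet) with h1 | h1
  · exact main A hAX hAJ h1
  -- In odd dimension $\det(-A)=-\det A$; the sign changes neither the intertwining relation nor the
  -- isometry condition.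
  · refine main (-A) (by rw [neg_mul, mul_neg, hAX]) ?_ ?_
    · rw [transpose_neg, neg_mul, neg_mul, mul_neg, neg_neg, hAJ]
    · rw [det_neg, h1, Fintype.card_fin, pow_succ, pow_mul]
      norm_num

theorem isNilpotentOrbit_orbit
    (hJ : (J : Matrix (Fin (2 * n + 1)) (Fin (2 * n + 1)) ℂ).IsSymm)
    (lam : Nat.Partition (2 * n + 1)) : IsNilpotentOrbit J (orbit J lam) := by
  obtain ⟨X, hX⟩ := orbit_nonempty hJ lam
  refine ⟨X, hX.1, ?_⟩
  ext Y
  constructor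
  · exact fun hY => exists_conj_of_mem_orbit hJ hX hY
  · rintro ⟨g, hg, rfl⟩
    exact conj_mem_orbit hg hX

end SingleOrbit

/-! ### Flags, their stabilizers, and orthogonal complements. -/

section Flags

variable {N : ℕ}

theorem mem_stabilizer_iff {ι : Type} {S : ι → Submodule ℂ (Fin N → ℂ)}
    {g : Matrix.SpecialLinearGroup (Fin N) ℂ} :
    g ∈ stabilizer S ↔ ∀ i, ∀ u ∈ S i, (g : Matrix (Fin N) (Fin N) ℂ) *ᵥ u ∈ S i := by
  constructor
  · intro h i u hu
    rw [← h i]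
    exact ⟨u, hu, rfl⟩
  · intro h i
    refine Submodule.eq_of_le_of_finrank_eq ?_ ?_
    · rintro _ ⟨u, hu, rfl⟩
      exact h i u hu
    · have : (g : Matrix (Fin N) (Fin N) ℂ).mulVecLin =
          (Matrix.SpecialLinearGroup.toLin' g : (Fin N → ℂ) →ₗ[ℂ] (Fin N → ℂ)) := rfl
      rw [this]
      exact LinearEquiv.finrank_map_eq _ _

/-- The transvection `1 + w ⊗ φ`. -/
theorem exists_transvection {w : Fin N → ℂ} {φ : Module.Dual ℂ (Fin N → ℂ)} (h : φ w = 0) :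
    ∃ g : Matrix.SpecialLinearGroup (Fin N) ℂ,
      ∀ u, (g : Matrix (Fin N) (Fin N) ℂ) *ᵥ u = u + φ u • w := by
  refine ⟨⟨LinearMap.toMatrix' (LinearEquiv.transvection h : (Fin N → ℂ) →ₗ[ℂ] (Fin N → ℂ)), ?_⟩,
    fun u => ?_⟩
  · rw [LinearMap.det_toMatrix', ← LinearEquiv.coe_det, LinearEquiv.transvection.det_eq_one]
    rfl
  · rw [← toLin'_apply]
    simp only [toLin'_toMatrix']
    simp [LinearMap.transvection.apply]

/-- The spaces of a flag are the only subspaces that its parabolic subgroup stabilizes. -/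
theorem PartialFlag.exists_eq_space (F : PartialFlag N) {M : Submodule ℂ (Fin N → ℂ)}
    (hM : ∀ g ∈ F.parabolic, ∀ u ∈ M, (g : Matrix (Fin N) (Fin N) ℂ) *ᵥ u ∈ M) :
    ∃ k, M = F.space k := by
  by_contra! hne
  -- If $M$ is no space of the flag, then containing $V^i$ forces it to contain $V^{i+1}$, hence
  -- everything, which is itself a space of the flag.
  have key : ∀ k, F.space k ≤ M := by
    intro k
    induction k using Fin.induction with
    | zero => rw [F.space_zero]; exact bot_le
    | succ i ih =>
      obtain ⟨u, huM, hu⟩ : ∃ u ∈ M, u ∉ F.space i.castSucc := by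
        by_contra! hle
        exact hne _ (le_antisymm hle ih)
      intro w hw
      by_cases huw : u ∈ F.space i.castSucc ⊔ Submodule.span ℂ {w}
      · rw [Submodule.mem_sup] at huw
        obtain ⟨y, hy, y', hy', rfl⟩ := huw
        obtain ⟨c, rfl⟩ := Submodule.mem_span_singleton.1 hy'
        have hc : c ≠ 0 := by
          rintro rfl
          exact hu (by simpa using hy)
        have h1 : c • w ∈ M := by simpa using sub_mem huM (ih hy)
        exact (Submodule.smul_mem_iff _ hc).1 h1
      -- With $\varphi$ zero on $V^i$ and on $w\in V^{i+1}$, the transvection $u\mapsto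
      -- u+\varphi(u)w$ lies in $P$: it fixes $V^i$ pointwise and changes vectors only by multiples
      -- of $w$. Applied to $u\in M$ with $\varphi(u)\ne0$, it yields $w\in M$.
      · obtain ⟨φ, hφ, hφ'⟩ := Submodule.exists_dual_map_eq_bot_of_notMem huw inferInstance
        have hker : ∀ y ∈ F.space i.castSucc ⊔ Submodule.span ℂ {w}, φ y = 0 := fun y hy => by
          have : φ y ∈ Submodule.map φ (F.space i.castSucc ⊔ Submodule.span ℂ {w}) := ⟨y, hy, rfl⟩
          rw [hφ'] at this
          simpa using this
        obtain ⟨g, hg⟩ := exists_transvection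
          (hker w (Submodule.mem_sup_right (Submodule.mem_span_singleton_self w)))
        have hgP : g ∈ F.parabolic := by
          refine mem_stabilizer_iff.2 fun r y hy => ?_
          rw [hg]
          rcases le_or_gt r i.castSucc with hr | hr
          · rw [hker y (Submodule.mem_sup_left (F.strictMono.monotone hr hy)), zero_smul, add_zero]
            exact hy
          · have hr' : i.succ ≤ r := Fin.castSucc_lt_iff_succ_le.1 hr
            exact add_mem hy (Submodule.smul_mem _ _ (F.strictMono.monotone hr' hw))
        have h1 := sub_mem (hM g hgP u huM) huM
        rw [hg, add_sub_cancel_left] at h1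
        exact (Submodule.smul_mem_iff _ hφ).1 h1
  refine hne (Fin.last _) (le_antisymm ?_ (key _))
  rw [F.space_last]
  exact le_top

variable {J : GL (Fin N) ℂ}

/-- The orthogonal complement of a subspace. -/
def perp (J : GL (Fin N) ℂ) (M : Submodule ℂ (Fin N → ℂ)) : Submodule ℂ (Fin N → ℂ) where
  carrier := {w | ∀ u ∈ M, form J u w = 0}
  add_mem' ha hb u hu := by rw [map_add, ha u hu, hb u hu, add_zero]
  zero_mem' u _ := map_zero _
  smul_mem' c x hx u hu := by rw [map_smul, hx u hu, smul_zero]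

theorem exists_mem_perp_ne_zero (hJ : (J : Matrix (Fin N) (Fin N) ℂ).IsSymm)
    {M : Submodule ℂ (Fin N → ℂ)} (hM : M ≠ ⊤) : ∃ w ∈ perp J M, w ≠ 0 := by
  obtain ⟨φ, hφ, hφ'⟩ := Submodule.exists_dual_map_eq_bot_of_lt_top hM.lt_top inferInstance
  obtain ⟨w, hw⟩ := form_surjective hJ φ
  refine ⟨w, fun u hu => ?_, ?_⟩
  · rw [form_symm hJ, hw]
    have : φ u ∈ Submodule.map φ M := ⟨u, hu, rfl⟩
    rw [hφ'] at this
    simpa using this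
  · rintro rfl
    exact hφ (by rw [← hw, map_zero])

/-- As the inverse adjoint of $g$, $\theta(g)$ preserves the complement of any space that $g$
preserves. This is how $\theta$-stability becomes self-duality of flags and splittings. -/
theorem theta_mulVec_mem_perp (hJ : (J : Matrix (Fin N) (Fin N) ℂ).IsSymm)
    {M : Submodule ℂ (Fin N → ℂ)} {g : Matrix.SpecialLinearGroup (Fin N) ℂ}
    (hg : M.map (g : Matrix (Fin N) (Fin N) ℂ).mulVecLin = M) {w : Fin N → ℂ} (hw : w ∈ perp J M) :
    (theta J g : Matrix (Fin N) (Fin N) ℂ) *ᵥ w ∈ perp J M := by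
  intro u hu
  rw [← hg] at hu
  obtain ⟨u, hu, rfl⟩ := hu
  rw [form_symm hJ, mulVecLin_apply, form_theta g hJ, form_symm hJ]
  exact hw u hu

theorem mulVec_mem_space {F : PartialFlag N} {W : F.Splitting} {X : Matrix (Fin N) (Fin N) ℂ}
    (hX : ∀ i : Fin F.length, ∀ v ∈ W.compl i, X *ᵥ v ∈ W.compl i) (k : Fin (F.length + 1))
    {u : Fin N → ℂ} (hu : u ∈ F.space k) : X *ᵥ u ∈ F.space k := by
  induction k using Fin.induction generalizing u with
  | zero =>
    rw [F.space_zero, Submodule.mem_bot] at *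
    rw [hu, mulVec_zero]
  | succ i ih =>
    rw [← W.sup_eq i] at *
    obtain ⟨y, hy, y', hy', rfl⟩ := Submodule.mem_sup.1 hu
    rw [mulVec_add]
    exact add_mem (Submodule.mem_sup_left (ih hy)) (Submodule.mem_sup_right (hX i y' hy'))

theorem isOpen_linearIndependent_chainFamily (s : ℕ) (p : ℕ → ℕ) (v : ℕ → Fin N → ℂ) :
    IsOpen {Y : Matrix (Fin N) (Fin N) ℂ | LinearIndependent ℂ (chainFamily (toLin' Y) s p v)} := by
  have hc : Continuous fun Y : Matrix (Fin N) (Fin N) ℂ => chainFamily (toLin' Y) s p v := by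
    refine continuous_pi fun q => ?_
    have e : ∀ Y : Matrix (Fin N) (Fin N) ℂ, chainFamily (toLin' Y) s p v q =
        (Y ^ (q.2 : ℕ)) *ᵥ (v q.1) := fun Y => by
      rw [chainFamily, ← toLin'_pow, toLin'_apply]
    simp only [e]
    exact (continuous_id.pow _).matrix_mulVec continuous_const
  exact isOpen_setOfPred_linearIndependent.preimage hc

end Flags

/-! ### An induced orbit has a partition with gaps. -/

section Necessity

variable {n : ℕ} {J : GL (Fin (2 * n + 1)) ℂ}

theorem hasGaps_of_isInduced
    (hJ : (J : Matrix (Fin (2 * n + 1)) (Fin (2 * n + 1)) ℂ).IsSymm)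
    {lam : Nat.Partition (2 * n + 1)} (h : IsInduced J (orbit J lam)) : HasGaps lam := by
  obtain ⟨F, W, A, hP, hPθ, -, ⟨X, ⟨hX, hXn⟩, rfl⟩, -, hdense⟩ := h
  have hlen : 0 < F.length := by
    by_contra h0
    have h1 : (0 : Fin (F.length + 1)) = Fin.last F.length := by
      ext
      simp only [Fin.val_zero, Fin.val_last]
      omega
    have h2 := F.space_last
    rw [← h1, F.space_zero] at h2
    exact bot_ne_top h2
  let i0 : Fin F.length := ⟨0, hlen⟩
  have hi0 : i0.castSucc = 0 := rfl
  set E := F.space i0.succ with hE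
  have hEpos : ∀ k : Fin (F.length + 1), k ≠ 0 → E ≤ F.space k := by
    intro k hk
    refine F.strictMono.monotone ?_
    rw [← Fin.castSucc_lt_iff_succ_le, hi0]
    exact Fin.pos_iff_ne_zero.2 hk
  have hE0 : E ≠ ⊥ := by
    rw [← F.space_zero]
    exact (F.strictMono (show (0 : Fin (F.length + 1)) < i0.succ from Fin.succ_pos _)).ne'
  have hE1 : E ≠ ⊤ := by
    intro h1
    apply hP
    rw [eq_top_iff]
    intro g _
    refine mem_stabilizer_iff.2 fun k u hu => ?_
    by_cases hk : k = 0
    · rw [hk, F.space_zero, Submodule.mem_bot] at hu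
      rw [hu, mulVec_zero]
      exact Submodule.zero_mem _
    · exact hEpos k hk (h1 ▸ Submodule.mem_top)
  -- $P=\theta(P)$ stabilizes $E^\perp$, so $E^\perp$ is a space of the flag. Being nonzero, it
  -- contains the smallest nonzero space $E$, which is therefore isotropic.
  obtain ⟨k, hk⟩ := F.exists_eq_space (M := perp J E) (by
    intro g hg u hu
    rw [← hPθ] at hg
    obtain ⟨g', hg', rfl⟩ := hg
    exact theta_mulVec_mem_perp hJ (hg' i0.succ) hu)
  have hk0 : k ≠ 0 := by
    rintro rfl
    obtain ⟨w, hw, hw0⟩ := exists_mem_perp_ne_zero hJ hE1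
    rw [hk, F.space_zero] at hw
    exact hw0 hw
  have hiso : ∀ u ∈ E, ∀ w ∈ E, form J u w = 0 := fun u hu w hw => by
    have : w ∈ perp J E := hk ▸ hEpos k hk0 hw
    exact this u hu
  -- an element of the orbit in the affine space
  obtain ⟨x, hxO, hxA⟩ : (orbit J lam ∩ (conjOrbit (fixedSubgroup J W.levi) X +
      (F.nilradical ∩ g1 J))).Nonempty := by
    rw [← closure_nonempty_iff]
    refine Set.Nonempty.mono hdense ?_
    refine ⟨X + 0, Set.add_mem_add ⟨1, one_mem _, by simp⟩ ⟨fun i v _ => ?_, ?_⟩⟩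
    · rw [zero_mulVec]
      exact Submodule.zero_mem _
    · rw [mem_g1_iff]
      simp
  obtain ⟨a, ha, z₀, hz₀, rfl⟩ := hxA
  obtain ⟨g, hg, rfl⟩ := ha
  have hgL := ((mem_fixedSubgroup_iff hJ).1 hg).1
  have hstab : ∀ i : Fin F.length, ∀ v ∈ W.compl i, conj g X *ᵥ v ∈ W.compl i := by
    intro i v hv
    have hv' := hv
    rw [← hgL i] at hv'
    obtain ⟨v', hv', rfl⟩ := hv'
    rw [mulVecLin_apply, conj_mulVec]
    exact mem_stabilizer_iff.1 hgL i _ (hX.2 i v' hv')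
  obtain ⟨x, hx⟩ : ∃ x, x = conj g X + z₀ := ⟨_, rfl⟩
  replace hxO : x ∈ orbit J lam := hx ▸ hxO
  have hxE : ∀ u ∈ E, toLin' x u ∈ E := by
    intro u hu
    rw [toLin'_apply, hx, add_mulVec]
    have h1 : z₀ *ᵥ u ∈ F.space i0.castSucc := hz₀.1 i0 u hu
    rw [hi0, F.space_zero, Submodule.mem_bot] at h1
    rw [h1, add_zero]
    exact mulVec_mem_space hstab _ hu
  obtain ⟨hxs, hxn⟩ := mem_nilcone1_iff.1 hxO.1
  obtain ⟨z, s, p, v, hz1, hz2, hz3, hz4, ⟨l, hl⟩, hps, ⟨i, hi⟩, hli, hle⟩ :=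
    exists_generic (form_symm hJ) (form_nondegenerate hJ) (x := toLin' x)
      (fun u w => by simpa using hxs u w) ((Matrix.isNilpotent_toLin'_iff _).2 hxn) hxE hE0 hiso
  set Z := LinearMap.toMatrix' z with hZ
  have hZz : ∀ u, Z *ᵥ u = z u := fun u => by rw [← toLin'_apply, hZ, toLin'_toMatrix']
  have hxZ : toLin' (x + Z) = toLin' x + z := by rw [map_add, hZ, toLin'_toMatrix']
  have hZtr : Z.trace = 0 := by
    have h1 : IsNilpotent (x + Z) := by
      rw [← Matrix.isNilpotent_toLin'_iff, hxZ]
      exact ⟨l, hl⟩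
    have h2 := (Matrix.isNilpotent_trace_of_isNilpotent h1).eq_zero
    have h3 := (Matrix.isNilpotent_trace_of_isNilpotent hxn).eq_zero
    rw [trace_add, h3, zero_add] at h2
    exact h2
  -- The flag $0\subset E\subseteq E^\perp\subset V$ is coarser than $F$, so its nilradical is
  -- contained in that of $F$. The cases are the first step, the steps above $E^\perp=V^k$, and the
  -- steps between $E$ and $E^\perp$.
  have hZn : Z ∈ F.nilradical ∩ g1 J := by
    refine ⟨fun i u hu => ?_, mem_g1_iff.2 ⟨hZtr, fun u w => by rw [hZz, hZz, hz1]⟩⟩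
    rw [hZz]
    by_cases hi1 : i.castSucc = 0
    · have : i = i0 := by
        ext
        have := congrArg Fin.val hi1
        simpa using this
      rw [hz2 u (by rw [this] at hu; exact hu)]
      exact Submodule.zero_mem _
    · rcases le_or_gt k i.castSucc with h1 | h1
      · refine F.strictMono.monotone h1 ?_
        rw [← hk]
        exact fun w hw => hz4 u w hw
      · refine hEpos _ hi1 (hz3 u fun w hw => ?_)
        have h2 := F.strictMono.monotone (Fin.castSucc_lt_iff_succ_le.1 h1) hu
        rw [← hk] at h2
        exact h2 w hw
  have hmem : x + Z ∈ closure (orbit J lam) := by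
    refine closure_mono Set.inter_subset_left (hdense ?_)
    refine ⟨conj g X, ⟨g, hg, rfl⟩, z₀ + Z, ⟨fun i u hu => ?_, ?_⟩,
      by rw [hx]; exact (add_assoc _ _ _).symm⟩
    · rw [add_mulVec]
      exact add_mem (hz₀.1 i u hu) (hZn.1 i u hu)
    · have h1 := mem_g1_iff.1 hz₀.2
      have h2 := mem_g1_iff.1 hZn.2
      refine mem_g1_iff.2 ⟨by rw [trace_add, h1.1, h2.1, add_zero], fun u w => ?_⟩
      rw [add_mulVec, add_mulVec, map_add, map_add, LinearMap.add_apply, h1.2, h2.2]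
  -- Near $x+Z$ the linked chains stay independent, so some $Y\in\mathcal O_\lambda$ has them too,
  -- giving $p\le\lambda$ in partial sums. The block bound for $x\in\mathcal O_\lambda$ gives the
  -- reverse inequality.
  obtain ⟨Y, hY1, hY2⟩ := mem_closure_iff.1 hmem _ (isOpen_linearIndependent_chainFamily s p v)
    (by rw [Set.mem_ofPred_eq, hxZ]; exact hli)
  obtain ⟨vY, hvY⟩ := hY2.2.exists_isChainBasis
  obtain ⟨vx, hvx⟩ := hxO.2.exists_isChainBasis
  have hpl : p = part lam := eq_of_sum_range_eq fun j => by
    refine le_antisymm (hvY.sum_le_of_linearIndependent hps hY1 j) ?_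
    obtain ⟨U, hU1, hU2, hU3⟩ :=
      exists_le_finrank_of_linearIndependent hvx.supp hvx.linearIndependent j
    exact hU3.trans (hle U j hU1 hU2)
  rw [hasGaps_iff]
  exact ⟨i, by rw [← hpl]; exact hi⟩

end Necessity

/-! ### The $\theta$-stable parabolic and Levi subgroups of a Witt pair. -/

section WittFlag

variable {N m : ℕ} {J : GL (Fin N) ℂ} {e f : Fin m → Fin N → ℂ}

theorem mem_perp_range_pairMap (h : IsWittPair (form J) e f)
    (hJ : (J : Matrix (Fin N) (Fin N) ℂ).IsSymm) {w : Fin N → ℂ} :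
    w ∈ perp J (LinearMap.range (pairMap (form J) f e)) ↔ pairMap (form J) e f w = 0 := by
  constructor
  · intro hw
    refine form_nondegenerate hJ _ fun y => ?_
    rw [form_symm hJ, ← h.adjoint]
    exact hw _ ⟨y, rfl⟩
  · rintro hw _ ⟨y, rfl⟩
    rw [h.adjoint, hw, map_zero]

theorem mem_perp_range_mid (h : IsWittPair (form J) e f)
    (hJ : (J : Matrix (Fin N) (Fin N) ℂ).IsSymm) {w : Fin N → ℂ} :
    w ∈ perp J (LinearMap.range (midMap (form J) e f)) ↔ midMap (form J) e f w = 0 := by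
  constructor
  · intro hw
    refine form_nondegenerate hJ _ fun y => ?_
    rw [form_symm hJ, ← h.adjoint_mid]
    exact hw _ ⟨y, rfl⟩
  · rintro hw _ ⟨y, rfl⟩
    rw [h.adjoint_mid, hw, map_zero]

theorem mem_range_pairMap_iff (h : IsWittPair (form J) e f) {w : Fin N → ℂ} :
    w ∈ LinearMap.range (pairMap (form J) f e) ↔
      midMap (form J) e f w = 0 ∧ pairMap (form J) e f w = 0 := by
  constructor
  · rintro ⟨y, rfl⟩
    exact ⟨h.mid_pairMap y, h.swap.pairMap_pairMap_swap y⟩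
  · rintro ⟨h1, h2⟩
    rw [IsWittPair.decomp (B := form J) (e := e) (f := f) w, h1, h2, add_zero, add_zero]
    exact ⟨w, rfl⟩

theorem mem_range_mid_iff (h : IsWittPair (form J) e f) {w : Fin N → ℂ} :
    w ∈ LinearMap.range (midMap (form J) e f) ↔
      pairMap (form J) f e w = 0 ∧ pairMap (form J) e f w = 0 := by
  constructor
  · rintro ⟨y, rfl⟩
    exact ⟨h.pairMap_mid y, h.pairMap_swap_mid y⟩
  · rintro ⟨h1, h2⟩
    rw [IsWittPair.decomp (B := form J) (e := e) (f := f) w, h1, h2, zero_add, add_zero]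
    exact ⟨w, rfl⟩

theorem perp_perp_range_pairMap (h : IsWittPair (form J) e f)
    (hJ : (J : Matrix (Fin N) (Fin N) ℂ).IsSymm) :
    perp J (perp J (LinearMap.range (pairMap (form J) f e))) =
      LinearMap.range (pairMap (form J) f e) := by
  apply le_antisymm
  · intro w hw
    rw [mem_range_pairMap_iff h, ← mem_perp_range_mid h hJ, ← mem_perp_range_pairMap h hJ]
    constructor
    · rintro _ ⟨y, rfl⟩
      exact hw _ ((mem_perp_range_pairMap h hJ).2 (h.pairMap_swap_mid y))
    · rintro _ ⟨y, rfl⟩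
      exact hw _ ((mem_perp_range_pairMap h hJ).2 (h.swap.pairMap_pairMap_swap y))
  · intro w hw u hu
    rw [form_symm hJ]
    exact hu w hw

theorem range_pairMap_le_perp (h : IsWittPair (form J) e f)
    (hJ : (J : Matrix (Fin N) (Fin N) ℂ).IsSymm) :
    LinearMap.range (pairMap (form J) f e) ≤
      perp J (LinearMap.range (pairMap (form J) f e)) := fun _ hw =>
  (mem_perp_range_pairMap h hJ).2 ((mem_range_pairMap_iff h).1 hw).2

theorem range_mid_le_perp (h : IsWittPair (form J) e f)
    (hJ : (J : Matrix (Fin N) (Fin N) ℂ).IsSymm) :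
    LinearMap.range (midMap (form J) e f) ≤
      perp J (LinearMap.range (pairMap (form J) f e)) := fun _ hw =>
  (mem_perp_range_pairMap h hJ).2 ((mem_range_mid_iff h).1 hw).2

/-- The flag `0 ⊂ span e ⊂ (span e)ᗮ ⊂ V` of a Witt pair. -/
noncomputable def wittFlag (h : IsWittPair (form J) e f)
    (hJ : (J : Matrix (Fin N) (Fin N) ℂ).IsSymm)
    (h1 : LinearMap.range (pairMap (form J) f e) ≠ ⊥)
    (h2 : LinearMap.range (midMap (form J) e f) ≠ ⊥) : PartialFlag N where
  length := 3
  space := ![⊥, LinearMap.range (pairMap (form J) f e),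
    perp J (LinearMap.range (pairMap (form J) f e)), ⊤]
  strictMono := by
    rw [Fin.strictMono_iff_lt_succ]
    intro i
    fin_cases i
    · exact bot_lt_iff_ne_bot.2 h1
    · refine lt_of_le_of_ne (range_pairMap_le_perp h hJ) fun heq => h2 ?_
      rw [eq_bot_iff]
      intro w hw
      have h3 : w ∈ LinearMap.range (pairMap (form J) f e) := by
        have heq' : LinearMap.range (pairMap (form J) f e) =
          perp J (LinearMap.range (pairMap (form J) f e)) := heq
        rw [heq']
        exact range_mid_le_perp h hJ hw
      rw [h.mem_range_mid] at hw
      rw [Submodule.mem_bot, ← hw, ((mem_range_pairMap_iff h).1 h3).1]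
    · refine lt_of_le_of_ne le_top fun heq => h1 ?_
      have heq' : perp J (LinearMap.range (pairMap (form J) f e)) = ⊤ := heq
      rw [← perp_perp_range_pairMap h hJ, heq', eq_bot_iff]
      intro w hw
      exact form_nondegenerate hJ w fun y => by
        rw [form_symm hJ]
        exact hw y trivial
  space_zero := rfl
  space_last := rfl

variable (h : IsWittPair (form J) e f) (hJ : (J : Matrix (Fin N) (Fin N) ℂ).IsSymm)
  (h1 : LinearMap.range (pairMap (form J) f e) ≠ ⊥)
  (h2 : LinearMap.range (midMap (form J) e f) ≠ ⊥)

/-- The splitting of the flag of a Witt pair. -/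
noncomputable def wittSplitting : (wittFlag h hJ h1 h2).Splitting where
  compl := ![LinearMap.range (pairMap (form J) f e), LinearMap.range (midMap (form J) e f),
    LinearMap.range (pairMap (form J) e f)]
  disjoint i := by
    fin_cases i
    · exact disjoint_bot_left
    · refine Submodule.disjoint_def.2 fun w hw hw' => ?_
      have hw1 : w ∈ LinearMap.range (pairMap (form J) f e) := hw
      have hw2 : w ∈ LinearMap.range (midMap (form J) e f) := hw'
      rw [← h.mem_range_mid.1 hw2, ((mem_range_pairMap_iff h).1 hw1).1]
    · refine Submodule.disjoint_def.2 fun w hw hw' => ?_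
      have hw1 : w ∈ perp J (LinearMap.range (pairMap (form J) f e)) := hw
      have hw2 : w ∈ LinearMap.range (pairMap (form J) e f) := hw'
      rw [← h.swap.mem_range_pairMap.1 hw2, (mem_perp_range_pairMap h hJ).1 hw1]
  sup_eq i := by
    fin_cases i
    · exact bot_sup_eq _
    · refine le_antisymm (sup_le (range_pairMap_le_perp h hJ) (range_mid_le_perp h hJ)) ?_
      intro w hw
      have hw' : w ∈ perp J (LinearMap.range (pairMap (form J) f e)) := hw
      rw [mem_perp_range_pairMap h hJ] at hw'
      rw [IsWittPair.decomp (B := form J) (e := e) (f := f) w, hw', add_zero]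
      exact add_mem (Submodule.mem_sup_left ⟨w, rfl⟩) (Submodule.mem_sup_right ⟨w, rfl⟩)
    · refine le_antisymm le_top fun w _ => ?_
      rw [IsWittPair.decomp (B := form J) (e := e) (f := f) w]
      refine add_mem (Submodule.mem_sup_left ?_) (Submodule.mem_sup_right ⟨w, rfl⟩)
      exact add_mem (range_pairMap_le_perp h hJ ⟨w, rfl⟩) (range_mid_le_perp h hJ ⟨w, rfl⟩)

theorem theta_theta (hJ : (J : Matrix (Fin N) (Fin N) ℂ).IsSymm)
    (g : Matrix.SpecialLinearGroup (Fin N) ℂ) : theta J (theta J g) = g := by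
  apply Subtype.ext
  refine eq_of_dotProduct_mulVec fun u w => ?_
  congr 1
  rw [← sub_eq_zero]
  refine form_nondegenerate hJ _ fun y => ?_
  obtain ⟨y', rfl⟩ : ∃ y', y = (theta J g : Matrix (Fin N) (Fin N) ℂ) *ᵥ y' :=
    ⟨(((theta J g)⁻¹ : Matrix.SpecialLinearGroup (Fin N) ℂ) : Matrix (Fin N) (Fin N) ℂ) *ᵥ y, by
      rw [mulVec_mulVec, mul_inv_cancel_coe, one_mulVec]⟩
  rw [map_sub, LinearMap.sub_apply, form_theta (theta J g) hJ,
    form_symm hJ ((g : Matrix (Fin N) (Fin N) ℂ) *ᵥ w), form_theta g hJ, form_symm hJ, sub_self]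

theorem thetaStable_of_le (hJ : (J : Matrix (Fin N) (Fin N) ℂ).IsSymm)
    {H : Subgroup (Matrix.SpecialLinearGroup (Fin N) ℂ)} (hH : ∀ g ∈ H, theta J g ∈ H) :
    ThetaStable J H := by
  apply le_antisymm
  · rintro _ ⟨g, hg, rfl⟩
    exact hH g hg
  · intro g hg
    exact ⟨theta J g, hH g hg, theta_theta hJ g⟩

theorem thetaStable_wittFlag_parabolic : ThetaStable J (wittFlag h hJ h1 h2).parabolic := by
  refine thetaStable_of_le hJ fun g hg => mem_stabilizer_iff.2 fun i u hu => ?_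
  fin_cases i
  · have hu' : u = 0 := hu
    rw [hu', mulVec_zero]
    exact Submodule.zero_mem _
  · have hg' := theta_mulVec_mem_perp hJ (hg (2 : Fin 4)) (w := u) (by
      change u ∈ perp J (perp J (LinearMap.range (pairMap (form J) f e)))
      rw [perp_perp_range_pairMap h hJ]
      exact hu)
    change _ ∈ perp J (perp J (LinearMap.range (pairMap (form J) f e))) at hg'
    rw [perp_perp_range_pairMap h hJ] at hg'
    exact hg'
  · exact theta_mulVec_mem_perp hJ (hg (1 : Fin 4)) hu
  · exact Submodule.mem_top

/-- Each summand of the splitting is the intersection of the orthogonal complements of two of the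
three summands, and $\theta(g)$ preserves these complements when $g$ preserves the summands. -/
theorem thetaStable_wittSplitting_levi : ThetaStable J (wittSplitting h hJ h1 h2).levi := by
  refine thetaStable_of_le hJ fun g hg => mem_stabilizer_iff.2 fun i u hu => ?_
  have q1 := fun w => mem_perp_range_pairMap h hJ (w := w)
  have q2 := fun w => mem_perp_range_mid h hJ (w := w)
  have q3 := fun w => mem_perp_range_pairMap h.swap hJ (w := w)
  have r1 : ∀ w, pairMap (form J) e f w = 0 →
      pairMap (form J) e f ((theta J g : Matrix (Fin N) (Fin N) ℂ) *ᵥ w) = 0 := fun w hw => by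
    rw [← q1] at *
    exact theta_mulVec_mem_perp hJ (hg (0 : Fin 3)) hw
  have r2 : ∀ w, midMap (form J) e f w = 0 →
      midMap (form J) e f ((theta J g : Matrix (Fin N) (Fin N) ℂ) *ᵥ w) = 0 := fun w hw => by
    rw [← q2] at *
    exact theta_mulVec_mem_perp hJ (hg (1 : Fin 3)) hw
  have r3 : ∀ w, pairMap (form J) f e w = 0 →
      pairMap (form J) f e ((theta J g : Matrix (Fin N) (Fin N) ℂ) *ᵥ w) = 0 := fun w hw => by
    rw [← q3] at *
    exact theta_mulVec_mem_perp hJ (hg (2 : Fin 3)) hw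
  fin_cases i
  · have hu' := (mem_range_pairMap_iff h).1 hu
    exact (mem_range_pairMap_iff h).2 ⟨r2 u hu'.1, r1 u hu'.2⟩
  · have hu' := (mem_range_mid_iff h).1 hu
    exact (mem_range_mid_iff h).2 ⟨r3 u hu'.1, r1 u hu'.2⟩
  · have hu' := (mem_range_pairMap_iff h.swap).1 hu
    rw [IsWittPair.midMap_swap] at hu'
    refine (mem_range_pairMap_iff h.swap).2 ⟨?_, r3 u hu'.2⟩
    rw [IsWittPair.midMap_swap]
    exact r2 u hu'.1

/-- A transvection that adds a nonzero middle vector $w$ to a vector $u$ of the span of `e` does not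
preserve that span. -/
theorem wittFlag_parabolic_ne_top : (wittFlag h hJ h1 h2).parabolic ≠ ⊤ := by
  intro htop
  obtain ⟨u, hu, hu0⟩ := Submodule.exists_mem_ne_zero_of_ne_bot h1
  obtain ⟨w, hw, hw0⟩ := Submodule.exists_mem_ne_zero_of_ne_bot h2
  have hwu : w ∉ LinearMap.range (pairMap (form J) f e) := fun hw' => hw0 (by
    rw [← h.mem_range_mid.1 hw, ((mem_range_pairMap_iff h).1 hw').1])
  have hu1 : u ∉ Submodule.span ℂ {w} := by
    intro hu1
    obtain ⟨c, rfl⟩ := Submodule.mem_span_singleton.1 hu1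
    have hc : c ≠ 0 := by
      rintro rfl
      exact hu0 (zero_smul _ _)
    exact hwu ((Submodule.smul_mem_iff _ hc).1 hu)
  obtain ⟨φ, hφ, hφ'⟩ := Submodule.exists_dual_map_eq_bot_of_notMem hu1 inferInstance
  have hφw : φ w = 0 := by
    have : φ w ∈ Submodule.map φ (Submodule.span ℂ {w}) :=
      ⟨w, Submodule.mem_span_singleton_self w, rfl⟩
    rw [hφ'] at this
    simpa using this
  obtain ⟨g, hg⟩ := exists_transvection hφw
  have hgP : g ∈ (wittFlag h hJ h1 h2).parabolic := htop ▸ Subgroup.mem_top g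
  have h3 : (g : Matrix (Fin N) (Fin N) ℂ) *ᵥ u ∈ LinearMap.range (pairMap (form J) f e) :=
    mem_stabilizer_iff.1 hgP (1 : Fin 4) u hu
  have h4 := sub_mem h3 hu
  rw [hg, add_sub_cancel_left] at h4
  exact hwu ((Submodule.smul_mem_iff _ hφ).1 h4)

theorem mem_wittFlag_nilradical {Z : Matrix (Fin N) (Fin N) ℂ} :
    Z ∈ (wittFlag h hJ h1 h2).nilradical ↔ IsStrictBlock (form J) e f (toLin' Z) := by
  constructor
  · intro hZ
    refine ⟨fun i => hZ (0 : Fin 3) (e i) ⟨e i, h.pairMap_e i⟩, fun u hu => ?_, fun u i => ?_⟩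
    · rw [← h.range_pairMap]
      exact hZ (1 : Fin 3) u ((mem_perp_range_pairMap h hJ).2 (h.pairMap_eq_zero_iff.2 hu))
    · have h3 : toLin' Z u ∈ perp J (LinearMap.range (pairMap (form J) f e)) :=
        hZ (2 : Fin 3) u trivial
      exact h3 _ ⟨e i, h.pairMap_e i⟩
  · intro hZ i u hu
    fin_cases i
    · have hu' : u ∈ Submodule.span ℂ (Set.range e) := by
        rw [← h.range_pairMap]
        exact hu
      have h3 : Submodule.span ℂ (Set.range e) ≤ LinearMap.ker (toLin' Z) := by
        rw [Submodule.span_le]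
        rintro _ ⟨i, rfl⟩
        exact hZ.kills i
      exact h3 hu'
    · have h3 := hZ.maps u fun i => hu _ ⟨e i, h.pairMap_e i⟩
      rw [← h.range_pairMap] at h3
      exact h3
    · exact (mem_perp_range_pairMap h hJ).2 (h.pairMap_eq_zero_iff.2 fun i => hZ.range u i)

theorem mem_wittSplitting_leviAlgebra {X : Matrix (Fin N) (Fin N) ℂ} (hX : X.trace = 0)
    (f₀ : End ℂ (Fin N → ℂ)) (hf₀ : toLin' X = blockDiag (form J) e f f₀) :
    X ∈ (wittSplitting h hJ h1 h2).leviAlgebra := by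
  refine ⟨hX, fun i u hu => ?_⟩
  rw [← toLin'_apply, hf₀]
  fin_cases i
  · obtain ⟨y, rfl⟩ := hu
    exact ⟨_, h.pairMap_blockDiag f₀ y⟩
  · obtain ⟨y, rfl⟩ := hu
    exact ⟨_, h.mid_blockDiag f₀ y⟩
  · obtain ⟨y, rfl⟩ := hu
    exact ⟨_, h.pairMap_swap_blockDiag f₀ y⟩

end WittFlag

/-! ### Jordan types of the diagonal blocks in a normal basis. -/

section Blocks

variable {V : Type*} [AddCommGroup V] [Module ℂ V] [FiniteDimensional ℂ V]

omit [FiniteDimensional ℂ V] in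
theorem isChainBasis_of_killed {m : ℕ} {D : End ℂ V} {e : Fin m → V}
    (he : LinearIndependent ℂ e) (hD : ∀ i, D (e i) = 0) :
    IsChainBasis D m (fun i => if i < m then 1 else 0) (fun i => if h : i < m then e ⟨i, h⟩ else 0)
      (Submodule.span ℂ (Set.range e)) where
  anti i j hij := by
    dsimp only
    split_ifs <;> omega
  supp i hi := if_neg (by omega)
  pow_apply i := by
    split_ifs with h
    · simpa using hD ⟨i, h⟩
    · simp
  span_eq := by
    apply le_antisymm
    · refine chainSpan_le fun i a => ?_
      split_ifs with h
      · cases a with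
        | zero => exact Submodule.subset_span ⟨⟨i, h⟩, rfl⟩
        | succ a =>
          rw [pow_succ, Module.End.mul_apply, hD, map_zero]
          exact Submodule.zero_mem _
      · rw [map_zero]
        exact Submodule.zero_mem _
    · rw [Submodule.span_le]
      rintro _ ⟨i, rfl⟩
      have := pow_mem_chainSpan D (fun i => if h : i < m then e ⟨i, h⟩ else 0) i 0
      simpa using this
  card_eq := by
    rw [finrank_span_eq_card he, Fintype.card_fin, Finset.sum_range]
    simp

theorem sum_range_ite_lt {s m : ℕ} (h : m ≤ s) :
    ∑ i ∈ Finset.range s, (if i < m then 1 else 0) = m := by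
  rw [← Finset.card_filter]
  have : (Finset.range s).filter (· < m) = Finset.range m := by
    ext i
    simp only [Finset.mem_filter, Finset.mem_range]
    omega
  rw [this, Finset.card_range]

omit [FiniteDimensional ℂ V] in
/-- The ends and the starts of the chains of length at least `2` form a Witt pair. -/
theorem IsNormalBasis.isWittPair {B : LinearMap.BilinForm ℂ V} (hB : ∀ x y, B x y = B y x)
    {f : End ℂ V} (hf : ∀ x y, B (f x) y = B x (f y)) {s : ℕ} {p : ℕ → ℕ} {v : ℕ → V}
    {M : Submodule ℂ V} (hv : IsNormalBasis B f s p v M) {m : ℕ} (hp : ∀ i < m, 2 ≤ p i) :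
    IsWittPair B (fun i : Fin m => (f ^ (p i - 1)) (v i)) (fun i : Fin m => v i) where
  symm := hB
  left i j := by
    have := hp i i.2
    have := hp j j.2
    rw [pow_selfAdjoint hf, ← Module.End.mul_apply, ← pow_add, hv.gram, if_neg]
    rintro ⟨h1, h2⟩
    rw [← h1] at h2
    omega
  right i j := by
    have := hp i i.2
    have h1 := hv.gram i j 0
    rw [if_neg (by omega)] at h1
    exact h1
  dual i j := by
    have := hp i i.2
    rw [pow_selfAdjoint hf, hv.gram]
    congr 1
    rw [eq_iff_iff, Fin.ext_iff]
    omega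

-- Chain vectors pair nontrivially only with their mirror images, so the middle projection kills the
-- two ends of each of the first $m$ chains and fixes all other chain vectors.
omit [FiniteDimensional ℂ V] in
theorem IsNormalBasis.mid_pow {B : LinearMap.BilinForm ℂ V} (hB : ∀ x y, B x y = B y x)
    {f : End ℂ V} (hf : ∀ x y, B (f x) y = B x (f y)) {s : ℕ} {p : ℕ → ℕ} {v : ℕ → V}
    {M : Submodule ℂ V} (hv : IsNormalBasis B f s p v M) {m : ℕ} (hp : ∀ i < m, 2 ≤ p i)
    (i a : ℕ) :
    midMap B (fun i : Fin m => (f ^ (p i - 1)) (v i)) (fun i : Fin m => v i) ((f ^ a) (v i)) =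
      if i < m ∧ (a = 0 ∨ a + 1 = p i) then 0 else (f ^ a) (v i) := by
  have h := hv.isWittPair hB hf hp
  split_ifs with hi
  · obtain ⟨him, ha⟩ := hi
    rcases ha with rfl | ha
    · rw [pow_zero, Module.End.one_apply, ← h.swap.pairMap_e ⟨i, him⟩]
      exact h.mid_pairMap_swap _
    · have e1 : (f ^ a) (v i) = (f ^ (p i - 1)) (v i) := by
        rw [← ha, Nat.add_sub_cancel]
      have e2 := h.pairMap_e ⟨i, him⟩
      simp only at e2
      rw [e1, ← e2]
      exact h.mid_pairMap _
  · have e1 : pairMap B (fun i : Fin m => v i) (fun i : Fin m => (f ^ (p i - 1)) (v i))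
        ((f ^ a) (v i)) = 0 := by
      refine h.swap.pairMap_eq_zero_iff.2 fun j => ?_
      rw [hv.gram, if_neg]
      rintro ⟨h1, h2⟩
      exact hi ⟨h1 ▸ j.2, Or.inr (by rw [h2, h1])⟩
    have e2 : pairMap B (fun i : Fin m => (f ^ (p i - 1)) (v i)) (fun i : Fin m => v i)
        ((f ^ a) (v i)) = 0 := by
      refine h.pairMap_eq_zero_iff.2 fun j => ?_
      have := hp j j.2
      rw [pow_selfAdjoint hf, ← Module.End.mul_apply, ← pow_add, hv.gram, if_neg]
      rintro ⟨h1, h2⟩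
      exact hi ⟨h1 ▸ j.2, Or.inl (by omega)⟩
    simp [midMap, e1, e2]

theorem finrank_le_add_add {ι : Type*} [Fintype ι] [DecidableEq ι] {B : LinearMap.BilinForm ℂ V}
    {e f : ι → V} : finrank ℂ V ≤ finrank ℂ (LinearMap.range (pairMap B f e)) +
      finrank ℂ (LinearMap.range (midMap B e f)) +
      finrank ℂ (LinearMap.range (pairMap B e f)) := by
  have h1 : (⊤ : Submodule ℂ V) ≤ LinearMap.range (pairMap B f e) ⊔
      LinearMap.range (midMap B e f) ⊔ LinearMap.range (pairMap B e f) := by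
    intro u _
    rw [IsWittPair.decomp (B := B) (e := e) (f := f) u]
    exact add_mem (Submodule.mem_sup_left (add_mem (Submodule.mem_sup_left ⟨u, rfl⟩)
      (Submodule.mem_sup_right ⟨u, rfl⟩))) (Submodule.mem_sup_right ⟨u, rfl⟩)
  have h2 := Submodule.finrank_mono h1
  rw [finrank_top] at h2
  have h3 := Submodule.finrank_add_le_finrank_add_finrank
    (LinearMap.range (pairMap B f e) ⊔ LinearMap.range (midMap B e f))
    (LinearMap.range (pairMap B e f))
  have h4 := Submodule.finrank_add_le_finrank_add_finrank
    (LinearMap.range (pairMap B f e)) (LinearMap.range (midMap B e f))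
  omega

omit [FiniteDimensional ℂ V] in
theorem finrank_range_pairMap_le {m : ℕ} {B : LinearMap.BilinForm ℂ V} {e f : Fin m → V}
    (h : IsWittPair B e f) : finrank ℂ (LinearMap.range (pairMap B f e)) ≤ m := by
  rw [h.range_pairMap]
  exact (finrank_range_le_card (R := ℂ) e).trans_eq (Fintype.card_fin m)

/-- The Jordan type of the diagonal blocks for the Witt pair of `IsNormalBasis.isWittPair`. -/
theorem IsNormalBasis.exists_isChainBasis_blocks {B : LinearMap.BilinForm ℂ V}
    (hB : ∀ x y, B x y = B y x) {f : End ℂ V} (hf : ∀ x y, B (f x) y = B x (f y)) {s : ℕ}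
    {p : ℕ → ℕ} {v : ℕ → V} (hv : IsNormalBasis B f s p v ⊤) {m : ℕ} (hp : ∀ i < m, 2 ≤ p i)
    (hgap : ∀ i, i + 1 = m → p m + 2 ≤ p i) {e g : Fin m → V}
    (he : e = fun i : Fin m => (f ^ (p i - 1)) (v i)) (hg : g = fun i : Fin m => v i) :
    (∃ v₁, IsChainBasis (blockDiag B e g f) m (fun i => if i < m then 1 else 0) v₁
      (LinearMap.range (pairMap B g e))) ∧
    (∃ v₂, IsChainBasis (blockDiag B e g f) s (fun i => if i < m then p i - 2 else p i) v₂
      (LinearMap.range (midMap B e g))) ∧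
    (∃ v₃, IsChainBasis (blockDiag B e g f) m (fun i => if i < m then 1 else 0) v₃
      (LinearMap.range (pairMap B e g))) := by
  have h : IsWittPair B e g := he ▸ hg ▸ hv.isWittPair hB hf hp
  set D := blockDiag B e g f with hD
  have hms : m ≤ s := by
    by_contra hms
    have h1 := hp s (by omega)
    rw [hv.supp s le_rfl] at h1
    omega
  refine ⟨?_, ?_, ?_⟩
  · rw [h.range_pairMap]
    refine ⟨_, isChainBasis_of_killed (linearIndependent_of_dual h.swap.dual) fun i => ?_⟩
    have := hp i i.2
    rw [← h.pairMap_e i, hD, h.blockDiag_pairMap, h.pairMap_e i, he]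
    simp only
    rw [← Module.End.mul_apply f, ← pow_succ', pow_apply_eq_zero_of_le (hv.pow_apply i) (by omega),
      map_zero]
  -- The middle block inherits the interior of each of the first $m$ chains, hence starts at
  -- $f(v_i)$ there, and the whole of every other chain.
  · set w : ℕ → V := fun i => midMap B e g ((f ^ (if i < m then 1 else 0)) (v i)) with hw
    have hmid := hv.mid_pow hB hf hp
    rw [← he, ← hg] at hmid
    have hpow : ∀ i a, (D ^ a) (w i) = midMap B e g ((f ^ (a + if i < m then 1 else 0)) (v i)) := by
      intro i a
      induction a with
      | zero => simp [hw]
      | succ a ih =>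
        rw [pow_succ', Module.End.mul_apply, ih, hD, h.blockDiag_mid, hmid]
        by_cases hi : i < m ∧ (a + (if i < m then 1 else 0) = 0 ∨
            a + (if i < m then 1 else 0) + 1 = p i)
        · rw [if_pos hi, map_zero, map_zero, pow_apply_eq_zero_of_le (hv.pow_apply i), map_zero]
          rw [if_pos hi.1] at hi ⊢
          omega
        · rw [if_neg hi, ← Module.End.mul_apply f, ← pow_succ', Nat.add_right_comm]
    have hpw : ∀ i, (D ^ (if i < m then p i - 2 else p i)) (w i) = 0 := by
      intro i
      rw [hpow]
      by_cases hi : i < m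
      · have := hp i hi
        rw [if_pos hi, if_pos hi, hmid, if_pos ⟨hi, by omega⟩]
      · rw [if_neg hi, if_neg hi, add_zero, hv.pow_apply, map_zero]
    have hsupp : ∀ i, s ≤ i → (if i < m then p i - 2 else p i) = 0 := by
      intro i hi
      rw [if_neg (by omega), hv.supp i hi]
    have hspan : chainSpan D w = LinearMap.range (midMap B e g) := by
      apply le_antisymm
      · refine chainSpan_le fun i a => ?_
        rw [hpow]
        exact ⟨_, rfl⟩
      · rw [LinearMap.range_eq_map, ← hv.span_eq, Submodule.map_le_iff_le_comap]
        refine chainSpan_le fun i a => ?_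
        rw [Submodule.mem_comap]
        by_cases hi : i < m ∧ a = 0
        · rw [hmid, if_pos ⟨hi.1, Or.inl hi.2⟩]
          exact Submodule.zero_mem _
        · have := hpow i (a - if i < m then 1 else 0)
          rw [Nat.sub_add_cancel (by split_ifs <;> omega)] at this
          rw [← this]
          exact pow_mem_chainSpan D w i _
    refine ⟨w, antitone_nat_of_succ_le fun i => ?_, hsupp, hpw, hspan, ?_⟩
    · have h1 := hv.anti (Nat.le_succ i)
      simp only [Nat.succ_eq_add_one] at h1
      -- Only at this boundary can shortening by $2$ destroy the decreasing order; the gap prevents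
      -- it.
      by_cases him : i + 1 = m
      · have h2 := hgap i him
        rw [if_neg (by omega), if_pos (by omega), him]
        omega
      · split_ifs <;> omega
    -- The chains span the middle block, which bounds its dimension above; the outer blocks have
    -- dimension at most $m$ each, which bounds it below by the same number.
    · have h1 := finrank_chainSpan_le hsupp hpw
      rw [hspan] at h1
      have h2 := finrank_le_add_add (B := B) (e := e) (f := g)
      have h3 := finrank_range_pairMap_le h
      have h4 := finrank_range_pairMap_le h.swap
      have h5 : ∑ i ∈ Finset.range s, p i =
          ∑ i ∈ Finset.range s, (if i < m then p i - 2 else p i) + m + m := by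
        have h6 := sum_range_ite_lt hms
        have h7 : ∀ i ∈ Finset.range s, p i = (if i < m then p i - 2 else p i) +
            (if i < m then 1 else 0) + (if i < m then 1 else 0) := fun i _ => by
          split_ifs with hi
          · have := hp i hi
            omega
          · rfl
        rw [Finset.sum_congr rfl h7, Finset.sum_add_distrib, Finset.sum_add_distrib, h6]
      rw [hv.card_eq, finrank_top] at h5
      omega
  · rw [h.swap.range_pairMap]
    refine ⟨_, isChainBasis_of_killed (linearIndependent_of_dual h.dual) fun i => ?_⟩
    rw [← h.swap.pairMap_e i, hD, h.blockDiag_pairMap_swap, h.swap.pairMap_e i,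
      h.pairMap_eq_zero_iff]
    intro j
    have := hp j j.2
    rw [he, hg]
    simp only
    rw [pow_selfAdjoint hf, ← Module.End.mul_apply, ← pow_succ, hv.gram, if_neg]
    omega

end Blocks

/-! ### Conjugation and the density condition. -/

section Conj

variable {N : ℕ} {J : GL (Fin N) ℂ} {X : Matrix (Fin N) (Fin N) ℂ}

theorem conj_add (g : Matrix.SpecialLinearGroup (Fin N) ℂ) (X Y : Matrix (Fin N) (Fin N) ℂ) :
    conj g (X + Y) = conj g X + conj g Y := by
  simp only [conj, mul_add, add_mul]

theorem conj_conj (g h : Matrix.SpecialLinearGroup (Fin N) ℂ) (X : Matrix (Fin N) (Fin N) ℂ) :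
    conj g (conj h X) = conj (g * h) X := by
  simp only [conj, _root_.mul_inv_rev, Matrix.SpecialLinearGroup.coe_mul, mul_assoc]

theorem conj_conj_inv (g : Matrix.SpecialLinearGroup (Fin N) ℂ) (X : Matrix (Fin N) (Fin N) ℂ) :
    conj g (conj g⁻¹ X) = X := by
  rw [conj_conj, mul_inv_cancel]
  simp [conj]

theorem continuous_conj (g : Matrix.SpecialLinearGroup (Fin N) ℂ) : Continuous (conj g) :=
  (continuous_const.matrix_mul continuous_id).matrix_mul continuous_const

theorem trace_conj (g : Matrix.SpecialLinearGroup (Fin N) ℂ) (X : Matrix (Fin N) (Fin N) ℂ) :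
    (conj g X).trace = X.trace := by
  rw [conj, trace_mul_comm, ← mul_assoc, inv_mul_cancel_coe, one_mul]

theorem conj_selfAdjoint {g : Matrix.SpecialLinearGroup (Fin N) ℂ} (hg : g ∈ SO J)
    (hX : ∀ u w, form J (X *ᵥ u) w = form J u (X *ᵥ w)) (u w : Fin N → ℂ) :
    form J (conj g X *ᵥ u) w = form J u (conj g X *ᵥ w) := by
  have e : ∀ y : Fin N → ℂ, ∃ y', y = (g : Matrix (Fin N) (Fin N) ℂ) *ᵥ y' := fun y =>
    ⟨((g⁻¹ : Matrix.SpecialLinearGroup (Fin N) ℂ) : Matrix (Fin N) (Fin N) ℂ) *ᵥ y, by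
      rw [mulVec_mulVec, mul_inv_cancel_coe, one_mulVec]⟩
  obtain ⟨u, rfl⟩ := e u
  obtain ⟨w, rfl⟩ := e w
  rw [conj_mulVec, conj_mulVec, mem_SO_iff.1 hg, mem_SO_iff.1 hg, hX]

theorem conj_mem_g1 {g : Matrix.SpecialLinearGroup (Fin N) ℂ} (hg : g ∈ SO J) (hX : X ∈ g1 J) :
    conj g X ∈ g1 J := by
  rw [mem_g1_iff] at *
  exact ⟨(trace_conj g X).trans hX.1, conj_selfAdjoint hg hX.2⟩

theorem conj_mem_nilradical {F : PartialFlag N} {W : F.Splitting}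
    {g : Matrix.SpecialLinearGroup (Fin N) ℂ} (hg : g ∈ W.levi) (hX : X ∈ F.nilradical) :
    conj g X ∈ F.nilradical := by
  intro i u hu
  rw [conj, ← mulVec_mulVec, ← mulVec_mulVec]
  exact mulVec_mem_space (mem_stabilizer_iff.1 hg) _
    (hX i _ (mulVec_mem_space (mem_stabilizer_iff.1 (W.levi.inv_mem hg)) _ hu))

/-- The density condition for an induced orbit has to be checked for one element only. -/
theorem add_subset_closure (hJ : (J : Matrix (Fin N) (Fin N) ℂ).IsSymm) {F : PartialFlag N}
    {W : F.Splitting} {O : Set (Matrix (Fin N) (Fin N) ℂ)}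
    (hO : ∀ g ∈ SO J, ∀ Y ∈ O, conj g Y ∈ O)
    (h : ∀ Z ∈ F.nilradical ∩ g1 J, X + Z ∈ closure (O ∩
      {Y | ∃ Z ∈ F.nilradical ∩ g1 J, Y = X + Z})) :
    conjOrbit (fixedSubgroup J W.levi) X + (F.nilradical ∩ g1 J) ⊆
      closure (O ∩ (conjOrbit (fixedSubgroup J W.levi) X + (F.nilradical ∩ g1 J))) := by
  have hstab : ∀ g ∈ fixedSubgroup J W.levi, ∀ Z ∈ F.nilradical ∩ g1 J,
      conj g Z ∈ F.nilradical ∩ g1 J := fun g hg Z hZ => by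
    rw [mem_fixedSubgroup_iff hJ] at hg
    exact ⟨conj_mem_nilradical hg.1 hZ.1, conj_mem_g1 hg.2 hZ.2⟩
  rintro _ ⟨_, ⟨g, hg, rfl⟩, Z, hZ, rfl⟩
  change conj g X + Z ∈ _
  rw [← conj_conj_inv g Z, ← conj_add]
  refine map_mem_closure (continuous_conj g) (h _ (hstab _ (inv_mem hg) Z hZ)) ?_
  rintro _ ⟨hY, Z', hZ', rfl⟩
  refine ⟨hO g ((mem_fixedSubgroup_iff hJ).1 hg).2 _ hY, ?_⟩
  rw [conj_add]
  exact Set.add_mem_add ⟨g, hg, rfl⟩ (hstab g hg Z' hZ')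

end Conj

/-! ### Density along a line and identification of the Jordan type. -/

section Density

variable {N : ℕ}

/-- On a line, linear independence of given chains is a dense condition. -/
theorem dense_linearIndependent_chainFamily (A Z : Matrix (Fin N) (Fin N) ℂ) {s : ℕ} {p : ℕ → ℕ}
    {v : ℕ → Fin N → ℂ} (hp : ∑ i ∈ Finset.range s, p i = N)
    (h : LinearIndependent ℂ (chainFamily (toLin' (A + Z)) s p v)) :
    Dense {t : ℂ | LinearIndependent ℂ (chainFamily (toLin' (A + t • Z)) s p v)} := by
  obtain ⟨σ⟩ : Nonempty (Fin N ≃ Σ i : Fin s, Fin (p i)) :=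
    Fintype.card_eq.1 (by rw [card_sigma_fin, hp, Fintype.card_fin])
  let M : Matrix (Fin N) (Fin N) (Polynomial ℂ) :=
    (Polynomial.C : ℂ →+* Polynomial ℂ).mapMatrix A +
      (Polynomial.X : Polynomial ℂ) • (Polynomial.C : ℂ →+* Polynomial ℂ).mapMatrix Z
  -- The rows of `P` are the chain vectors as polynomials in $t$, so independence means that $\det
  -- P$ does not vanish at $t$. It is nonzero at $t=1$, so only finitely many $t$ are excluded.
  let P : Matrix (Fin N) (Fin N) (Polynomial ℂ) :=
    Matrix.of fun q : Fin N => (M ^ ((σ q).2 : ℕ)) *ᵥ fun j => Polynomial.C (v (σ q).1 j)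
  have hM : ∀ t : ℂ, (Polynomial.evalRingHom t).mapMatrix M = A + t • Z := fun t => by
    ext i j
    simp [M]
    exact mul_comm _ _
  have hP : ∀ t : ℂ, (Polynomial.evalRingHom t).mapMatrix P =
      Matrix.of fun q => chainFamily (toLin' (A + t • Z)) s p v (σ q) := fun t => by
    ext q j
    have h1 : chainFamily (toLin' (A + t • Z)) s p v (σ q) =
        ((A + t • Z) ^ ((σ q).2 : ℕ)) *ᵥ (v (σ q).1) := by
      rw [chainFamily, ← toLin'_pow, toLin'_apply]
    rw [of_apply, h1, ← hM, ← map_pow]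
    have h2 := RingHom.map_mulVec (Polynomial.evalRingHom t) (M ^ ((σ q).2 : ℕ))
      (fun j => Polynomial.C (v (σ q).1 j)) j
    have h3 : (Polynomial.evalRingHom t) ∘ (fun j => Polynomial.C (v (σ q).1 j)) = v (σ q).1 := by
      ext
      simp
    rw [h3] at h2
    exact h2
  have key : ∀ t : ℂ, LinearIndependent ℂ (chainFamily (toLin' (A + t • Z)) s p v) ↔
      P.det.eval t ≠ 0 := fun t => by
    rw [← Polynomial.coe_evalRingHom, RingHom.map_det, hP, ← isUnit_iff_ne_zero,
      ← Matrix.isUnit_iff_isUnit_det, ← Matrix.linearIndependent_rows_iff_isUnit]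
    exact (linearIndependent_equiv σ).symm
  have hP0 : P.det ≠ 0 := by
    intro h0
    rw [← one_smul ℂ Z, key, h0] at h
    exact h Polynomial.eval_zero
  simp only [key]
  have hfin : {t | P.det.IsRoot t}.Finite := Polynomial.finite_setOfPred_isRoot hP0
  exact hfin.countable.dense_compl ℂ

variable {m : ℕ} {J : GL (Fin N) ℂ} {e f : Fin m → Fin N → ℂ} {lam : Nat.Partition N}

/-- A self-adjoint nilpotent matrix whose Jordan type is bounded from below by independent chains
and from above by the types of its diagonal blocks. -/
theorem mem_orbit_of_isStrictBlock (h : IsWittPair (form J) e f) {x : End ℂ (Fin N → ℂ)}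
    {k : ℕ} (hD : blockDiag (form J) e f x ^ k = 0) {Y : Matrix (Fin N) (Fin N) ℂ}
    (hY : ∀ u w, form J (Y *ᵥ u) w = form J u (Y *ᵥ w))
    (hz : IsStrictBlock (form J) e f (toLin' Y - blockDiag (form J) e f x))
    {s₁ s₂ s₃ : ℕ} {p₁ p₂ p₃ : ℕ → ℕ} {v₁ v₂ v₃ : ℕ → Fin N → ℂ}
    (b₁ : IsChainBasis (blockDiag (form J) e f x) s₁ p₁ v₁ (LinearMap.range (pairMap (form J) f e)))
    (b₂ : IsChainBasis (blockDiag (form J) e f x) s₂ p₂ v₂ (LinearMap.range (midMap (form J) e f)))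
    (b₃ : IsChainBasis (blockDiag (form J) e f x) s₃ p₃ v₃ (LinearMap.range (pairMap (form J) e f)))
    (hp : ∀ i, p₁ i + p₂ i + p₃ i = part lam i) {s : ℕ} {v : ℕ → Fin N → ℂ}
    (hs : ∀ i, s ≤ i → part lam i = 0)
    (hli : LinearIndependent ℂ (chainFamily (toLin' Y) s (part lam) v)) : Y ∈ orbit J lam := by
  have hpow := hz.pow_eq_zero h hD
  obtain ⟨r, ρ, w, hρ⟩ := exists_isChainBasis (f := toLin' Y) (M := ⊤) (fun _ _ => trivial)
    ⟨k + k + k, fun u _ => by rw [hpow]; rfl⟩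
  have hρ' : ρ = part lam := eq_of_sum_range_eq fun j => by
    refine le_antisymm ?_ (hρ.sum_le_of_linearIndependent hs hli j)
    obtain ⟨U, hU1, hU2, hU3⟩ :=
      exists_le_finrank_of_linearIndependent hρ.supp hρ.linearIndependent j
    refine hU3.trans ((hz.finrank_le h b₁ b₂ b₃ hU1 hU2).trans_eq ?_)
    exact Finset.sum_congr rfl fun i _ => hp i
  subst hρ'
  exact ⟨mem_nilcone1_iff.2 ⟨hY, (Matrix.isNilpotent_toLin'_iff _).1 ⟨_, hpow⟩⟩,
    hasJordanType_of_isChainBasis hρ⟩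

end Density

/-! ### A partition with gaps gives an induced orbit. -/

section Sufficiency

variable {n : ℕ} {J : GL (Fin (2 * n + 1)) ℂ}

theorem isInduced_of_hasGaps (hJ : (J : Matrix (Fin (2 * n + 1)) (Fin (2 * n + 1)) ℂ).IsSymm)
    {lam : Nat.Partition (2 * n + 1)} (hgap : HasGaps lam) : IsInduced J (orbit J lam) := by
  obtain ⟨i₀, hi₀⟩ := (hasGaps_iff lam).1 hgap
  obtain ⟨m, hm⟩ : ∃ m, m = i₀ + 1 := ⟨_, rfl⟩
  obtain ⟨X, hX⟩ := orbit_nonempty hJ lam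
  obtain ⟨s, v, hv⟩ := exists_isNormalBasis_of_mem_orbit hJ hX
  obtain ⟨hXs, hXn⟩ := mem_nilcone1_iff.1 hX.1
  have hp : ∀ i < m, 2 ≤ part lam i := fun i hi => by
    have := part_antitone lam (show i ≤ i₀ by omega)
    omega
  have hself : ∀ u w, form J (toLin' X u) w = form J u (toLin' X w) := fun u w => hXs u w
  obtain ⟨e, he⟩ : ∃ e : Fin m → Fin (2 * n + 1) → ℂ,
      e = fun i : Fin m => (toLin' X ^ (part lam i - 1)) (v i) := ⟨_, rfl⟩
  obtain ⟨f, hf⟩ : ∃ f : Fin m → Fin (2 * n + 1) → ℂ, f = fun i : Fin m => v i := ⟨_, rfl⟩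
  have h : IsWittPair (form J) e f := he ▸ hf ▸ hv.isWittPair (form_symm hJ) hself hp
  obtain ⟨⟨v₁, b₁⟩, ⟨v₂, b₂⟩, ⟨v₃, b₃⟩⟩ :=
    hv.exists_isChainBasis_blocks (form_symm hJ) hself hp (fun i hi => by
      obtain rfl : i = i₀ := by omega
      rw [hm]
      exact hi₀) he hf
  set D := blockDiag (form J) e f (toLin' X) with hD
  have hXD : IsStrictBlock (form J) e f (toLin' X - D) :=
    IsStrictBlock.sub_blockDiag h hself fun i => by
      have := hp i i.2
      have h0 : toLin' X (e i) = 0 := by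
        rw [he]
        simp only
        rw [← Module.End.mul_apply, ← pow_succ']
        exact pow_apply_eq_zero_of_le (hv.pow_apply i) (by omega)
      rw [h0]
      exact Submodule.zero_mem _
  obtain ⟨k, hk⟩ := (Matrix.isNilpotent_toLin'_iff _).2 hXn
  have hDk : D ^ k = 0 := hXD.blockDiag_pow_eq_zero h hk
  have hsum : ∑ i ∈ Finset.range s, part lam i = 2 * n + 1 := by
    rw [hv.card_eq, finrank_top, finrank_fin_fun]
  have h1 : LinearMap.range (pairMap (form J) f e) ≠ ⊥ := by
    intro h1
    have h2 : e ⟨0, by omega⟩ = 0 := by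
      rw [← Submodule.mem_bot ℂ, ← h1]
      exact ⟨_, h.pairMap_e _⟩
    have h3 := h.dual ⟨0, by omega⟩ ⟨0, by omega⟩
    rw [h2] at h3
    simp at h3
  -- If the middle block were zero, all nonzero parts would equal $2$, and $N$ would be even.
  have h2 : LinearMap.range (midMap (form J) e f) ≠ ⊥ := by
    intro h2
    have h3 := b₂.card_eq
    rw [h2, finrank_bot, Finset.sum_eq_zero_iff] at h3
    have h4 : ∀ i ∈ Finset.range s, part lam i = 2 * if i < m then 1 else 0 := fun i hi => by
      have h5 := h3 i hi
      split_ifs at h5 ⊢ with hi'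
      · have := hp i hi'
        omega
      · exact h5
    rw [Finset.sum_congr rfl h4, ← Finset.mul_sum] at hsum
    omega
  obtain ⟨X', hX'⟩ : ∃ X', X' = LinearMap.toMatrix' D := ⟨_, rfl⟩
  have hX'D : toLin' X' = D := by rw [hX', toLin'_toMatrix']
  have hX's : ∀ u w, form J (X' *ᵥ u) w = form J u (X' *ᵥ w) := fun u w => by
    rw [← toLin'_apply, ← toLin'_apply, hX'D]
    exact h.blockDiag_selfAdjoint hself u w
  have hX'n : X' ∈ nilcone1 J := mem_nilcone1_iff.2
    ⟨hX's, (Matrix.isNilpotent_toLin'_iff _).1 (hX'D ▸ ⟨k, hDk⟩)⟩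
  refine ⟨wittFlag h hJ h1 h2, wittSplitting h hJ h1 h2, _, wittFlag_parabolic_ne_top h hJ h1 h2,
    thetaStable_wittFlag_parabolic h hJ h1 h2, thetaStable_wittSplitting_levi h hJ h1 h2,
    ⟨X', ⟨mem_wittSplitting_leviAlgebra h hJ h1 h2 hX'n.1.1 (toLin' X) hX'D, hX'n⟩, rfl⟩,
    isNilpotentOrbit_orbit hJ lam, ?_⟩
  refine add_subset_closure hJ (fun g hg Y hY => conj_mem_orbit hg hY) ?_
  rintro Z ⟨hZ1, hZ2⟩
  rw [mem_wittFlag_nilradical] at hZ1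
  rw [mem_g1_iff] at hZ2
  -- The line $X'+Z+tT$ runs from $X'+Z$ at $t=0$ to $X$ at $t=1$ inside $X'+(\mathfrak n_P)_1$. At
  -- $t=1$ the chains of $X$ are independent, so $t=0$ is a limit of parameters where they are.
  obtain ⟨T, hT⟩ : ∃ T, T = X - X' - Z := ⟨_, rfl⟩
  have hdense := dense_linearIndependent_chainFamily (X' + Z) T hsum (v := v) (by
    rw [show X' + Z + T = X by rw [hT]; abel]
    exact hv.linearIndependent)
  have hcont : Continuous fun t : ℂ => X' + Z + t • T := by fun_prop
  have h0 := map_mem_closure hcont (hdense 0) (t := orbit J lam ∩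
    {Y | ∃ Z ∈ (wittFlag h hJ h1 h2).nilradical ∩ g1 J, Y = X' + Z}) ?_
  · simpa using h0
  intro t ht
  have hTs : ∀ u w, form J (T *ᵥ u) w = form J u (T *ᵥ w) := fun u w => by
    simp only [hT, sub_mulVec, map_sub, LinearMap.sub_apply, hXs, hX's, hZ2.2]
  have hTtr : T.trace = 0 := by
    rw [hT, trace_sub, trace_sub, hZ2.1, hX.1.1.1, hX'n.1.1, sub_zero, sub_zero]
  have hZT : IsStrictBlock (form J) e f (toLin' (Z + t • T)) := by
    rw [map_add, map_smul, hT, map_sub, map_sub, hX'D, sub_eq_add_neg _ (toLin' Z)]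
    exact hZ1.add ((hXD.add hZ1.neg).smul t)
  have hY : ∀ u w, form J ((X' + Z + t • T) *ᵥ u) w = form J u ((X' + Z + t • T) *ᵥ w) :=
    fun u w => by
      simp only [add_mulVec, smul_mulVec, map_add, map_smul, LinearMap.add_apply,
        LinearMap.smul_apply, hX's, hTs, hZ2.2]
  refine ⟨mem_orbit_of_isStrictBlock h hDk hY ?_ b₁ b₂ b₃ (fun i => ?_) hv.supp ht,
    Z + t • T, ⟨(mem_wittFlag_nilradical h hJ h1 h2).2 hZT, mem_g1_iff.2 ⟨?_, fun u w => ?_⟩⟩,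
    add_assoc _ _ _⟩
  · simp only
    rw [add_assoc, map_add, hX'D, add_sub_cancel_left]
    exact hZT
  · split_ifs with hi
    · have := hp i hi
      omega
    · omega
  · rw [trace_add, trace_smul, hTtr, hZ2.1, smul_zero, add_zero]
  · simp only [add_mulVec, smul_mulVec, map_add, map_smul, LinearMap.add_apply,
      LinearMap.smul_apply, hTs, hZ2.2]

end Sufficiency

end SymPair

theorem proposition2p3 (n : ℕ) (J : GL (Fin (2 * n + 1)) ℂ)
    (hJ : (J : Matrix (Fin (2 * n + 1)) (Fin (2 * n + 1)) ℂ).IsSymm)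
    (lam : Nat.Partition (2 * n + 1)) :
    SymPair.IsNilpotentOrbit J (SymPair.orbit J lam) ∧
      (SymPair.IsInduced J (SymPair.orbit J lam) ↔ SymPair.HasGaps lam) :=
  ⟨SymPair.isNilpotentOrbit_orbit hJ lam, SymPair.hasGaps_of_isInduced hJ,
    SymPair.isInduced_of_hasGaps hJ⟩
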